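/- Let $\alpha\in(0,1)$. **Setting.** Write $x=(x^{(1)},x^{(2)},x^{(3)})$, $r=|x'|=\sqrt{(x^{(1)})^2+(x^{(2)})^2}$, and let $e_r,e_\theta,e_3$ be the cylindrical unit vectors. For $a<0<b$ let $D=\{r<1,\ a<x^{(3)}<b\}$; its side boundary is $\{r=1,\ a<x^{(3)}<b\}$. Let $T_0>0$. A *solution* is a velocity field $v$ with a pressure $p$, smooth on $[0,T_0)$ up to the side boundary, that solves the incompressible Euler equations $\partial_t v+v\cdot\nabla v+\nabla p=0$, $\nabla\cdot v=0$ in the cylinder, is axially symmetric (its components $v^r,v^\theta,v^{(3)}$ depend on $(r,x^{(3)},t)$ only), satisfies $v\cdot n=0$ on $r=1$, and is smoothly periodic in $x^{(3)}$ with period $b-a$. For $\gamma\in(0,1)$, $C^\gamma$ functions are the bounded $\gamma$-Hölder functions (in space-time: for the parabolic distance $|x-y|+\sqrt{|t-s|}$), and $C^{2,1,\gamma}_{x,t}$ is the class of $f$ such that $f,\nabla f,\nabla^2 f,\partial_t f$ are in $C^\gamma$; local classes ask this on every compact subset of the domain. **Blow-up sequences.** *Blow-up points* (off the axis) are points $x_k\in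 D\cup\{\text{side boundary}\}$ and times $t_k\in[0,T_0)$ with $x_k\to x_*\in D\cup\{\text{side boundary}\}$, $t_k\to T_0$, $|x_k'|>\delta$ for some fixed $\delta>0$, and $|v(x_k,t_k)|\to\infty$. Let $Q_k>0$ satisfy $c_0^{-1}|v(x_k,t_k)|\le Q_k\le c_0|v(x_k,t_k)|$ for a fixed $c_0\ge1$, and put, for $\tilde t\le 0$, $$\tilde v_k(\tilde x,\tilde t)=Q_k^{-1}\,v\big(Q_k^{-(1-\alpha)/\alpha}\tilde x+x_k,\ Q_k^{-1/\alpha}\tilde t+t_k\big).$$ The points are *near maximal* if, for a fixed $c>0$, $|v(x_k,t_k)|\ge c\,|v(y,s)|$ for all $y\in D$, $s\in[0,t_k]$. They are *anchor points* if there are a continuous nondecreasing $\lambda:[0,\infty)\to[1,\infty)$ and $\kappa>0$ with $|\tilde v_k(\tilde x,\tilde t)|\le\lambda(|\tilde x|^2+|\tilde t|)\,|\tilde v_k(0,0)|$ for all $\tilde x$, $\tilde t\le0$ whose unscaled variables lie in $D\times[0,T_0)$ and which satisfy $|\tilde x|^2+|\tilde t|\le\kappa k$. They *stay within finite distance of the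 side boundary after blow-up* if $Q_k^{(1-\alpha)/\alpha}(1-|x_k'|)$ is bounded. A *blow-up limit* is a locally uniform limit of a subsequence of $(\tilde v_k)$ on (limit of the scaled domains) $\times(-\infty,0]$, where the limit of the scaled domains is the set of points having a neighbourhood that is eventually contained in them. **(1)** For no $\gamma\in(0,1)$, $a<0<b$ and $T_0>0$ is there a solution $v$ of the form $$v(x,t)=\frac1{(T_0-t)^\alpha}V\Big(\frac{x}{(T_0-t)^{1-\alpha}}\Big)+\frac{g(t)}{(T_0-t)^\alpha}W(x,t),\qquad (x,t)\in D\times[0,T_0),$$ with $V:\mathbb R^3\to\mathbb R^3$ not identically zero, $W$ bounded and $g(t)\to0$ as $t\uparrow T_0$, such that (a) $V\in C^{2,\gamma}(\mathbb R^3)$, $W\in C^{2,1,\gamma}_{x,t}(D\times[0,T_0))$, and $|y||\nabla V(y)|$, $|y|^2|\nabla^2V(y)|$ are $C^\gamma$ functions; (b) some sequence of near maximal blow-up points stays within finite distance of the side boundary after blow-up; (c) every blow-up limit of that sequence has a vertical component that is odd in $\tilde x^{(3)}$. **(2)** For no $\gamma\in(0,1)$, $a<0<b$, $T_0>0$ and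 $d\in[0,1)$ is there a solution $v$ that is asymptotically self-similar around the boundary point $p_0$, $(r,x^{(3)})=(1,0)$: for all $x\in D$ with $r>d$ and all $t\in[0,T_0)$, $$v(x,t)=\frac1{(T_0-t)^\alpha}\big(V^r(y)e_r+V^\theta(y)e_\theta+V^{(3)}(y)e_3\big)+\frac{g(t)}{(T_0-t)^\alpha}W(x,t),\qquad y=\frac{(r-1,\ x^{(3)})}{(T_0-t)^{1-\alpha}},$$ with $V=(V^r,V^\theta,V^{(3)})$ defined and not identically zero on the half plane $H=\{y_1\le0\}$, $W$ bounded and $g(t)\to0$ as $t\uparrow T_0$, such that (b) $V\in C^{2,\gamma}_{loc}(H)$ and $W\in C^{2,1,\gamma}_{x,t,loc}$ on $\{x\in D: r>d\}\times[0,T_0)$; (c) some sequence of anchor blow-up points stays within finite distance of the side boundary after blow-up; (d) $|V(y)|/|y|\to0$ as $|y|\to\infty$ in $H$, and $|\nabla V|$ is bounded on $H$; (e) $V^{(3)}(y_1,-y_2)=-V^{(3)}(y_1,y_2)$ on $H$. -/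

import Mathlib

open Set Filter Topology
open scoped ContDiff

noncomputable section

namespace AxiEuler

abbrev E2 : Type := EuclideanSpace ℝ (Fin 2)

abbrev E3 : Type := EuclideanSpace ℝ (Fin 3)

/-! ### Geometry of the cylinder -/

/-- The distance of `x` to the vertical axis. -/
def rad (x : E3) : ℝ := Real.sqrt (x 0 ^ 2 + x 1 ^ 2)

/-- The radial unit vector (meaningful off the axis). -/
def eR (x : E3) : E3 := !₂[x 0 / rad x, x 1 / rad x, 0]

/-- The angular unit vector (meaningful off the axis). -/
def eTheta (x : E3) : E3 := !₂[-(x 1) / rad x, x 0 / rad x, 0]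

/-- The vertical unit vector. -/
def eZ : E3 := !₂[0, 0, 1]

/-- Rotation by the angle `θ` around the vertical axis. -/
def rot (θ : ℝ) (x : E3) : E3 :=
  !₂[Real.cos θ * x 0 - Real.sin θ * x 1, Real.sin θ * x 0 + Real.cos θ * x 1, x 2]

/-- Reflection of the vertical coordinate. -/
def reflZ (x : E3) : E3 := !₂[x 0, x 1, -(x 2)]

/-- The infinite open cylinder of radius one (all vertical periods of the finite cylinder). -/
def pipe : Set E3 := {x | rad x < 1}

/-- The infinite closed cylinder of radius one. -/
def closedPipe : Set E3 := {x | rad x ≤ 1}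

/-- The finite open cylinder `D`, of radius one, between the heights `a` and `b`. -/
def cyl (a b : ℝ) : Set E3 := {x | rad x < 1 ∧ a < x 2 ∧ x 2 < b}

/-- The finite cylinder `D` together with its side boundary. -/
def cylSide (a b : ℝ) : Set E3 := {x | rad x ≤ 1 ∧ a < x 2 ∧ x 2 < b}

/-! ### The axially symmetric Euler equations -/

/-- `(v, p)` is a smooth axially symmetric solution of the incompressible Euler equations on the
cylinder between the heights `a` and `b`, for times in `[0, T₀)`, which is smooth up to the side
boundary, satisfies the no penetration condition there, and is periodic in the vertical variable.
The velocity is written through its smooth periodic extension to the infinite cylinder. -/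
structure IsAxisymEulerSolution (a b T₀ : ℝ) (v : E3 → ℝ → E3) (p : E3 → ℝ → ℝ) : Prop where
  smooth_velocity : ContDiffOn ℝ ∞ (fun z : E3 × ℝ => v z.1 z.2) (closedPipe ×ˢ Ico 0 T₀)
  smooth_pressure : ContDiffOn ℝ ∞ (fun z : E3 × ℝ => p z.1 z.2) (closedPipe ×ˢ Ico 0 T₀)
  momentum : ∀ x ∈ pipe, ∀ t ∈ Ioo 0 T₀,
    deriv (fun s => v x s) t + fderiv ℝ (fun y => v y t) x (v x t)
      + gradient (fun y => p y t) x = 0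
  divergence_free : ∀ x ∈ pipe, ∀ t ∈ Ioo 0 T₀,
    ∑ i : Fin 3, fderiv ℝ (fun y => v y t) x (EuclideanSpace.single i 1) i = 0
  no_penetration : ∀ x : E3, rad x = 1 → ∀ t ∈ Ico 0 T₀, x 0 * v x t 0 + x 1 * v x t 1 = 0
  periodic : ∀ x ∈ closedPipe, ∀ t ∈ Ico 0 T₀, v (x + (b - a) • eZ) t = v x t
  axisymmetric : ∀ θ : ℝ, ∀ x ∈ closedPipe, ∀ t ∈ Ico 0 T₀, v (rot θ x) t = rot θ (v x t)

/-! ### Hölder classes -/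

/-- `f` is bounded and Hölder continuous with exponent `γ` on `S`. -/
def IsHolderOn {E F : Type*} [NormedAddCommGroup E] [NormedAddCommGroup F]
    (γ : ℝ) (S : Set E) (f : E → F) : Prop :=
  ∃ C : ℝ, (∀ x ∈ S, ‖f x‖ ≤ C) ∧ ∀ x ∈ S, ∀ y ∈ S, ‖f x - f y‖ ≤ C * ‖x - y‖ ^ γ

/-- `f` is bounded and Hölder continuous with exponent `γ` on the space-time set `S`, with respect
to the parabolic distance. -/
def IsParabolicHolderOn {E F : Type*} [NormedAddCommGroup E] [NormedAddCommGroup F]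
    (γ : ℝ) (S : Set (E × ℝ)) (f : E → ℝ → F) : Prop :=
  ∃ C : ℝ, (∀ z ∈ S, ‖f z.1 z.2‖ ≤ C) ∧ ∀ z ∈ S, ∀ w ∈ S,
    ‖f z.1 z.2 - f w.1 w.2‖ ≤ C * (‖z.1 - w.1‖ + Real.sqrt |z.2 - w.2|) ^ γ

/-- `f`, its first two spatial derivatives and its time derivative exist in `Ω × I`, and they are
of class `C^γ` on the part `S` of `Ω × I`. Here `Ω` is open and `I` is an interval. -/
def IsC21HolderOn {E F : Type*} [NormedAddCommGroup E] [NormedSpace ℝ E]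
    [NormedAddCommGroup F] [NormedSpace ℝ F]
    (γ : ℝ) (Ω : Set E) (I : Set ℝ) (S : Set (E × ℝ)) (f : E → ℝ → F) : Prop :=
  (∀ t ∈ I, ContDiffOn ℝ 2 (fun y => f y t) Ω) ∧
  (∀ x ∈ Ω, DifferentiableOn ℝ (fun s => f x s) I) ∧
  IsParabolicHolderOn γ S f ∧
  IsParabolicHolderOn γ S (fun x t => iteratedFDeriv ℝ 1 (fun y => f y t) x) ∧
  IsParabolicHolderOn γ S (fun x t => iteratedFDeriv ℝ 2 (fun y => f y t) x) ∧
  IsParabolicHolderOn γ S (fun x t => derivWithin (fun s => f x s) I t)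

/-- The class `C^{2,1,γ}_{x,t}` on `Ω × I`. -/
def IsC21Holder {E F : Type*} [NormedAddCommGroup E] [NormedSpace ℝ E]
    [NormedAddCommGroup F] [NormedSpace ℝ F]
    (γ : ℝ) (Ω : Set E) (I : Set ℝ) (f : E → ℝ → F) : Prop :=
  IsC21HolderOn γ Ω I (Ω ×ˢ I) f

/-- The local class `C^{2,1,γ}_{x,t,loc}` on `Ω × I`. -/
def IsC21HolderLoc {E F : Type*} [NormedAddCommGroup E] [NormedSpace ℝ E]
    [NormedAddCommGroup F] [NormedSpace ℝ F]
    (γ : ℝ) (Ω : Set E) (I : Set ℝ) (f : E → ℝ → F) : Prop :=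
  ∀ K : Set (E × ℝ), K ⊆ Ω ×ˢ I → IsCompact K → IsC21HolderOn γ Ω I K f

/-- The class `C^{2,γ}` on the whole space (`C^{2,1,γ}_{x,t}` for a stationary field). -/
def IsC2Holder {E F : Type*} [NormedAddCommGroup E] [NormedSpace ℝ E]
    [NormedAddCommGroup F] [NormedSpace ℝ F] (γ : ℝ) (f : E → F) : Prop :=
  ContDiff ℝ 2 f ∧ IsHolderOn γ univ f ∧ IsHolderOn γ univ (iteratedFDeriv ℝ 1 f) ∧
    IsHolderOn γ univ (iteratedFDeriv ℝ 2 f)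

/-- The class `C^{2,γ}_{loc}` on a set `H` which is the closure of an open convex set, up to the
boundary of `H`. -/
def IsC2HolderLocOn {E F : Type*} [NormedAddCommGroup E] [NormedSpace ℝ E]
    [NormedAddCommGroup F] [NormedSpace ℝ F] (γ : ℝ) (H : Set E) (f : E → F) : Prop :=
  ContDiffOn ℝ 2 f H ∧ ∀ K : Set E, K ⊆ H → IsCompact K →
    IsHolderOn γ K f ∧ IsHolderOn γ K (iteratedFDerivWithin ℝ 1 f H) ∧
      IsHolderOn γ K (iteratedFDerivWithin ℝ 2 f H)

/-- The Euclidean length `|∇V(y)|` of the gradient. -/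
def gradNorm (V : E3 → E3) (y : E3) : ℝ :=
  Real.sqrt (∑ i : Fin 3, ‖fderiv ℝ V y (EuclideanSpace.single i 1)‖ ^ 2)

/-- The Euclidean length `|∇²V(y)|` of the second gradient. -/
def hessNorm (V : E3 → E3) (y : E3) : ℝ :=
  Real.sqrt (∑ i : Fin 3, ∑ j : Fin 3,
    ‖iteratedFDeriv ℝ 2 V y ![EuclideanSpace.single i 1, EuclideanSpace.single j 1]‖ ^ 2)

/-! ### Asymptotically self-similar solutions -/

/-- `v` is asymptotically self-similar at time `T₀` on the cylinder, around the origin, with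
profile `V` (not identically zero) and bounded error field `W`; `g` is the infinitesimal factor in
front of the error. -/
def IsASSS (α a b T₀ : ℝ) (v : E3 → ℝ → E3) (V : E3 → E3) (W : E3 → ℝ → E3) : Prop :=
  (∃ y, V y ≠ 0) ∧
  (∃ C : ℝ, ∀ x ∈ cyl a b, ∀ t ∈ Ico 0 T₀, ‖W x t‖ ≤ C) ∧
  ∃ g : ℝ → ℝ, Tendsto g (𝓝[<] T₀) (𝓝 0) ∧
    ∀ x ∈ cyl a b, ∀ t ∈ Ico 0 T₀,
      v x t = (1 / (T₀ - t) ^ α) • V ((1 / (T₀ - t) ^ (1 - α)) • x)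
        + (g t / (T₀ - t) ^ α) • W x t

/-- The closed left half plane, in which `((r, x₃) - (1, 0)) / (T₀ - t) ^ (1 - α)` lives. -/
def halfPlane : Set E2 := {y | y 0 ≤ 0}

/-- The part of the finite cylinder at distance more than `d` from the axis. -/
def cylOff (a b d : ℝ) : Set E3 := {x | x ∈ cyl a b ∧ d < rad x}

/-- `v` is asymptotically self-similar at time `T₀` around the boundary point `p₀`, that is
`(r, x₃) = (1, 0)` in the meridian half plane: the three cylindrical components
`(v^r, v^θ, v^{(3)})`, as functions of `(r, x₃, t)`, have the profile `V = (V^r, V^θ, V^{(3)})`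
(not identically zero) in the variable `((r, x₃) - (1, 0)) / (T₀ - t) ^ (1 - α)`, with a bounded
error field `W`. The expansion is only asked for at distance more than `d` from the axis. -/
def IsBoundaryASSS (α a b d T₀ : ℝ) (v : E3 → ℝ → E3) (V : E2 → E3) (W : E3 → ℝ → E3) : Prop :=
  (∃ y ∈ halfPlane, V y ≠ 0) ∧
  (∃ C : ℝ, ∀ x ∈ cylOff a b d, ∀ t ∈ Ico 0 T₀, ‖W x t‖ ≤ C) ∧
  ∃ g : ℝ → ℝ, Tendsto g (𝓝[<] T₀) (𝓝 0) ∧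
    ∀ x ∈ cylOff a b d, ∀ t ∈ Ico 0 T₀, ∀ y : E2,
      y = (1 / (T₀ - t) ^ (1 - α)) • (!₂[rad x - 1, x 2] : E2) →
      v x t = (1 / (T₀ - t) ^ α) • (V y 0 • eR x + V y 1 • eTheta x + V y 2 • eZ)
        + (g t / (T₀ - t) ^ α) • W x t

/-! ### Blow-up sequences -/

/-- `(x k, t k)` are blow-up points off the axis: they converge to a point `(x₊, T₀)`, with `x₊` in
the cylinder or on its side boundary, and `|v|` tends to infinity along them. -/
def IsBlowupPoints (a b T₀ : ℝ) (v : E3 → ℝ → E3) (x : ℕ → E3) (t : ℕ → ℝ) : Prop :=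
  (∀ k, x k ∈ cylSide a b) ∧ (∀ k, t k ∈ Ico 0 T₀) ∧
  (∃ xlim ∈ cylSide a b, Tendsto x atTop (𝓝 xlim)) ∧ Tendsto t atTop (𝓝 T₀) ∧
  (∃ d > 0, ∀ k, d < rad (x k)) ∧
  Tendsto (fun k => ‖v (x k) (t k)‖) atTop atTop

/-- The positive numbers `Q k` are comparable to `|v (x k, t k)|`. -/
def IsScale (v : E3 → ℝ → E3) (x : ℕ → E3) (t : ℕ → ℝ) (Q : ℕ → ℝ) : Prop :=
  (∀ k, 0 < Q k) ∧
  ∃ c : ℝ, 1 ≤ c ∧ ∀ k, c⁻¹ * ‖v (x k) (t k)‖ ≤ Q k ∧ Q k ≤ c * ‖v (x k) (t k)‖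

/-- The unscaled position of `y`, for the centre `x₀` and the scale `q`. -/
def unscaleX (α q : ℝ) (x₀ y : E3) : E3 := q ^ (-((1 - α) / α)) • y + x₀

/-- The unscaled time of `s`, for the centre `t₀` and the scale `q`. -/
def unscaleT (α q t₀ s : ℝ) : ℝ := q ^ (-(1 / α)) * s + t₀

/-- The blow-up solutions with centres `(x k, t k)` and scales `Q k`. -/
def blowup (α : ℝ) (v : E3 → ℝ → E3) (x : ℕ → E3) (t Q : ℕ → ℝ) (k : ℕ) (y : E3) (s : ℝ) : E3 :=
  (Q k)⁻¹ • v (unscaleX α (Q k) (x k) y) (unscaleT α (Q k) (t k) s)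

/-- The blow-up points are near maximal. -/
def IsNearMaximal (a b : ℝ) (v : E3 → ℝ → E3) (x : ℕ → E3) (t : ℕ → ℝ) : Prop :=
  ∃ c > 0, ∀ k, ∀ s ∈ Icc 0 (t k), ∀ y ∈ cyl a b, c * ‖v y s‖ ≤ ‖v (x k) (t k)‖

/-- The blow-up points are anchor points: the blow-up solutions obey a locally uniform bound `lam`,
on a range of the scaled variables that grows linearly in `k`. -/
def IsAnchor (α a b T₀ : ℝ) (v : E3 → ℝ → E3) (x : ℕ → E3) (t Q : ℕ → ℝ) : Prop :=
  ∃ lam : ℝ → ℝ, ContinuousOn lam (Ici 0) ∧ MonotoneOn lam (Ici 0) ∧ (∀ m ∈ Ici 0, 1 ≤ lam m) ∧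
  ∃ κ > 0, ∀ (k : ℕ) (y : E3) (s : ℝ), s ≤ 0 →
    unscaleX α (Q k) (x k) y ∈ cyl a b → unscaleT α (Q k) (t k) s ∈ Ico 0 T₀ →
    ‖y‖ ^ 2 + |s| ≤ κ * k →
    ‖blowup α v x t Q k y s‖ ≤ lam (‖y‖ ^ 2 + |s|) * ‖blowup α v x t Q k 0 0‖

/-- After scaling, the centres stay within a finite distance of the side boundary. -/
def IsNearSide (α : ℝ) (x : ℕ → E3) (Q : ℕ → ℝ) : Prop :=
  ∃ M : ℝ, ∀ k, Q k ^ ((1 - α) / α) * (1 - rad (x k)) ≤ M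

/-- The open limit of the scaled cylinders along the subsequence `φ`: the points which have a
neighbourhood that is eventually contained in the scaled cylinder. -/
def limitDomain (α a b : ℝ) (x : ℕ → E3) (Q : ℕ → ℝ) (φ : ℕ → ℕ) : Set E3 :=
  {y | ∃ ε > 0, ∀ᶠ k in atTop, ∀ z ∈ Metric.ball y ε,
    unscaleX α (Q (φ k)) (x (φ k)) z ∈ cyl a b}

/-- `u` is the limit of the blow-up solutions along the subsequence `φ`, locally uniformly in space
and in the times `s ≤ 0`. -/
def IsBlowupLimit (α a b : ℝ) (v : E3 → ℝ → E3) (x : ℕ → E3) (t Q : ℕ → ℝ) (φ : ℕ → ℕ)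
    (u : E3 → ℝ → E3) : Prop :=
  StrictMono φ ∧
  TendstoLocallyUniformlyOn (fun (k : ℕ) (z : E3 × ℝ) => blowup α v x t Q (φ k) z.1 z.2)
    (fun z => u z.1 z.2) atTop (limitDomain α a b x Q φ ×ˢ Iic (0 : ℝ))

/-- Every limit of the blow-up sequence has a vertical component that is odd in the vertical
variable. -/
def HasOddLimits (α a b : ℝ) (v : E3 → ℝ → E3) (x : ℕ → E3) (t Q : ℕ → ℝ) : Prop :=
  ∀ (φ : ℕ → ℕ) (u : E3 → ℝ → E3), IsBlowupLimit α a b v x t Q φ u →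
    ∀ y ∈ limitDomain α a b x Q φ, ∀ s ≤ 0, u (reflZ y) s 2 = -(u y s 2)

end AxiEuler

end

open AxiEuler

/-!
Both parts rest on the swirl `r v^θ`, which an axially symmetric Euler flow transports: the pressure
does not depend on the angle (`fderiv_pressure_perp`). By the maximum principle up to the side
boundary the swirl stays bounded (`exists_swirl_bound`), so off the axis the angular velocity does
not take part in a blow-up.

**Profiles around the origin.** Near maximal blow-up points have the self-similar rate, that is
`Q_k (T₀ - t_k)^α` stays between positive constants (`exists_rate_bounds`). In the self-similar
variables these points escape to infinity. Since `|y| |∇V(y)|` is bounded, the profile is nearly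
constant on bounded neighbourhoods of points near infinity, and it is uniformly Lipschitz in the
logarithm of the scale. Hence a subsequence of the blow-up sequence converges to a function of time
only (`exists_subseq_tendsto_of_lipschitz`, `tendsto_blowup`). The limit is zero at time zero:
its vertical component is odd and constant in space, its radial component vanishes because the side
boundary, where there is no penetration, stays within finite distance, and its angular component
vanishes by the bound on the swirl. This contradicts the normalization by `Q_k` (`not_isASSS`).

**Profiles around a boundary point.** In the variables `y` and `s = -log (T₀ - t)`, the velocity
converges locally uniformly to the profile `V` as `s → ∞` (`tendsto_selfVel`). Nothing is known about
convergence of its derivatives or of the pressure, so the limit is taken in the weak form of the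
vorticity equation (`limit_equations`), in which the curvature of the cylinder and the centrifugal
force disappear. As `V` is twice differentiable, its planar part is free of divergence, and its
vorticity `ω` satisfies `((1 - α) y + V) · ∇ω + ω = 0` (`profile_equations`, `profile_transport`).
The transport field grows at most linearly and is tangential on the boundary, and `ω` is bounded. At
a maximum of `ω²` with the weight `(1 + |y|²)^(-ε)` the damping term `ω` dominates, hence `ω = 0`
(`vort_eq_zero`). The radial component is then harmonic, vanishes on the boundary and grows
sublinearly, so it is zero by the Phragmén–Lindelöf principle (`profile_radial_nonpos`). The vertical
component is then constant, and odd, so it is zero too; the angular component is zero by the bound on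
the swirl (`profile_angular_eq_zero`). Thus `V = 0`, which is excluded (`not_isBoundaryASSS`).
-/

namespace AxiEuler

/-! ### Geometry of the cylinder -/

theorem continuous_rad : Continuous rad := by unfold rad; fun_prop

theorem rad_nonneg (x : E3) : 0 ≤ rad x := Real.sqrt_nonneg _

theorem rad_sq (x : E3) : rad x ^ 2 = x 0 ^ 2 + x 1 ^ 2 := Real.sq_sqrt (by positivity)

theorem rad_le_one_iff (x : E3) : rad x ≤ 1 ↔ x 0 ^ 2 + x 1 ^ 2 ≤ 1 := by
  rw [← rad_sq, sq_le_one_iff₀ (rad_nonneg x)]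

theorem rad_lt_one_iff (x : E3) : rad x < 1 ↔ x 0 ^ 2 + x 1 ^ 2 < 1 := by
  rw [← rad_sq, sq_lt_one_iff₀ (rad_nonneg x)]

theorem rad_le_norm (x : E3) : rad x ≤ ‖x‖ := by
  rw [EuclideanSpace.norm_eq, Fin.sum_univ_three]
  refine Real.sqrt_le_sqrt ?_
  simp only [Real.norm_eq_abs, sq_abs]
  nlinarith [sq_nonneg (x 2)]

theorem abs_apply_le_norm (x : E3) (i : Fin 3) : |x i| ≤ ‖x‖ := PiLp.norm_apply_le x i

theorem mem_pipe {x : E3} : x ∈ pipe ↔ rad x < 1 := Iff.rfl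

theorem mem_closedPipe {x : E3} : x ∈ closedPipe ↔ rad x ≤ 1 := Iff.rfl

theorem pipe_subset_closedPipe : pipe ⊆ closedPipe := fun _ hx =>
  mem_closedPipe.2 (mem_pipe.1 hx).le

theorem isOpen_pipe : IsOpen pipe := isOpen_lt continuous_rad continuous_const

theorem isClosed_closedPipe : IsClosed closedPipe := isClosed_le continuous_rad continuous_const

theorem convex_closedPipe : Convex ℝ closedPipe := by
  intro x hx y hy s t hs ht hst
  simp only [closedPipe, mem_ofPred_eq, rad_le_one_iff] at *
  simp only [PiLp.add_apply, PiLp.smul_apply, smul_eq_mul]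
  have h : t = 1 - s := by linarith
  subst h
  nlinarith [mul_nonneg hs ht, mul_nonneg (mul_nonneg hs ht) (sq_nonneg (x 0 - y 0)),
    mul_nonneg (mul_nonneg hs ht) (sq_nonneg (x 1 - y 1)), mul_le_mul_of_nonneg_left hx hs,
    mul_le_mul_of_nonneg_left hy ht]

theorem interior_closedPipe_nonempty : (interior closedPipe).Nonempty := by
  refine ⟨0, mem_interior.2 ⟨pipe, pipe_subset_closedPipe, isOpen_pipe, ?_⟩⟩
  simp [pipe, rad]

theorem smul_mem_pipe {x : E3} (hx : x ∈ closedPipe) {s : ℝ} (hs : 0 ≤ s) (hs' : s < 1) :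
    s • x ∈ pipe := by
  simp only [closedPipe, pipe, mem_ofPred_eq, rad_le_one_iff, rad_lt_one_iff] at *
  simp only [PiLp.smul_apply, smul_eq_mul]
  nlinarith [mul_nonneg (sq_nonneg s) (sub_nonneg.2 hx)]

/-- The closed space-time domain on which the solutions are smooth. -/
def spaceTime (T₀ : ℝ) : Set (E3 × ℝ) := closedPipe ×ˢ Ico 0 T₀

theorem uniqueDiffOn_spaceTime {T₀ : ℝ} : UniqueDiffOn ℝ (spaceTime T₀) := by
  exact (uniqueDiffOn_convex convex_closedPipe interior_closedPipe_nonempty).prod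
    (uniqueDiffOn_Ico 0 T₀)

theorem spaceTime_mem_nhds {T₀ : ℝ} {x : E3} {t : ℝ} (hx : x ∈ pipe) (ht : t ∈ Ioo 0 T₀) :
    spaceTime T₀ ∈ 𝓝 (x, t) :=
  prod_mem_nhds (mem_of_superset (isOpen_pipe.mem_nhds hx) pipe_subset_closedPipe)
    (Ico_mem_nhds ht.1 ht.2)

theorem spaceTime_subset_closure {T₀ : ℝ} : spaceTime T₀ ⊆ closure (pipe ×ˢ Ioo 0 T₀) := by
  rintro ⟨x, t⟩ ⟨hx, ht⟩
  rw [closure_prod_eq]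
  refine ⟨?_, ?_⟩
  · have h : Tendsto (fun s : ℝ => s • x) (𝓝[<] 1) (𝓝 x) := by
      have : Continuous fun s : ℝ => s • x := by fun_prop
      simpa using (this.tendsto 1).mono_left nhdsWithin_le_nhds
    refine mem_closure_of_tendsto h ?_
    filter_upwards [Ioo_mem_nhdsLT (show (0 : ℝ) < 1 by norm_num)] with s hs
    exact smul_mem_pipe hx hs.1.le hs.2
  · rw [closure_Ioo (ht.1.trans_lt ht.2).ne]
    exact ⟨ht.1, ht.2.le⟩

/-! ### Rotations -/

/-- The rotation around the vertical axis as a continuous linear map. -/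
noncomputable def rotL (θ : ℝ) : E3 →L[ℝ] E3 :=
  LinearMap.toContinuousLinearMap
    { toFun := rot θ
      map_add' := fun x y => by ext i; fin_cases i <;> simp [rot] <;> ring
      map_smul' := fun c x => by ext i; fin_cases i <;> simp [rot] <;> ring }

@[simp] theorem rotL_apply (θ : ℝ) (x : E3) : rotL θ x = rot θ x := rfl

/-- The generator of the rotations around the vertical axis: `x ↦ r e_θ`. -/
noncomputable def perp (x : E3) : E3 := !₂[-(x 1), x 0, 0]

theorem rad_rot (θ : ℝ) (x : E3) : rad (rot θ x) = rad x := by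
  unfold rad rot
  congr 1
  simp
  nlinarith [Real.sin_sq_add_cos_sq θ]

theorem rot_zero (x : E3) : rot 0 x = x := by
  ext i; fin_cases i <;> simp [rot]

theorem rot_two_pi (x : E3) : rot (2 * Real.pi) x = x := by
  ext i; fin_cases i <;> simp [rot]

theorem hasDerivAt_of_apply {f : ℝ → E3} {f' : E3} {s : ℝ}
    (h : ∀ i, HasDerivAt (fun s => f s i) (f' i) s) : HasDerivAt f f' s := by
  rw [hasDerivAt_iff_hasFDerivAt, ← hasFDerivWithinAt_univ, hasFDerivWithinAt_euclidean]
  intro i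
  rw [hasFDerivWithinAt_univ]
  exact (h i).hasFDerivAt.congr_fderiv (by ext; simp)

theorem hasFDerivAt_apply {E : Type*} [NormedAddCommGroup E] [NormedSpace ℝ E] {f : E → E3}
    {f' : E →L[ℝ] E3} {z : E} (h : HasFDerivAt f f' z) (i : Fin 3) :
    HasFDerivAt (fun z => f z i) ((EuclideanSpace.proj i : E3 →L[ℝ] ℝ).comp f') z :=
  (EuclideanSpace.proj i : E3 →L[ℝ] ℝ).hasFDerivAt.comp z h

theorem hasDerivAt_rot (θ : ℝ) (x : E3) : HasDerivAt (fun s => rot s x) (perp (rot θ x)) θ := by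
  refine hasDerivAt_of_apply fun i => ?_
  have hc := Real.hasDerivAt_cos θ
  have hs := Real.hasDerivAt_sin θ
  fin_cases i
  · exact ((hc.mul_const (x 0)).sub (hs.mul_const (x 1))).congr_deriv (by simp [perp, rot]; ring)
  · exact ((hs.mul_const (x 0)).add (hc.mul_const (x 1))).congr_deriv (by simp [perp, rot]; ring)
  · simpa [perp, rot] using hasDerivAt_const θ (x 2)

/-! ### Transport of the swirl -/

/-- The swirl `r v^θ` as a function on space-time. -/
noncomputable def swirl (v : E3 → ℝ → E3) (z : E3 × ℝ) : ℝ :=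
  z.1 0 * v z.1 z.2 1 - z.1 1 * v z.1 z.2 0

section Swirl

variable {a b T₀ : ℝ} {v : E3 → ℝ → E3} {p : E3 → ℝ → ℝ}

theorem contDiffOn_swirl (h : IsAxisymEulerSolution a b T₀ v p) :
    ContDiffOn ℝ ∞ (swirl v) (spaceTime T₀) := by
  have hv : ∀ i, ContDiffOn ℝ ∞ (fun z : E3 × ℝ => v z.1 z.2 i) (spaceTime T₀) := fun i =>
    contDiffOn_euclidean.1 h.smooth_velocity i
  have hx : ∀ i, ContDiffOn ℝ ∞ (fun z : E3 × ℝ => z.1 i) (spaceTime T₀) := fun i => by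
    have : ContDiff ℝ ∞ (fun z : E3 × ℝ => z.1) := contDiff_fst
    exact (contDiff_euclidean.1 this i).contDiffOn
  exact ((hx 0).mul (hv 1)).sub ((hx 1).mul (hv 0))

theorem swirl_rot (h : IsAxisymEulerSolution a b T₀ v p) (θ : ℝ) {x : E3} {t : ℝ}
    (hx : x ∈ closedPipe) (ht : t ∈ Ico 0 T₀) : swirl v (rot θ x, t) = swirl v (x, t) := by
  simp only [swirl, h.axisymmetric θ x hx t ht]
  simp only [rot]
  simp
  linear_combination (x 0 * v x t 1 - x 1 * v x t 0) * Real.sin_sq_add_cos_sq θ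

theorem hasFDerivWithinAt_swirl (h : IsAxisymEulerSolution a b T₀ v p) {z : E3 × ℝ}
    (hz : z ∈ spaceTime T₀) :
    HasFDerivWithinAt (swirl v) (fderivWithin ℝ (swirl v) (spaceTime T₀) z) (spaceTime T₀) z :=
  ((contDiffOn_swirl h).differentiableOn (by simp) z hz).hasFDerivWithinAt

/-- The momentum equation, with the total space-time derivative of the velocity. -/
theorem momentum_apply (h : IsAxisymEulerSolution a b T₀ v p) {x : E3} {t : ℝ}
    (hx : x ∈ pipe) (ht : t ∈ Ioo 0 T₀) (w : E3) :
    inner ℝ (fderiv ℝ (fun z : E3 × ℝ => v z.1 z.2) (x, t) (v x t, 1)) w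
      = -fderiv ℝ (fun y => p y t) x w := by
  have hd : DifferentiableAt ℝ (fun z : E3 × ℝ => v z.1 z.2) (x, t) :=
    (h.smooth_velocity.contDiffAt (spaceTime_mem_nhds hx ht)).differentiableAt (by simp)
  have h1 : deriv (fun s => v x s) t = fderiv ℝ (fun z : E3 × ℝ => v z.1 z.2) (x, t) (0, 1) := by
    refine HasDerivAt.deriv ?_
    exact hd.hasFDerivAt.comp_hasDerivAt t ((hasDerivAt_const t x).prodMk (hasDerivAt_id t))
  have h2 : fderiv ℝ (fun y => v y t) x (v x t)
      = fderiv ℝ (fun z : E3 × ℝ => v z.1 z.2) (x, t) (v x t, 0) := by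
    have : HasFDerivAt (fun y => v y t) ((fderiv ℝ (fun z : E3 × ℝ => v z.1 z.2) (x, t)).comp
        ((ContinuousLinearMap.id ℝ E3).prod (0 : E3 →L[ℝ] ℝ))) x :=
      HasFDerivAt.comp (f := fun y : E3 => (y, t)) x hd.hasFDerivAt
        ((hasFDerivAt_id x).prodMk (hasFDerivAt_const t x))
    rw [this.fderiv]; simp
  have h3 : inner ℝ (gradient (fun y => p y t) x) w = fderiv ℝ (fun y => p y t) x w := by
    simp [gradient]
  have hm := h.momentum x hx t ht
  rw [h1, h2, ← map_add] at hm
  simp only [Prod.mk_add_mk, zero_add, add_zero] at hm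
  rw [eq_neg_of_add_eq_zero_left hm, inner_neg_left, h3]

theorem fderiv_swirl_eq (h : IsAxisymEulerSolution a b T₀ v p) {x : E3} {t : ℝ}
    (hx : x ∈ pipe) (ht : t ∈ Ioo 0 T₀) :
    fderiv ℝ (swirl v) (x, t) (v x t, 1) = -fderiv ℝ (fun y => p y t) x (perp x) := by
  rw [← momentum_apply h hx ht]
  have hd : HasFDerivAt (fun z : E3 × ℝ => v z.1 z.2)
      (fderiv ℝ (fun z : E3 × ℝ => v z.1 z.2) (x, t)) (x, t) :=
    ((h.smooth_velocity.contDiffAt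
      (spaceTime_mem_nhds hx ht)).differentiableAt (by simp)).hasFDerivAt
  have hv := hasFDerivAt_apply hd
  have hf := hasFDerivAt_apply (hasFDerivAt_fst (𝕜 := ℝ) (E := E3) (F := ℝ) (p := (x, t)))
  have : HasFDerivAt (swirl v) _ (x, t) := ((hf 0).mul (hv 1)).sub ((hf 1).mul (hv 0))
  rw [this.fderiv]
  simp [perp, PiLp.inner_apply, Fin.sum_univ_three]
  ring

theorem fderiv_swirl_rot (h : IsAxisymEulerSolution a b T₀ v p) (θ : ℝ) {x : E3} {t : ℝ}
    (hx : x ∈ pipe) (ht : t ∈ Ioo 0 T₀) :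
    fderiv ℝ (swirl v) (rot θ x, t) (v (rot θ x) t, 1) = fderiv ℝ (swirl v) (x, t) (v x t, 1) := by
  have hx' : rot θ x ∈ pipe := by simpa [pipe, rad_rot] using hx
  have hd : DifferentiableAt ℝ (swirl v) (rot θ x, t) :=
    ((contDiffOn_swirl h).contDiffAt (spaceTime_mem_nhds hx' ht)).differentiableAt (by simp)
  have hc : HasFDerivAt (fun z : E3 × ℝ => swirl v (rot θ z.1, z.2))
      ((fderiv ℝ (swirl v) (rot θ x, t)).comp ((rotL θ).prodMap (ContinuousLinearMap.id ℝ ℝ)))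
      (x, t) :=
    HasFDerivAt.comp (x, t) (f := fun z : E3 × ℝ => (rot θ z.1, z.2)) hd.hasFDerivAt
      ((rotL θ).prodMap (ContinuousLinearMap.id ℝ ℝ)).hasFDerivAt
  have he : (fun z : E3 × ℝ => swirl v (rot θ z.1, z.2)) =ᶠ[𝓝 (x, t)] swirl v := by
    filter_upwards [spaceTime_mem_nhds hx ht] with z hz
    exact swirl_rot h θ hz.1 hz.2
  rw [(hc.congr_of_eventuallyEq he.symm).fderiv,
    h.axisymmetric θ x (pipe_subset_closedPipe hx) t ⟨ht.1.le, ht.2⟩]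
  simp

/-- The angular derivative of the pressure vanishes: along a circle around the axis it is constant,
as it is equal to the material derivative of the swirl, and it has mean zero. -/
theorem fderiv_pressure_perp (h : IsAxisymEulerSolution a b T₀ v p) {x : E3} {t : ℝ}
    (hx : x ∈ pipe) (ht : t ∈ Ioo 0 T₀) : fderiv ℝ (fun y => p y t) x (perp x) = 0 := by
  set c := fderiv ℝ (fun y => p y t) x (perp x) with hc
  have hx' : ∀ θ, rot θ x ∈ pipe := fun θ => by simpa [pipe, rad_rot] using hx
  have hp : ∀ y ∈ pipe, DifferentiableAt ℝ (fun y => p y t) y := fun y hy => by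
    have := (h.smooth_pressure.contDiffAt (spaceTime_mem_nhds hy ht)).differentiableAt (by simp)
    exact DifferentiableAt.comp (g := fun z : E3 × ℝ => p z.1 z.2) (f := fun y : E3 => (y, t)) y this
      (differentiableAt_id.prodMk (differentiableAt_const t))
  have hder : ∀ θ, HasDerivAt (fun s => p (rot s x) t) c θ := fun θ => by
    have h1 := (hp _ (hx' θ)).hasFDerivAt.comp_hasDerivAt θ (hasDerivAt_rot θ x)
    have h2 := fderiv_swirl_rot h θ hx ht
    rw [fderiv_swirl_eq h hx ht, fderiv_swirl_eq h (hx' θ) ht] at h2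
    exact h1.congr_deriv (neg_injective h2)
  have hlin : ∀ θ, HasDerivAt (fun s => p (rot s x) t - s * c) 0 θ := fun θ => by
    simpa using! (hder θ).sub ((hasDerivAt_id θ).mul_const c)
  have := is_const_of_deriv_eq_zero (fun θ => (hlin θ).differentiableAt) (fun θ => (hlin θ).deriv)
    (2 * Real.pi) 0
  simp only [rot_zero, rot_two_pi] at this
  have hpi := Real.pi_pos
  have : 2 * Real.pi * c = 0 := by linarith
  rcases mul_eq_zero.1 this with h0 | h0
  · linarith
  · exact h0

/-- The swirl is transported by the flow, up to the boundary of the space-time domain. -/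
theorem swirl_transport (h : IsAxisymEulerSolution a b T₀ v p) {z : E3 × ℝ}
    (hz : z ∈ spaceTime T₀) :
    fderivWithin ℝ (swirl v) (spaceTime T₀) z (v z.1 z.2, 1) = 0 := by
  have hcont : ContinuousOn (fun z : E3 × ℝ =>
      fderivWithin ℝ (swirl v) (spaceTime T₀) z (v z.1 z.2, 1)) (spaceTime T₀) :=
    ((contDiffOn_swirl h).continuousOn_fderivWithin uniqueDiffOn_spaceTime (by simp)).clm_apply
      (h.smooth_velocity.continuousOn.prodMk continuousOn_const)
  have hsub : pipe ×ˢ Ioo 0 T₀ ⊆ spaceTime T₀ :=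
    prod_mono pipe_subset_closedPipe Ioo_subset_Ico_self
  have heq : EqOn (fun z : E3 × ℝ =>
      fderivWithin ℝ (swirl v) (spaceTime T₀) z (v z.1 z.2, 1)) (fun _ => 0)
      (pipe ×ˢ Ioo 0 T₀) := by
    rintro ⟨x, t⟩ ⟨hx, ht⟩
    simp only
    rw [fderivWithin_of_mem_nhds (spaceTime_mem_nhds hx ht), fderiv_swirl_eq h hx ht,
      fderiv_pressure_perp h hx ht, neg_zero]
  exact heq.of_subset_closure hcont continuousOn_const hsub spaceTime_subset_closure hz

theorem fderivWithin_swirl_perp (h : IsAxisymEulerSolution a b T₀ v p) {z : E3 × ℝ}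
    (hz : z ∈ spaceTime T₀) :
    fderivWithin ℝ (swirl v) (spaceTime T₀) z (perp z.1, 0) = 0 := by
  obtain ⟨x, t⟩ := z
  have hr : HasDerivAt (fun s => (rot s x, t)) (perp x, (0 : ℝ)) 0 := by
    simpa [rot_zero] using (hasDerivAt_rot 0 x).prodMk (hasDerivAt_const (0 : ℝ) t)
  have hF := hasFDerivWithinAt_swirl h hz
  have hF' : HasFDerivWithinAt (swirl v) (fderivWithin ℝ (swirl v) (spaceTime T₀) (x, t))
      (spaceTime T₀) ((fun s => (rot s x, t)) 0) := by simpa [rot_zero] using hF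
  have h1 := hF'.comp_hasDerivAt (0 : ℝ) hr
    (Eventually.of_forall fun s =>
      mk_mem_prod (by simpa [closedPipe, rad_rot] using hz.1) hz.2)
  have h2 : (swirl v ∘ fun s => (rot s x, t)) = fun _ => swirl v (x, t) := by
    funext s; exact swirl_rot h s hz.1 hz.2
  rw [h2] at h1
  exact h1.unique (hasDerivAt_const _ _)

/-- A boundary velocity is a combination of the angular and the vertical directions. -/
theorem velocity_boundary (h : IsAxisymEulerSolution a b T₀ v p) {x : E3} {t : ℝ}
    (hx : rad x = 1) (ht : t ∈ Ico 0 T₀) :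
    v x t = swirl v (x, t) • perp x + v x t 2 • eZ := by
  have h0 := h.no_penetration x hx t ht
  have h1 := rad_sq x
  rw [hx] at h1
  ext i
  fin_cases i
  · simp [swirl, perp, eZ]
    linear_combination (v x t 0) * h1 + x 0 * h0
  · simp [swirl, perp, eZ]
    linear_combination (v x t 1) * h1 + x 1 * h0
  · simp [swirl, perp, eZ]

theorem add_smul_eZ_mem_closedPipe {x : E3} (hx : x ∈ closedPipe) (s : ℝ) :
    x + s • eZ ∈ closedPipe := by
  simpa [closedPipe, rad, eZ] using hx

theorem swirl_periodic (h : IsAxisymEulerSolution a b T₀ v p) {x : E3} {t : ℝ}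
    (hx : x ∈ closedPipe) (ht : t ∈ Ico 0 T₀) :
    Function.Periodic (fun s : ℝ => swirl v (x + s • eZ, t)) (b - a) := by
  intro s
  have := h.periodic _ (add_smul_eZ_mem_closedPipe hx s) t ht
  have he : x + (s + (b - a)) • eZ = x + s • eZ + (b - a) • eZ := by rw [add_smul, add_assoc]
  simp only [swirl, he, this]
  simp [eZ]

/-- A spatial direction is critical for a function with a spatial maximum, if the line in this
direction stays in the domain. -/
theorem fderivWithin_eq_zero_of_line {F : E3 × ℝ → ℝ} {F' : E3 × ℝ →L[ℝ] ℝ} {x w : E3} {t : ℝ}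
    (hF : HasFDerivWithinAt F F' (spaceTime T₀) (x, t)) (ht : t ∈ Ico 0 T₀)
    (hmax : ∀ y ∈ closedPipe, F (y, t) ≤ F (x, t))
    (hline : ∀ᶠ s in 𝓝 (0 : ℝ), x + s • w ∈ closedPipe) : F' (w, 0) = 0 := by
  have hr : HasDerivAt (fun s : ℝ => (x + s • w, t)) (w, (0 : ℝ)) 0 := by
    have : HasDerivAt (fun s : ℝ => x + s • w) w 0 := by
      simpa using ((hasDerivAt_id (0 : ℝ)).smul_const w).const_add x
    exact this.prodMk (hasDerivAt_const (0 : ℝ) t)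
  have hF' : HasFDerivWithinAt F F' (spaceTime T₀) ((fun s : ℝ => (x + s • w, t)) 0) := by
    simpa using hF
  have h1 := hF'.comp_hasDerivAt (0 : ℝ) hr (hline.mono fun s hs => mk_mem_prod hs ht)
  refine IsLocalMax.hasDerivAt_eq_zero ?_ h1
  filter_upwards [hline] with s hs
  simpa using hmax _ hs

theorem isCompact_period (c : ℝ) : IsCompact {x : E3 | x ∈ closedPipe ∧ x 2 ∈ Icc 0 c} := by
  refine Metric.isCompact_of_isClosed_isBounded ?_ ?_
  · exact isClosed_closedPipe.inter (isClosed_Icc.preimage (by fun_prop))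
  · refine (Metric.isBounded_closedBall (x := (0 : E3)) (r := 1 + |c|)).subset ?_
    rintro x ⟨hx, hx2⟩
    rw [mem_closedBall_zero_iff, EuclideanSpace.norm_eq, Fin.sum_univ_three]
    simp only [Real.norm_eq_abs, sq_abs]
    refine Real.sqrt_le_iff.2 ⟨by positivity, ?_⟩
    have h1 := (rad_le_one_iff x).1 hx
    have h2 : x 2 ≤ |c| := hx2.2.trans (le_abs_self c)
    nlinarith [hx2.1, abs_nonneg c]

/-- The swirl of an Euler solution is bounded up to the blow-up time. This is the maximum principle
for the transport equation, applied to the square of the swirl minus the time. -/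
theorem exists_swirl_bound (h : IsAxisymEulerSolution a b T₀ v p) (hab : a < b) (hT : 0 < T₀) :
    ∃ C : ℝ, ∀ x ∈ closedPipe, ∀ t ∈ Ico 0 T₀, |swirl v (x, t)| ≤ C := by
  set K : Set E3 := {x : E3 | x ∈ closedPipe ∧ x 2 ∈ Icc 0 (b - a)} with hK
  have hKc : IsCompact K := isCompact_period _
  have hcont : ContinuousOn (swirl v) (spaceTime T₀) := (contDiffOn_swirl h).continuousOn
  have hred : ∀ x ∈ closedPipe, ∀ t ∈ Ico 0 T₀, ∃ y ∈ K, swirl v (x, t) = swirl v (y, t) := by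
    intro x hx t ht
    set x' : E3 := x + (-(x 2)) • eZ with hx'
    have hx'm : x' ∈ closedPipe := add_smul_eZ_mem_closedPipe hx _
    obtain ⟨s, hs, hs'⟩ := (swirl_periodic h hx'm ht).exists_mem_Ico₀ (by linarith) (x 2)
    refine ⟨x' + s • eZ, ⟨add_smul_eZ_mem_closedPipe hx'm _, ?_⟩, ?_⟩
    · have : (x' + s • eZ) 2 = s := by simp [hx', eZ]
      rw [this]; exact Ico_subset_Icc_self hs
    · rw [← hs', hx', add_assoc, ← add_smul]; simp
  have hK0 : (0 : E3) ∈ K := by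
    refine ⟨by simp [closedPipe, rad], ?_⟩
    simp only [PiLp.zero_apply, mem_Icc, le_refl, true_and]; linarith
  -- a bound for the initial swirl
  obtain ⟨C₀, hC₀⟩ : ∃ C₀ : ℝ, ∀ x ∈ K, swirl v (x, 0) ^ 2 ≤ C₀ := by
    have hc : ContinuousOn (fun x : E3 => swirl v (x, 0) ^ 2) K :=
      (hcont.comp (by fun_prop) fun x hx => ⟨hx.1, le_refl _, hT⟩).pow 2
    obtain ⟨C, hC⟩ := (hKc.image_of_continuousOn hc).bddAbove
    exact ⟨C, fun x hx => hC (mem_image_of_mem _ hx)⟩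
  have hC₀' : 0 ≤ C₀ := (sq_nonneg _).trans (hC₀ 0 hK0)
  have main : ∀ T ∈ Ico 0 T₀, ∀ x ∈ K, ∀ t ∈ Icc 0 T, swirl v (x, t) ^ 2 - t ≤ C₀ := by
    intro T hTT
    set F : E3 × ℝ → ℝ := fun z => swirl v z ^ 2 - z.2 with hF
    have hsub : K ×ˢ Icc 0 T ⊆ spaceTime T₀ := by
      rintro ⟨x, t⟩ ⟨hx, ht⟩
      exact ⟨hx.1, ht.1, ht.2.trans_lt hTT.2⟩
    have hFc : ContinuousOn F (K ×ˢ Icc 0 T) :=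
      ((hcont.mono hsub).pow 2).sub continuousOn_snd
    obtain ⟨⟨x, t⟩, ⟨hx, ht⟩, hmax⟩ := (hKc.prod isCompact_Icc).exists_isMaxOn
      ⟨(0, 0), hK0, le_refl _, hTT.1⟩ hFc
    have ht' : t ∈ Ico 0 T₀ := ⟨ht.1, ht.2.trans_lt hTT.2⟩
    have hz : (x, t) ∈ spaceTime T₀ := ⟨hx.1, ht'⟩
    have hmax' : ∀ y ∈ closedPipe, ∀ s ∈ Icc 0 T, F (y, s) ≤ F (x, t) := by
      intro y hy s hs
      obtain ⟨y', hy', he⟩ := hred y hy s ⟨hs.1, hs.2.trans_lt hTT.2⟩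
      have : F (y, s) = F (y', s) := by simp only [hF, he]
      rw [this]; exact hmax (mk_mem_prod hy' hs)
    suffices ht0 : t = 0 by
      intro y hy s hs
      refine (hmax (mk_mem_prod hy hs)).trans ?_
      subst ht0
      simpa [hF] using hC₀ x hx
    by_contra ht0
    have htpos : 0 < t := lt_of_le_of_ne ht.1 (Ne.symm ht0)
    set S' := fderivWithin ℝ (swirl v) (spaceTime T₀) (x, t) with hS'
    have hS : HasFDerivWithinAt (swirl v) S' (spaceTime T₀) (x, t) := hasFDerivWithinAt_swirl h hz
    have hFd : HasFDerivWithinAt F ((2 * swirl v (x, t)) • S' - ContinuousLinearMap.snd ℝ E3 ℝ)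
        (spaceTime T₀) (x, t) := by
      refine HasFDerivWithinAt.sub ?_ hasFDerivAt_snd.hasFDerivWithinAt
      have := hS.pow 2
      simpa using this
    have hmaxt : ∀ y ∈ closedPipe, F (y, t) ≤ F (x, t) := fun y hy => hmax' y hy t ht
    -- the spatial derivative in the direction of the flow vanishes
    have hspace : 2 * swirl v (x, t) * S' (v x t, 0) = 0 := by
      rcases lt_or_eq_of_le (show rad x ≤ 1 from hx.1) with hr | hr
      · have hl : ∀ᶠ s in 𝓝 (0 : ℝ), x + s • v x t ∈ closedPipe := by
          have hc : Continuous fun s : ℝ => x + s • v x t := by fun_prop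
          have := hc.continuousAt.eventually_mem (x := 0)
            (isOpen_pipe.mem_nhds (by simpa [mem_pipe] using hr))
          exact this.mono fun s hs => pipe_subset_closedPipe hs
        simpa using fderivWithin_eq_zero_of_line hFd ht' hmaxt hl
      · have hl : ∀ᶠ s in 𝓝 (0 : ℝ), x + s • eZ ∈ closedPipe :=
          Eventually.of_forall fun s => add_smul_eZ_mem_closedPipe hx.1 s
        have h1 := fderivWithin_eq_zero_of_line hFd ht' hmaxt hl
        have h2 : S' (perp x, 0) = 0 := fderivWithin_swirl_perp h hz
        have h3 : ((v x t, 0) : E3 × ℝ)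
            = swirl v (x, t) • (perp x, (0 : ℝ)) + v x t 2 • (eZ, (0 : ℝ)) := by
          ext1
          · simpa using velocity_boundary h hr ht'
          · simp
        rw [h3, map_add, map_smul, map_smul, h2]
        have h4 : 2 * swirl v (x, t) * S' (eZ, 0) = 0 := by simpa using h1
        simp only [smul_eq_mul, mul_zero, zero_add]
        linear_combination (v x t 2) * h4
    -- the time derivative is nonnegative, because the maximum is attained at a positive time
    have htime : 0 ≤ 2 * swirl v (x, t) * S' (0, 1) - 1 := by
      have hr : HasDerivWithinAt (fun s : ℝ => (x, s)) ((0 : E3), (1 : ℝ)) (Icc 0 t) t :=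
        (hasDerivWithinAt_const t _ x).prodMk (hasDerivWithinAt_id t _)
      have hm : MapsTo (fun s : ℝ => (x, s)) (Icc 0 t) (spaceTime T₀) := fun s hs =>
        ⟨hx.1, hs.1, hs.2.trans_lt ht'.2⟩
      have h1 := HasFDerivWithinAt.comp_hasDerivWithinAt (f := fun s : ℝ => (x, s)) t hFd hr hm
      have h2 : Tendsto (slope (F ∘ fun s : ℝ => (x, s)) t) (𝓝[<] t)
          (𝓝 (((2 * swirl v (x, t)) • S' - ContinuousLinearMap.snd ℝ E3 ℝ) ((0 : E3), (1 : ℝ)))) := by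
        refine (hasDerivWithinAt_iff_tendsto_slope.1 h1).mono_left ?_
        refine nhdsWithin_le_iff.2 ?_
        filter_upwards [Ioo_mem_nhdsLT htpos] with s hs
        exact ⟨⟨hs.1.le, hs.2.le⟩, hs.2.ne⟩
      have h3 := ge_of_tendsto h2 (b := 0) (by
        filter_upwards [Ioo_mem_nhdsLT htpos] with s hs
        rw [slope_def_field]
        refine div_nonneg_of_nonpos ?_ (by linarith [hs.2])
        have := hmax' x hx.1 s ⟨hs.1.le, hs.2.le.trans ht.2⟩
        simpa using this)
      simpa using h3
    have htr : S' (v x t, 1) = 0 := swirl_transport h hz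
    have hsum : S' (v x t, 1) = S' (v x t, 0) + S' (0, 1) := by rw [← map_add]; simp
    rw [htr] at hsum
    have : 2 * swirl v (x, t) * S' (v x t, 0) + 2 * swirl v (x, t) * S' (0, 1) = 0 := by
      rw [← mul_add, ← hsum, mul_zero]
    linarith
  refine ⟨Real.sqrt (C₀ + T₀), fun x hx t ht => ?_⟩
  obtain ⟨y, hy, he⟩ := hred x hx t ht
  rw [he]
  refine Real.abs_le_sqrt ?_
  have := main t ht y hy t ⟨ht.1, le_refl _⟩
  linarith [ht.2]

end Swirl

/-! ### Profiles with decaying gradient -/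

theorem norm_fderiv_le_gradNorm (V : E3 → E3) (y : E3) : ‖fderiv ℝ V y‖ ≤ gradNorm V y := by
  refine ContinuousLinearMap.opNorm_le_bound _ (Real.sqrt_nonneg _) fun x => ?_
  have hx : x = ∑ i, x i • EuclideanSpace.single i (1 : ℝ) := by
    ext j; simp [Finset.sum_apply, Pi.single_apply]
  calc ‖fderiv ℝ V y x‖
      = ‖∑ i, x i • fderiv ℝ V y (EuclideanSpace.single i (1 : ℝ))‖ := by
        conv_lhs => rw [hx]
        simp only [map_sum, map_smul]
    _ ≤ ∑ i, ‖fderiv ℝ V y (EuclideanSpace.single i (1 : ℝ))‖ * ‖x i‖ := by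
        refine (norm_sum_le _ _).trans (le_of_eq (Finset.sum_congr rfl fun i _ => ?_))
        rw [norm_smul, mul_comm]
    _ ≤ gradNorm V y * ‖x‖ := by
        rw [EuclideanSpace.norm_eq]
        exact Real.sum_mul_le_sqrt_mul_sqrt _ _ _

section Profile

variable {V : E3 → E3} {C : ℝ}

theorem norm_profile_sub_le (hV : Differentiable ℝ V) (hC : ∀ y, ‖y‖ * ‖fderiv ℝ V y‖ ≤ C)
    {X y : E3} (h : ‖y‖ < ‖X‖) : ‖V (X + y) - V X‖ ≤ C * ‖y‖ / (‖X‖ - ‖y‖) := by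
  have hpos : 0 < ‖X‖ - ‖y‖ := by linarith
  have hb : ∀ z ∈ Metric.closedBall X ‖y‖, ‖fderiv ℝ V z‖ ≤ C / (‖X‖ - ‖y‖) := by
    intro z hz
    rw [le_div_iff₀ hpos]
    have h1 : ‖X‖ - ‖y‖ ≤ ‖z‖ := by
      have h2 : ‖X‖ - ‖z‖ ≤ ‖X - z‖ := norm_sub_norm_le X z
      have h3 : ‖X - z‖ ≤ ‖y‖ := by rw [← dist_eq_norm, dist_comm]; exact hz
      linarith
    calc ‖fderiv ℝ V z‖ * (‖X‖ - ‖y‖) ≤ ‖fderiv ℝ V z‖ * ‖z‖ := by gcongr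
      _ ≤ C := by rw [mul_comm]; exact hC z
  have := (convex_closedBall X ‖y‖).norm_image_sub_le_of_norm_fderiv_le
    (fun z _ => hV z) hb (Metric.mem_closedBall_self (norm_nonneg _))
    (show X + y ∈ Metric.closedBall X ‖y‖ by simp)
  refine this.trans (le_of_eq ?_)
  simp; ring

/-- By scaling, two points at a bounded distance from each other, and far from the origin, have
close values at every scale. -/
theorem norm_profile_smul_sub_le (hV : Differentiable ℝ V) (hC : ∀ y, ‖y‖ * ‖fderiv ℝ V y‖ ≤ C)
    {X y : E3} (h : ‖y‖ < ‖X‖) {m : ℝ} (hm : 0 < m) :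
    ‖V (m • (X + y)) - V (m • X)‖ ≤ C * ‖y‖ / (‖X‖ - ‖y‖) := by
  have h1 : ‖m • y‖ < ‖m • X‖ := by
    rw [norm_smul, norm_smul]; gcongr; simpa using hm.ne'
  rw [smul_add]
  refine (norm_profile_sub_le hV hC h1).trans (le_of_eq ?_)
  rw [norm_smul, norm_smul, Real.norm_of_nonneg hm.le]
  have : ‖X‖ - ‖y‖ ≠ 0 := by linarith
  field_simp

/-- A profile with decaying gradient is Lipschitz in the logarithm of the scale, uniformly in the
direction and the distance of the point. -/
theorem norm_profile_exp_sub_le (hV : Differentiable ℝ V) (hC : ∀ y, ‖y‖ * ‖fderiv ℝ V y‖ ≤ C)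
    (X : E3) (s t : ℝ) : ‖V (Real.exp s • X) - V (Real.exp t • X)‖ ≤ C * |s - t| := by
  have hd : ∀ s : ℝ, HasDerivAt (fun s => V (Real.exp s • X))
      (fderiv ℝ V (Real.exp s • X) (Real.exp s • X)) s := fun s =>
    (hV _).hasFDerivAt.comp_hasDerivAt s ((Real.hasDerivAt_exp s).smul_const X)
  have := convex_univ.norm_image_sub_le_of_norm_hasDerivWithin_le (C := C) (x := t) (y := s)
    (fun s _ => (hd s).hasDerivWithinAt) (fun s _ => ?_) (mem_univ _) (mem_univ _)
  · simpa using this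
  · refine (ContinuousLinearMap.le_opNorm _ _).trans ?_
    rw [mul_comm]; exact hC _

end Profile

/-- A uniformly bounded and uniformly Lipschitz sequence of functions on the line has a pointwise
convergent subsequence. -/
theorem exists_subseq_tendsto_of_lipschitz {H : ℕ → ℝ → E3} {C B : ℝ}
    (hB : ∀ k s, ‖H k s‖ ≤ B) (hL : ∀ k s t, ‖H k s - H k t‖ ≤ C * |s - t|) :
    ∃ (φ : ℕ → ℕ) (L : ℝ → E3), StrictMono φ ∧
      ∀ s, Tendsto (fun k => H (φ k) s) atTop (𝓝 (L s)) := by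
  have hcpt : IsCompact (univ.pi fun _ : ℚ => Metric.closedBall (0 : E3) B) :=
    isCompact_univ_pi fun _ => isCompact_closedBall _ _
  obtain ⟨l, -, φ, hφ, hl⟩ := hcpt.tendsto_subseq
    (x := fun k (q : ℚ) => H k q) (fun k q _ => by simpa using hB k q)
  have hl' : ∀ q : ℚ, Tendsto (fun k => H (φ k) q) atTop (𝓝 (l q)) := fun q =>
    (tendsto_pi_nhds.1 hl q)
  have hC : 0 ≤ C := by simpa using (norm_nonneg _).trans (hL 0 1 0)
  have hcauchy : ∀ s : ℝ, CauchySeq fun k => H (φ k) s := by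
    intro s
    rw [Metric.cauchySeq_iff]
    intro ε hε
    obtain ⟨q, hq⟩ : ∃ q : ℚ, |s - q| < ε / (4 * (C + 1)) := by
      obtain ⟨q, hq⟩ := exists_rat_btwn (show s - ε / (4 * (C + 1)) < s by
        have : 0 < ε / (4 * (C + 1)) := by positivity
        linarith)
      refine ⟨q, ?_⟩
      rw [abs_of_pos (by linarith)]; linarith
    have hq' : C * |s - q| ≤ ε / 4 := by
      have : |s - q| * (4 * (C + 1)) < ε := by rwa [lt_div_iff₀ (by positivity)] at hq
      nlinarith [abs_nonneg (s - q)]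
    obtain ⟨N, hN⟩ := Metric.cauchySeq_iff.1 (hl' q).cauchySeq (ε / 2) (by positivity)
    refine ⟨N, fun m hm n hn => ?_⟩
    have h1 := hN m hm n hn
    have h2 := hL (φ m) s q
    have h3 := hL (φ n) s q
    rw [dist_eq_norm] at h1 ⊢
    have h4 : H (φ m) s - H (φ n) s = (H (φ m) s - H (φ m) q) + (H (φ m) q - H (φ n) q)
        - (H (φ n) s - H (φ n) q) := by abel
    rw [h4]
    have h5 := norm_sub_le ((H (φ m) s - H (φ m) q) + (H (φ m) q - H (φ n) q))
      (H (φ n) s - H (φ n) q)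
    have h6 := norm_add_le (H (φ m) s - H (φ m) q) (H (φ m) q - H (φ n) q)
    linarith
  choose L hLim using fun s => cauchySeq_tendsto_of_complete (hcauchy s)
  exact ⟨φ, L, hφ, hLim⟩

/-- For a uniformly Lipschitz sequence, pointwise convergence is continuous convergence. -/
theorem tendsto_of_lipschitz_of_tendsto {ι : Type*} {l : Filter ι} {H : ι → ℝ → E3} {C s : ℝ}
    {L : E3} (hL : ∀ k s t, ‖H k s - H k t‖ ≤ C * |s - t|)
    (hs : Tendsto (fun k => H k s) l (𝓝 L)) {r : ι → ℝ} (hr : Tendsto r l (𝓝 s)) :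
    Tendsto (fun k => H k (r k)) l (𝓝 L) := by
  have h1 : Tendsto (fun k => H k (r k) - H k s) l (𝓝 0) := by
    refine squeeze_zero_norm (fun k => hL k (r k) s) ?_
    have : Tendsto (fun k => |r k - s|) l (𝓝 0) := by
      simpa using (hr.sub_const s).abs
    simpa using this.const_mul C
  simpa using h1.add hs

/-! ### The blow-up sequence near the side boundary -/

theorem cylSide_subset_closedPipe {a b : ℝ} : cylSide a b ⊆ closedPipe := fun _ hx =>
  mem_closedPipe.2 hx.1

theorem cyl_subset_cylSide {a b : ℝ} : cyl a b ⊆ cylSide a b := fun _ hx =>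
  ⟨hx.1.le, hx.2⟩

/-- The horizontal contraction towards the axis. -/
noncomputable def contract (s : ℝ) (x : E3) : E3 := !₂[s * x 0, s * x 1, x 2]

theorem tendsto_contract (x : E3) : Tendsto (fun s => contract s x) (𝓝[<] 1) (𝓝 x) := by
  have h : Continuous fun s => contract s x := by
    unfold contract
    refine (PiLp.continuous_toLp 2 _).comp (continuous_pi fun i => ?_)
    fin_cases i <;> simp <;> fun_prop
  have h1 : contract 1 x = x := by ext i; fin_cases i <;> simp [contract]
  simpa [h1] using (h.tendsto 1).mono_left nhdsWithin_le_nhds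

theorem rad_contract {s : ℝ} (hs : 0 ≤ s) (x : E3) : rad (contract s x) = s * rad x := by
  simp only [rad, contract]
  rw [← Real.sqrt_sq hs, ← Real.sqrt_mul (sq_nonneg s), Real.sqrt_sq hs]
  congr 1
  simp; ring

theorem contract_mem_cyl {a b s : ℝ} {x : E3} (hx : x ∈ cylSide a b) (hs : 0 ≤ s) (hs' : s < 1) :
    contract s x ∈ cyl a b := by
  refine ⟨?_, by simpa [contract] using hx.2⟩
  rw [rad_contract hs]
  have := hx.1
  nlinarith [rad_nonneg x]

/-- An estimate on the velocity by the profile extends from the open cylinder to its side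
boundary. -/
theorem norm_sub_profile_le_of_cylSide {a b T₀ : ℝ} {v : E3 → ℝ → E3} {p : E3 → ℝ → ℝ}
    (h : IsAxisymEulerSolution a b T₀ v p) {t c m M : ℝ} (ht : t ∈ Ico 0 T₀) {V : E3 → E3}
    (hV : Continuous V) (hb : ∀ x ∈ cyl a b, ‖c • v x t - V (m • x)‖ ≤ M)
    {x : E3} (hx : x ∈ cylSide a b) : ‖c • v x t - V (m • x)‖ ≤ M := by
  have hlim : Tendsto (fun s => contract s x) (𝓝[<] 1) (𝓝[closedPipe] x) := by
    refine tendsto_nhdsWithin_iff.2 ⟨tendsto_contract x, ?_⟩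
    filter_upwards [Ioo_mem_nhdsLT (show (0 : ℝ) < 1 by norm_num)] with s hs
    exact cylSide_subset_closedPipe (cyl_subset_cylSide (contract_mem_cyl hx hs.1.le hs.2))
  have hv : ContinuousOn (fun y => v y t) closedPipe :=
    h.smooth_velocity.continuousOn.comp (f := fun y : E3 => (y, t)) (by fun_prop)
      fun y hy => ⟨hy, ht⟩
  have hc : ContinuousOn (fun y => ‖c • v y t - V (m • y)‖) closedPipe := by fun_prop
  refine le_of_tendsto ((hc x (cylSide_subset_closedPipe hx)).tendsto.comp hlim) ?_
  filter_upwards [Ioo_mem_nhdsLT (show (0 : ℝ) < 1 by norm_num)] with s hs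
  exact hb _ (contract_mem_cyl hx hs.1.le hs.2)

theorem mem_limitDomain_of_eventually {α a b : ℝ} {x : ℕ → E3} {Q : ℕ → ℝ} {φ : ℕ → ℕ} {z₀ : E3}
    (h : ∀ᶠ w : ℕ × E3 in atTop ×ˢ 𝓝 z₀, unscaleX α (Q (φ w.1)) (x (φ w.1)) w.2 ∈ cyl a b) :
    z₀ ∈ limitDomain α a b x Q φ := by
  obtain ⟨P, hP, R, hR, hPR⟩ := eventually_prod_iff.1 h
  obtain ⟨ε, hε, hball⟩ := Metric.eventually_nhds_iff_ball.1 hR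
  exact ⟨ε, hε, hP.mono fun k hk z hz => hPR hk (hball z hz)⟩

/-- The limits of the scaled cylinders are not empty: they contain a multiple of the inner normal
at the limit of the centres. -/
theorem limitDomain_nonempty {α a b : ℝ} (hα : α ∈ Ioo (0 : ℝ) 1) {x : ℕ → E3} {Q : ℕ → ℝ}
    {φ : ℕ → ℕ} {y : E3} (hy : y ∈ cylSide a b) (hy0 : 0 < rad y) (hx : ∀ k, x k ∈ cylSide a b)
    (hlim : Tendsto x atTop (𝓝 y)) (hQ : ∀ k, 0 < Q k) (hQlim : Tendsto Q atTop atTop)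
    (hφ : StrictMono φ) : (limitDomain α a b x Q φ).Nonempty := by
  set z₀ : E3 := !₂[-(y 0), -(y 1), 0] with hz₀
  obtain ⟨q, hq⟩ : ∃ q : ℕ → ℝ, ∀ k, q k = Q (φ k) ^ (-((1 - α) / α)) := ⟨_, fun _ => rfl⟩
  have hqpos : ∀ k, 0 < q k := fun k => hq k ▸ Real.rpow_pos_of_pos (hQ _) _
  have hβ : 0 < (1 - α) / α := div_pos (by linarith [hα.2]) hα.1
  have hqlim : Tendsto q atTop (𝓝 0) := by
    rw [funext hq]
    exact (tendsto_rpow_neg_atTop hβ).comp (hQlim.comp hφ.tendsto_atTop)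
  have hxlim : Tendsto (fun k => x (φ k)) atTop (𝓝 y) := hlim.comp hφ.tendsto_atTop
  suffices h : ∀ᶠ w : ℕ × E3 in atTop ×ˢ 𝓝 z₀, q w.1 • w.2 + x (φ w.1) ∈ cyl a b by
    refine ⟨z₀, mem_limitDomain_of_eventually (h.mono fun w hw => ?_)⟩
    rwa [unscaleX, ← hq]
  have hX : Tendsto (fun w : ℕ × E3 => x (φ w.1)) (atTop ×ˢ 𝓝 z₀) (𝓝 y) := hxlim.comp tendsto_fst
  have hq' : Tendsto (fun w : ℕ × E3 => q w.1) (atTop ×ˢ 𝓝 z₀) (𝓝 0) := hqlim.comp tendsto_fst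
  have hZ : Tendsto (fun w : ℕ × E3 => w.2) (atTop ×ˢ 𝓝 z₀) (𝓝 z₀) := tendsto_snd
  have happ : ∀ (i : Fin 3) (u : E3), Tendsto (fun x : E3 => x i) (𝓝 u) (𝓝 (u i)) := fun i u =>
    (show Continuous fun x : E3 => x i by fun_prop).tendsto u
  have hX' : ∀ i, Tendsto (fun w : ℕ × E3 => x (φ w.1) i) (atTop ×ˢ 𝓝 z₀) (𝓝 (y i)) :=
    fun i => (happ i y).comp hX
  have hZ' : ∀ i, Tendsto (fun w : ℕ × E3 => w.2 i) (atTop ×ˢ 𝓝 z₀) (𝓝 (z₀ i)) :=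
    fun i => (happ i z₀).comp hZ
  -- the inner normal direction makes the distance to the axis decrease at first order
  have hdir : Tendsto (fun w : ℕ × E3 => 2 * (x (φ w.1) 0 * w.2 0 + x (φ w.1) 1 * w.2 1)
      + q w.1 * (w.2 0 ^ 2 + w.2 1 ^ 2)) (atTop ×ˢ 𝓝 z₀) (𝓝 (-2 * rad y ^ 2)) := by
    have := ((((hX' 0).mul (hZ' 0)).add ((hX' 1).mul (hZ' 1))).const_mul 2).add
      (hq'.mul (((hZ' 0).pow 2).add ((hZ' 1).pow 2)))
    have he : 2 * (y 0 * z₀ 0 + y 1 * z₀ 1) + 0 * (z₀ 0 ^ 2 + z₀ 1 ^ 2) = -2 * rad y ^ 2 := by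
      rw [rad_sq]; simp [hz₀]; ring
    rwa [he] at this
  have hheight : Tendsto (fun w : ℕ × E3 => q w.1 * w.2 2 + x (φ w.1) 2) (atTop ×ˢ 𝓝 z₀)
      (𝓝 (y 2)) := by
    have := (hq'.mul (hZ' 2)).add (hX' 2)
    simpa using this
  filter_upwards [hdir.eventually_lt_const (show -2 * rad y ^ 2 < 0 by nlinarith),
    hheight.eventually_const_lt hy.2.1, hheight.eventually_lt_const hy.2.2] with w h1 h2 h3
  refine ⟨?_, by simpa using h2, by simpa using h3⟩
  rw [rad_lt_one_iff]
  have h4 := (rad_le_one_iff _).1 (hx (φ w.1)).1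
  have h5 := mul_neg_of_pos_of_neg (hqpos w.1) h1
  simp only [PiLp.add_apply, PiLp.smul_apply, smul_eq_mul]
  nlinarith

theorem time_unscale {α T₀ q t s : ℝ} (hq : 0 < q) :
    T₀ - unscaleT α q t s = q ^ (-(1 / α)) * (q ^ (1 / α) * (T₀ - t) - s) := by
  have h : q ^ (-(1 / α)) * q ^ (1 / α) = 1 := by
    rw [← Real.rpow_add hq]; simp
  unfold unscaleT
  linear_combination (t - T₀) * h

/-- In the variables of the blow-up, the profile estimate compares the blow-up solution with the
profile, up to the factor which the self-similar scaling prescribes. -/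
theorem norm_blowup_sub_profile_le {α a b T₀ : ℝ} (hα : α ∈ Ioo (0 : ℝ) 1) {v : E3 → ℝ → E3}
    {V : E3 → E3} {G : ℝ → ℝ} {x : ℕ → E3} {t Q : ℕ → ℝ}
    (hest : ∀ x ∈ cylSide a b, ∀ t ∈ Ico 0 T₀,
      ‖(T₀ - t) ^ α • v x t - V ((1 / (T₀ - t) ^ (1 - α)) • x)‖ ≤ G t)
    {k : ℕ} (hQ : 0 < Q k) (ht : t k < T₀) {y : E3} {s : ℝ} (hs : s ≤ 0)
    (hy : unscaleX α (Q k) (x k) y ∈ cylSide a b)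
    (hs' : unscaleT α (Q k) (t k) s ∈ Ico 0 T₀) :
    ‖(Q k ^ (1 / α) * (T₀ - t k) - s) ^ α • blowup α v x t Q k y s
      - V (Real.exp (-(1 - α) * Real.log (Q k ^ (1 / α) * (T₀ - t k) - s)) •
          (Q k ^ ((1 - α) / α) • x k + y))‖ ≤ G (unscaleT α (Q k) (t k) s) := by
  have h := hest _ hy _ hs'
  have hα0 : α ≠ 0 := hα.1.ne'
  set μ := Q k ^ (1 / α) * (T₀ - t k) - s with hμ
  have hμpos : 0 < μ := by
    have : 0 < Q k ^ (1 / α) * (T₀ - t k) := mul_pos (Real.rpow_pos_of_pos hQ _) (by linarith)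
    linarith
  have hqp : 0 < Q k ^ (-(1 / α)) := Real.rpow_pos_of_pos hQ _
  rw [time_unscale hQ, ← hμ, Real.mul_rpow hqp.le hμpos.le, Real.mul_rpow hqp.le hμpos.le,
    ← Real.rpow_mul hQ.le, ← Real.rpow_mul hQ.le] at h
  have e1 : -(1 / α) * α = -1 := by field_simp
  have e2 : -(1 / α) * (1 - α) = -((1 - α) / α) := by field_simp
  rw [e1, e2, Real.rpow_neg_one] at h
  have e3 : Real.exp (-(1 - α) * Real.log μ) = (μ ^ (1 - α))⁻¹ := by
    rw [neg_mul, Real.exp_neg, Real.rpow_def_of_pos hμpos, mul_comm (1 - α)]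
  have e4 : (1 / (Q k ^ (-((1 - α) / α)) * μ ^ (1 - α))) • unscaleX α (Q k) (x k) y
      = (μ ^ (1 - α))⁻¹ • (Q k ^ ((1 - α) / α) • x k + y) := by
    have hne : Q k ^ ((1 - α) / α) ≠ 0 := (Real.rpow_pos_of_pos hQ _).ne'
    have hne' : μ ^ (1 - α) ≠ 0 := (Real.rpow_pos_of_pos hμpos _).ne'
    unfold unscaleX
    rw [Real.rpow_neg hQ.le]
    simp only [smul_add, smul_smul]
    rw [add_comm]
    congr 2 <;> field_simp
  rw [e4] at h
  rw [e3]
  have e5 : μ ^ α • blowup α v x t Q k y s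
      = ((Q k)⁻¹ * μ ^ α) • v (unscaleX α (Q k) (x k) y) (unscaleT α (Q k) (t k) s) := by
    unfold blowup
    rw [smul_smul, mul_comm]
  rw [e5]; exact h

theorem isOpen_cyl {a b : ℝ} : IsOpen (cyl a b) := by
  have h2 : Continuous fun x : E3 => x 2 := by fun_prop
  exact (isOpen_lt continuous_rad continuous_const).inter
    ((isOpen_lt continuous_const h2).inter (isOpen_lt h2 continuous_const))

theorem zero_mem_cyl {a b : ℝ} (ha : a < 0) (hb : 0 < b) : (0 : E3) ∈ cyl a b :=
  ⟨by simp [rad], by simpa using ha, by simpa using hb⟩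

/-- The velocity is compared with the profile, with an infinitesimal error, up to the side
boundary. -/
theorem IsASSS.exists_estimate {α a b T₀ : ℝ} {v : E3 → ℝ → E3} {p : E3 → ℝ → ℝ} {V : E3 → E3}
    {W : E3 → ℝ → E3} (hsol : IsAxisymEulerSolution a b T₀ v p) (hS : IsASSS α a b T₀ v V W)
    (hV : Continuous V) :
    ∃ G : ℝ → ℝ, Tendsto G (𝓝[<] T₀) (𝓝 0) ∧ ∀ x ∈ cylSide a b, ∀ t ∈ Ico 0 T₀,
      ‖(T₀ - t) ^ α • v x t - V ((1 / (T₀ - t) ^ (1 - α)) • x)‖ ≤ G t := by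
  obtain ⟨-, ⟨C, hC⟩, g, hg, hform⟩ := hS
  refine ⟨fun t => |g t| * C, by simpa using hg.abs.mul_const C, fun x hx t ht => ?_⟩
  refine norm_sub_profile_le_of_cylSide hsol ht hV (fun y hy => ?_) hx
  have hpos : 0 < (T₀ - t) ^ α := Real.rpow_pos_of_pos (by linarith [ht.2]) _
  have he : (T₀ - t) ^ α • v y t - V ((1 / (T₀ - t) ^ (1 - α)) • y) = g t • W y t := by
    rw [hform y hy t ht, smul_add, smul_smul, smul_smul, mul_one_div_cancel hpos.ne',
      mul_div_cancel₀ _ hpos.ne', one_smul, add_sub_cancel_left]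
  rw [he, norm_smul, Real.norm_eq_abs]
  exact mul_le_mul_of_nonneg_left (hC y hy t ht) (abs_nonneg _)

/-- Near maximal blow-up points of an asymptotically self-similar solution have the self-similar
blow-up rate. -/
theorem exists_rate_bounds {α a b T₀ : ℝ} (hα : α ∈ Ioo (0 : ℝ) 1) (ha : a < 0) (hb : 0 < b)
    {v : E3 → ℝ → E3} {V : E3 → E3} {G : ℝ → ℝ} {x : ℕ → E3} {t Q : ℕ → ℝ} {B : ℝ}
    (hB : ∀ y, ‖V y‖ ≤ B) (hV0 : ∃ y, V y ≠ 0) (hG : Tendsto G (𝓝[<] T₀) (𝓝 0))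
    (hest : ∀ x ∈ cylSide a b, ∀ t ∈ Ico 0 T₀,
      ‖(T₀ - t) ^ α • v x t - V ((1 / (T₀ - t) ^ (1 - α)) • x)‖ ≤ G t)
    (hx : IsBlowupPoints a b T₀ v x t) (hQ : IsScale v x t Q) (hm : IsNearMaximal a b v x t) :
    ∃ m > 0, ∃ M : ℝ, ∀ᶠ k in atTop, Q k * (T₀ - t k) ^ α ∈ Icc m M := by
  obtain ⟨hxm, htm, -, htlim, -, -⟩ := hx
  obtain ⟨hQpos, c₀, hc₀, hQc⟩ := hQ
  obtain ⟨c, hc, hmax⟩ := hm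
  obtain ⟨y₀, hy₀⟩ := hV0
  have hy₀' : 0 < ‖V y₀‖ := norm_pos_iff.2 hy₀
  have hc₀' : 0 < c₀ := by linarith
  have htlim' : Tendsto t atTop (𝓝[<] T₀) :=
    tendsto_nhdsWithin_iff.2 ⟨htlim, Eventually.of_forall fun k => (htm k).2⟩
  have hGt : Tendsto (fun k => G (t k)) atTop (𝓝 0) := hG.comp htlim'
  have hτ : ∀ k, 0 < T₀ - t k := fun k => by linarith [(htm k).2]
  have hτa : ∀ k, 0 < (T₀ - t k) ^ α := fun k => Real.rpow_pos_of_pos (hτ k) _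
  have hpt : Tendsto (fun k => (T₀ - t k) ^ (1 - α) • y₀) atTop (𝓝 0) := by
    have h1 : Tendsto (fun k => T₀ - t k) atTop (𝓝 0) := by simpa using htlim.const_sub T₀
    have h2 := h1.rpow_const (p := 1 - α) (Or.inr (by linarith [hα.2]))
    rw [Real.zero_rpow (by linarith [hα.2])] at h2
    simpa using h2.smul_const y₀
  refine ⟨c * c₀⁻¹ * (‖V y₀‖ / 2), by positivity, c₀ * (B + 1), ?_⟩
  filter_upwards [hpt.eventually_mem (isOpen_cyl.mem_nhds (zero_mem_cyl ha hb)),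
    hGt.eventually_lt_const (show 0 < ‖V y₀‖ / 2 by positivity),
    hGt.eventually_lt_const one_pos] with k hk hG1 hG2
  have hn : ∀ y, ‖(T₀ - t k) ^ α • v y (t k)‖ = (T₀ - t k) ^ α * ‖v y (t k)‖ := fun y => by
    rw [norm_smul, Real.norm_of_nonneg (hτa k).le]
  constructor
  · have h1 := hest _ (cyl_subset_cylSide hk) _ (htm k)
    rw [smul_smul, one_div_mul_cancel (Real.rpow_pos_of_pos (hτ k) _).ne', one_smul] at h1
    have h2 := norm_sub_norm_le (V y₀) ((T₀ - t k) ^ α • v ((T₀ - t k) ^ (1 - α) • y₀) (t k))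
    rw [norm_sub_rev, hn] at h2
    have h3 := hmax k (t k) ⟨(htm k).1, le_refl _⟩ _ hk
    have h4 := (hQc k).1
    have h5 : ‖V y₀‖ / 2 ≤ (T₀ - t k) ^ α * ‖v ((T₀ - t k) ^ (1 - α) • y₀) (t k)‖ := by linarith
    calc c * c₀⁻¹ * (‖V y₀‖ / 2)
        ≤ c * c₀⁻¹ * ((T₀ - t k) ^ α * ‖v ((T₀ - t k) ^ (1 - α) • y₀) (t k)‖) := by gcongr
      _ = (T₀ - t k) ^ α * (c₀⁻¹ * (c * ‖v ((T₀ - t k) ^ (1 - α) • y₀) (t k)‖)) := by ring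
      _ ≤ (T₀ - t k) ^ α * (c₀⁻¹ * ‖v (x k) (t k)‖) := by
          have := hτa k
          gcongr
      _ ≤ (T₀ - t k) ^ α * Q k := mul_le_mul_of_nonneg_left h4 (hτa k).le
      _ = Q k * (T₀ - t k) ^ α := mul_comm _ _
  · have h1 := hest _ (hxm k) _ (htm k)
    have h2 := norm_sub_norm_le ((T₀ - t k) ^ α • v (x k) (t k))
      (V ((1 / (T₀ - t k) ^ (1 - α)) • x k))
    rw [hn] at h2
    have h3 := hB ((1 / (T₀ - t k) ^ (1 - α)) • x k)
    calc Q k * (T₀ - t k) ^ α ≤ c₀ * ‖v (x k) (t k)‖ * (T₀ - t k) ^ α :=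
          mul_le_mul_of_nonneg_right (hQc k).2 (hτa k).le
      _ = c₀ * ((T₀ - t k) ^ α * ‖v (x k) (t k)‖) := by ring
      _ ≤ c₀ * (B + 1) := by gcongr; linarith

/-- Convergence of the blow-up solutions along variable points, uniformly in the spatial
variable. The limit does not depend on the spatial variable, because the gradient of the profile
decays and the centres of the blow-up escape to infinity in the self-similar variables. -/
theorem tendsto_blowup {α a b T₀ : ℝ} (hα : α ∈ Ioo (0 : ℝ) 1) (hT : 0 < T₀)
    {v : E3 → ℝ → E3} {V : E3 → E3} {G : ℝ → ℝ} {x : ℕ → E3} {t Q : ℕ → ℝ} {C : ℝ}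
    (hV : Differentiable ℝ V) (hC : ∀ y, ‖y‖ * ‖fderiv ℝ V y‖ ≤ C)
    (hG : Tendsto G (𝓝[<] T₀) (𝓝 0))
    (hest : ∀ x ∈ cylSide a b, ∀ t ∈ Ico 0 T₀,
      ‖(T₀ - t) ^ α • v x t - V ((1 / (T₀ - t) ^ (1 - α)) • x)‖ ≤ G t)
    (hQ : ∀ k, 0 < Q k) (ht : ∀ k, t k < T₀) (htlim : Tendsto t atTop (𝓝 T₀))
    (hQlim : Tendsto Q atTop atTop)
    (hX : Tendsto (fun k => ‖Q k ^ ((1 - α) / α) • x k‖) atTop atTop)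
    {ι : Type*} {l : Filter ι} {n : ι → ℕ} (hn : Tendsto n l atTop)
    {μ s₀ : ℝ} {L : E3} (hμpos : 0 < μ)
    (hμ : Tendsto (fun i => Q (n i) ^ (1 / α) * (T₀ - t (n i))) l (𝓝 μ))
    (hs₀ : s₀ ≤ 0)
    (hL : Tendsto (fun i => V (Real.exp (-(1 - α) * Real.log (μ - s₀)) •
      (Q (n i) ^ ((1 - α) / α) • x (n i)))) l (𝓝 L))
    {y : ι → E3} {s : ι → ℝ} {M : ℝ} (hy : ∀ᶠ i in l, ‖y i‖ ≤ M)
    (hs : ∀ᶠ i in l, s i ≤ 0) (hslim : Tendsto s l (𝓝 s₀))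
    (hmem : ∀ᶠ i in l, unscaleX α (Q (n i)) (x (n i)) (y i) ∈ cylSide a b) :
    Tendsto (fun i => blowup α v x t Q (n i) (y i) (s i)) l (𝓝 (((μ - s₀) ^ α)⁻¹ • L)) := by
  have hm0 : 0 < μ - s₀ := by linarith
  obtain ⟨m, hm⟩ : ∃ m : ι → ℝ, ∀ i, m i = Q (n i) ^ (1 / α) * (T₀ - t (n i)) - s i :=
    ⟨_, fun _ => rfl⟩
  have hmlim : Tendsto m l (𝓝 (μ - s₀)) := by
    rw [funext hm]; exact hμ.sub hslim
  have hmpos : ∀ᶠ i in l, 0 < m i := hmlim.eventually_const_lt hm0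
  -- the unscaled times
  have hT' : Tendsto (fun i => unscaleT α (Q (n i)) (t (n i)) (s i)) l (𝓝[<] T₀) := by
    refine tendsto_nhdsWithin_iff.2 ⟨?_, ?_⟩
    · have h1 : Tendsto (fun i => Q (n i) ^ (-(1 / α))) l (𝓝 0) :=
        (tendsto_rpow_neg_atTop (one_div_pos.2 hα.1)).comp (hQlim.comp hn)
      have h2 := (h1.mul hslim).add (htlim.comp hn)
      rw [zero_mul, zero_add] at h2
      exact h2
    · filter_upwards [hmpos] with i hi
      have h1 := time_unscale (α := α) (T₀ := T₀) (t := t (n i)) (s := s i) (hQ (n i))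
      rw [← hm] at h1
      have h2 := mul_pos (Real.rpow_pos_of_pos (hQ (n i)) (-(1 / α))) hi
      rw [← h1] at h2
      exact mem_Iio.2 (sub_pos.1 h2)
  have hT'mem : ∀ᶠ i in l, unscaleT α (Q (n i)) (t (n i)) (s i) ∈ Ico 0 T₀ := by
    filter_upwards [hT'.eventually_mem (Ioo_mem_nhdsLT hT)] with i hi using ⟨hi.1.le, hi.2⟩
  -- the profile along the orbit of the centres
  have hr : Tendsto (fun i => -(1 - α) * Real.log (m i)) l
      (𝓝 (-(1 - α) * Real.log (μ - s₀))) := (hmlim.log hm0.ne').const_mul _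
  have hH : Tendsto (fun i => V (Real.exp (-(1 - α) * Real.log (m i)) •
      (Q (n i) ^ ((1 - α) / α) • x (n i)))) l (𝓝 L) :=
    tendsto_of_lipschitz_of_tendsto
      (H := fun i r => V (Real.exp r • (Q (n i) ^ ((1 - α) / α) • x (n i))))
      (fun i r r' => norm_profile_exp_sub_le hV hC _ r r') hL hr
  have hXn : Tendsto (fun i => ‖Q (n i) ^ ((1 - α) / α) • x (n i)‖) l atTop := hX.comp hn
  have hC0 : 0 ≤ C := le_trans (by positivity) (hC 0)
  have hsmall : Tendsto (fun i => G (unscaleT α (Q (n i)) (t (n i)) (s i))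
      + C * M / (‖Q (n i) ^ ((1 - α) / α) • x (n i)‖ - M)) l (𝓝 0) := by
    have h1 : Tendsto (fun i => ‖Q (n i) ^ ((1 - α) / α) • x (n i)‖ - M) l atTop :=
      tendsto_atTop_add_const_right _ _ hXn
    simpa using (hG.comp hT').add (h1.const_div_atTop (C * M))
  have hdiff : Tendsto (fun i => m i ^ α • blowup α v x t Q (n i) (y i) (s i)
      - V (Real.exp (-(1 - α) * Real.log (m i)) • (Q (n i) ^ ((1 - α) / α) • x (n i)))) l
      (𝓝 0) := by
    refine squeeze_zero_norm' ?_ hsmall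
    filter_upwards [hy, hs, hmem, hT'mem, hXn.eventually_gt_atTop M] with i h1 h2 h3 h4 h5
    have h6 := norm_blowup_sub_profile_le hα hest (hQ (n i)) (ht (n i)) h2 h3 h4
    rw [← hm] at h6
    have h7 := norm_profile_smul_sub_le hV hC (lt_of_le_of_lt h1 h5)
      (Real.exp_pos (-(1 - α) * Real.log (m i)))
    have h8 : C * ‖y i‖ / (‖Q (n i) ^ ((1 - α) / α) • x (n i)‖ - ‖y i‖)
        ≤ C * M / (‖Q (n i) ^ ((1 - α) / α) • x (n i)‖ - M) := by
      have : 0 < ‖Q (n i) ^ ((1 - α) / α) • x (n i)‖ - M := by linarith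
      have hM : 0 ≤ M := (norm_nonneg _).trans h1
      gcongr
    exact (norm_sub_le_norm_sub_add_norm_sub _ _ _).trans (add_le_add h6 (h7.trans h8))
  have hfin : Tendsto (fun i => m i ^ α • blowup α v x t Q (n i) (y i) (s i)) l (𝓝 L) := by
    simpa using hdiff.add hH
  have hinv : Tendsto (fun i => (m i ^ α)⁻¹) l (𝓝 ((μ - s₀) ^ α)⁻¹) :=
    (hmlim.rpow_const (Or.inl hm0.ne')).inv₀ (Real.rpow_pos_of_pos hm0 _).ne'
  refine (hinv.smul hfin).congr' ?_
  filter_upwards [hmpos] with i hi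
  rw [smul_smul, inv_mul_cancel₀ (Real.rpow_pos_of_pos hi _).ne', one_smul]

/-- A vector field with small radial, angular and vertical parts is small. -/
theorem tendsto_zero_of_cylindrical {ι : Type*} {l : Filter ι} {x w : ι → E3} {δ : ℝ} (hδ : 0 < δ)
    (hx : ∀ i, δ < rad (x i))
    (hr : Tendsto (fun i => x i 0 * w i 0 + x i 1 * w i 1) l (𝓝 0))
    (hθ : Tendsto (fun i => x i 0 * w i 1 - x i 1 * w i 0) l (𝓝 0))
    (hz : Tendsto (fun i => w i 2) l (𝓝 0)) : Tendsto w l (𝓝 0) := by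
  rw [tendsto_zero_iff_norm_tendsto_zero]
  have h1 : Tendsto (fun i => Real.sqrt ((δ ^ 2)⁻¹ * ((x i 0 * w i 0 + x i 1 * w i 1) ^ 2
      + (x i 0 * w i 1 - x i 1 * w i 0) ^ 2) + w i 2 ^ 2)) l (𝓝 0) := by
    have := ((((hr.pow 2).add (hθ.pow 2)).const_mul (δ ^ 2)⁻¹).add (hz.pow 2)).sqrt
    simpa using this
  refine squeeze_zero (fun _ => norm_nonneg _) (fun i => ?_) h1
  rw [EuclideanSpace.norm_eq, Fin.sum_univ_three]
  simp only [Real.norm_eq_abs, sq_abs]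
  refine Real.sqrt_le_sqrt ?_
  have h2 : (x i 0 * w i 0 + x i 1 * w i 1) ^ 2 + (x i 0 * w i 1 - x i 1 * w i 0) ^ 2
      = rad (x i) ^ 2 * (w i 0 ^ 2 + w i 1 ^ 2) := by rw [rad_sq]; ring
  rw [h2]
  have h3 : δ ^ 2 ≤ rad (x i) ^ 2 := by have := hx i; gcongr
  have h4 : w i 0 ^ 2 + w i 1 ^ 2 ≤ (δ ^ 2)⁻¹ * (rad (x i) ^ 2 * (w i 0 ^ 2 + w i 1 ^ 2)) := by
    rw [← mul_assoc]
    refine le_mul_of_one_le_left (by positivity) ?_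
    rw [inv_mul_eq_div, one_le_div (by positivity)]
    exact h3
  linarith

/-- The radial projection to the side boundary. -/
noncomputable def sideProj (x : E3) : E3 := !₂[x 0 / rad x, x 1 / rad x, x 2]

theorem rad_sideProj {x : E3} (hx : 0 < rad x) : rad (sideProj x) = 1 := by
  have h : (x 0 / rad x) ^ 2 + (x 1 / rad x) ^ 2 = 1 := by
    rw [div_pow, div_pow, ← add_div, ← rad_sq, div_self (by positivity)]
  have h2 : rad (sideProj x) = Real.sqrt ((x 0 / rad x) ^ 2 + (x 1 / rad x) ^ 2) := by
    simp [rad, sideProj]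
  rw [h2, h, Real.sqrt_one]

theorem norm_sideProj_sub {x : E3} (hx : 0 < rad x) (hx1 : rad x ≤ 1) :
    ‖sideProj x - x‖ = 1 - rad x := by
  rw [EuclideanSpace.norm_eq, Fin.sum_univ_three]
  simp only [Real.norm_eq_abs, sq_abs]
  rw [← Real.sqrt_sq (show 0 ≤ 1 - rad x by linarith)]
  congr 1
  simp only [sideProj, PiLp.sub_apply]
  simp
  have h := rad_sq x
  field_simp
  linear_combination (-(1 - rad x) ^ 2) * h

/-- No asymptotically self-similar blow-up around the origin has near maximal blow-up points near
the side boundary, if the limits of the blow-up sequence are odd. -/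
theorem not_isASSS {α γ a b T₀ : ℝ} (hα : α ∈ Ioo (0 : ℝ) 1) (ha : a < 0) (hb : 0 < b)
    (hT : 0 < T₀) {v : E3 → ℝ → E3} {p : E3 → ℝ → ℝ} {V : E3 → E3} {W : E3 → ℝ → E3}
    {x : ℕ → E3} {t Q : ℕ → ℝ} (hsol : IsAxisymEulerSolution a b T₀ v p)
    (hS : IsASSS α a b T₀ v V W) (hVreg : IsC2Holder γ V)
    (hVgrad : IsHolderOn γ univ (fun y => ‖y‖ * gradNorm V y))
    (hx : IsBlowupPoints a b T₀ v x t) (hQ : IsScale v x t Q) (hm : IsNearMaximal a b v x t)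
    (hside : IsNearSide α x Q) (hodd : HasOddLimits α a b v x t Q) : False := by
  have hVd : Differentiable ℝ V := hVreg.1.differentiable (by norm_num)
  obtain ⟨B, hB, -⟩ := hVreg.2.1
  obtain ⟨C, hC, -⟩ := hVgrad
  have hC' : ∀ y, ‖y‖ * ‖fderiv ℝ V y‖ ≤ C := fun y => by
    refine le_trans ?_ ((le_abs_self _).trans (hC y (mem_univ _)))
    exact mul_le_mul_of_nonneg_left (norm_fderiv_le_gradNorm V y) (norm_nonneg _)
  obtain ⟨G, hG, hest⟩ := IsASSS.exists_estimate hsol hS hVd.continuous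
  obtain ⟨m, hm0, M, hmM⟩ := exists_rate_bounds hα ha hb (fun y => hB y (mem_univ _)) hS.1 hG hest
    hx hQ hm
  obtain ⟨hxm, htm, ⟨xlim, hxlimm, hxlim⟩, htlim, ⟨δ, hδ, hxδ⟩, hvlim⟩ := hx
  obtain ⟨hQpos, c₀, hc₀, hQc⟩ := hQ
  have hc₀' : 0 < c₀ := by linarith
  have hβ : 0 < (1 - α) / α := div_pos (by linarith [hα.2]) hα.1
  have hQlim : Tendsto Q atTop atTop :=
    tendsto_atTop_mono (fun k => (hQc k).1) (hvlim.const_mul_atTop (by positivity))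
  have hX : Tendsto (fun k => ‖Q k ^ ((1 - α) / α) • x k‖) atTop atTop := by
    have h1 : Tendsto (fun k => Q k ^ ((1 - α) / α) * δ) atTop atTop :=
      ((tendsto_rpow_atTop hβ).comp hQlim).atTop_mul_const hδ
    refine tendsto_atTop_mono (fun k => ?_) h1
    have h2 := Real.rpow_pos_of_pos (hQpos k) ((1 - α) / α)
    rw [norm_smul, Real.norm_of_nonneg h2.le]
    have := (hxδ k).le.trans (rad_le_norm _)
    gcongr
  -- a subsequence along which the blow-up solutions converge
  obtain ⟨φ₁, L, hφ₁, hL⟩ := exists_subseq_tendsto_of_lipschitz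
    (H := fun k r => V (Real.exp r • (Q k ^ ((1 - α) / α) • x k))) (B := B) (C := C)
    (fun k r => hB _ (mem_univ _)) (fun k r r' => norm_profile_exp_sub_le hVd hC' _ r r')
  obtain ⟨q, hq, φ₂, hφ₂, hqlim⟩ := isCompact_Icc.tendsto_subseq'
    (x := fun k => Q (φ₁ k) * (T₀ - t (φ₁ k)) ^ α)
    (hφ₁.tendsto_atTop.eventually hmM).frequently
  obtain ⟨φ, hφdef⟩ : ∃ φ : ℕ → ℕ, φ = φ₁ ∘ φ₂ := ⟨_, rfl⟩
  have hφ : StrictMono φ := hφdef ▸ hφ₁.comp hφ₂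
  have hqpos : 0 < q := hm0.trans_le hq.1
  have hμpos : 0 < q ^ (1 / α) := Real.rpow_pos_of_pos hqpos _
  have hμ : Tendsto (fun k => Q (φ k) ^ (1 / α) * (T₀ - t (φ k))) atTop (𝓝 (q ^ (1 / α))) := by
    refine (hqlim.rpow_const (p := 1 / α) (Or.inl hqpos.ne')).congr fun k => ?_
    have h1 : 0 ≤ T₀ - t (φ k) := by linarith [(htm (φ k)).2]
    have h2 : α * (1 / α) = 1 := mul_one_div_cancel hα.1.ne'
    simp only [Function.comp_apply, hφdef] at h1 ⊢
    rw [Real.mul_rpow (hQpos _).le (Real.rpow_nonneg h1 _), ← Real.rpow_mul h1, h2, Real.rpow_one]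
  have hLφ : ∀ r, Tendsto (fun k => V (Real.exp r • (Q (φ k) ^ ((1 - α) / α) • x (φ k)))) atTop
      (𝓝 (L r)) := fun r => by
    have := (hL r).comp hφ₂.tendsto_atTop
    rw [hφdef]; exact this
  obtain ⟨u, hu⟩ : ∃ u : ℝ → E3, ∀ s, u s = ((q ^ (1 / α) - s) ^ α)⁻¹ •
    L (-(1 - α) * Real.log (q ^ (1 / α) - s)) := ⟨_, fun _ => rfl⟩
  have key : ∀ {ι : Type} {l : Filter ι} {n : ι → ℕ}, Tendsto n l atTop → ∀ {s₀ : ℝ}, s₀ ≤ 0 →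
      ∀ {y : ι → E3} {s : ι → ℝ} {R : ℝ}, (∀ᶠ i in l, ‖y i‖ ≤ R) → (∀ᶠ i in l, s i ≤ 0) →
      Tendsto s l (𝓝 s₀) →
      (∀ᶠ i in l, unscaleX α (Q (φ (n i))) (x (φ (n i))) (y i) ∈ cylSide a b) →
      Tendsto (fun i => blowup α v x t Q (φ (n i)) (y i) (s i)) l (𝓝 (u s₀)) := by
    intro ι l n hn s₀ hs₀ y s R hy hs hslim hmem
    rw [hu]
    exact tendsto_blowup hα hT hVd hC' hG hest hQpos (fun k => (htm k).2) htlim hQlim hX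
      (n := φ ∘ n) (hφ.tendsto_atTop.comp hn) hμpos (hμ.comp hn) hs₀ ((hLφ _).comp hn) hy hs hslim
      hmem
  have hlimit : IsBlowupLimit α a b v x t Q φ (fun _ s => u s) := by
    refine ⟨hφ, ?_⟩
    rw [tendstoLocallyUniformlyOn_iff_forall_tendsto]
    rintro ⟨y₀, s₀⟩ ⟨hy₀, hs₀⟩
    have hfst : Tendsto (fun z : ℕ × E3 × ℝ => z.2) (atTop ×ˢ 𝓝[limitDomain α a b x Q φ ×ˢ Iic 0]
        (y₀, s₀)) (𝓝 (y₀, s₀)) := tendsto_snd.mono_right nhdsWithin_le_nhds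
    have hin : ∀ᶠ z : ℕ × E3 × ℝ in atTop ×ˢ 𝓝[limitDomain α a b x Q φ ×ˢ Iic 0] (y₀, s₀),
        z.2 ∈ limitDomain α a b x Q φ ×ˢ Iic 0 := tendsto_snd.eventually self_mem_nhdsWithin
    have hy1 : Tendsto (fun z : ℕ × E3 × ℝ => z.2.1) (atTop ×ˢ
        𝓝[limitDomain α a b x Q φ ×ˢ Iic 0] (y₀, s₀)) (𝓝 y₀) :=
      (continuous_fst.tendsto (y₀, s₀)).comp hfst
    have hs1 : Tendsto (fun z : ℕ × E3 × ℝ => z.2.2) (atTop ×ˢ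
        𝓝[limitDomain α a b x Q φ ×ˢ Iic 0] (y₀, s₀)) (𝓝 s₀) :=
      (continuous_snd.tendsto (y₀, s₀)).comp hfst
    obtain ⟨ε, hε, hball⟩ := hy₀
    have h1 := key (l := atTop ×ˢ 𝓝[limitDomain α a b x Q φ ×ˢ Iic 0] (y₀, s₀))
      (n := fun z : ℕ × E3 × ℝ => z.1) tendsto_fst (mem_Iic.1 hs₀) (y := fun z => z.2.1)
      (s := fun z => z.2.2) (R := ‖y₀‖ + 1)
      (hy1.norm.eventually_le_const (by linarith)) (hin.mono fun z hz => hz.2) hs1 (by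
        filter_upwards [tendsto_fst.eventually hball,
          hy1.eventually (Metric.ball_mem_nhds y₀ hε)] with z h1 h2
        exact cyl_subset_cylSide (h1 _ h2))
    -- the limit is continuous in time, as a continuous limit of the profile
    have h2 : Tendsto (fun z : ℕ × E3 × ℝ => u z.2.2) (atTop ×ˢ
        𝓝[limitDomain α a b x Q φ ×ˢ Iic 0] (y₀, s₀)) (𝓝 (u s₀)) := by
      have hpos : 0 < q ^ (1 / α) - s₀ := by linarith [mem_Iic.1 hs₀]
      have h3 : Tendsto (fun z : ℕ × E3 × ℝ => q ^ (1 / α) - z.2.2) (atTop ×ˢ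
        𝓝[limitDomain α a b x Q φ ×ˢ Iic 0] (y₀, s₀)) (𝓝 (q ^ (1 / α) - s₀)) := hs1.const_sub _
      rw [hu]
      simp only [hu]
      refine Tendsto.smul ((h3.rpow_const (Or.inl hpos.ne')).inv₀
        (Real.rpow_pos_of_pos hpos _).ne') ?_
      refine tendsto_of_lipschitz_of_tendsto (H := fun _ => L) (C := C) (fun _ r r' => ?_)
        tendsto_const_nhds ((h3.log hpos.ne').const_mul _)
      exact le_of_tendsto ((hLφ r).sub (hLφ r')).norm
        (Eventually.of_forall fun k => norm_profile_exp_sub_le hVd hC' _ r r')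
    have := (h2.prodMk_nhds h1)
    exact this.mono_right (nhds_le_uniformity _)
  -- the vertical component of the limit vanishes
  have hu2 : u 0 2 = 0 := by
    obtain ⟨y, hy⟩ := limitDomain_nonempty hα hxlimm (hδ.trans_le (ge_of_tendsto
      ((continuous_rad.tendsto _).comp hxlim) (Eventually.of_forall fun k => (hxδ k).le)))
      hxm hxlim hQpos hQlim hφ
    have := hodd φ _ hlimit y hy 0 le_rfl
    linarith
  have hcentre : ∀ k, unscaleX α (Q k) (x k) 0 = x k := fun k => by simp [unscaleX]
  have htime : ∀ k, unscaleT α (Q k) (t k) 0 = t k := fun k => by simp [unscaleT]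
  have hw : Tendsto (fun k => blowup α v x t Q (φ k) 0 0) atTop (𝓝 (u 0)) :=
    key tendsto_id le_rfl (R := 0) (by simp) (by simp) tendsto_const_nhds
      (by simp [hcentre, hxm])
  have hwdef : ∀ k, blowup α v x t Q k 0 0 = (Q k)⁻¹ • v (x k) (t k) := fun k => by
    rw [blowup, hcentre, htime]
  have happ : ∀ (i : Fin 3) {w : ℕ → E3} {w₀ : E3}, Tendsto w atTop (𝓝 w₀) →
      Tendsto (fun k => w k i) atTop (𝓝 (w₀ i)) := fun i w w₀ hw =>
    ((show Continuous fun x : E3 => x i by fun_prop).tendsto w₀).comp hw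
  have hQφ : Tendsto (fun k => (Q (φ k))⁻¹) atTop (𝓝 0) :=
    tendsto_inv_atTop_zero.comp (hQlim.comp hφ.tendsto_atTop)
  -- the angular component vanishes, because the swirl is bounded
  have hangular : Tendsto (fun k => x (φ k) 0 * blowup α v x t Q (φ k) 0 0 1
      - x (φ k) 1 * blowup α v x t Q (φ k) 0 0 0) atTop (𝓝 0) := by
    obtain ⟨S, hS⟩ := exists_swirl_bound hsol (by linarith) hT
    have h1 : Tendsto (fun k => (Q (φ k))⁻¹ * S) atTop (𝓝 0) := by simpa using hQφ.mul_const S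
    refine squeeze_zero_norm (fun k => ?_) h1
    have h2 := hS _ (cylSide_subset_closedPipe (hxm (φ k))) _ (htm (φ k))
    have h3 : x (φ k) 0 * blowup α v x t Q (φ k) 0 0 1 - x (φ k) 1 * blowup α v x t Q (φ k) 0 0 0
        = (Q (φ k))⁻¹ * swirl v (x (φ k), t (φ k)) := by
      rw [hwdef]; simp [swirl]; ring
    have h4 := inv_pos.2 (hQpos (φ k))
    rw [h3, norm_mul, Real.norm_of_nonneg h4.le]
    gcongr
    exact h2
  -- the radial component vanishes, because it does so on the side boundary
  have hradial : Tendsto (fun k => x (φ k) 0 * blowup α v x t Q (φ k) 0 0 0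
      + x (φ k) 1 * blowup α v x t Q (φ k) 0 0 1) atTop (𝓝 0) := by
    obtain ⟨R, hR⟩ := hside
    set y : ℕ → E3 := fun k => Q k ^ ((1 - α) / α) • (sideProj (x k) - x k) with hy
    have hxpos : ∀ k, 0 < rad (x k) := fun k => hδ.trans (hxδ k)
    have hyun : ∀ k, unscaleX α (Q k) (x k) (y k) = sideProj (x k) := fun k => by
      have h1 : Q k ^ (-((1 - α) / α)) * Q k ^ ((1 - α) / α) = 1 := by
        rw [← Real.rpow_add (hQpos k)]; simp
      rw [unscaleX, hy]
      simp only [smul_smul, h1, one_smul, sub_add_cancel]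
    have hyR : ∀ k, ‖y k‖ ≤ R := fun k => by
      rw [hy, norm_smul, Real.norm_of_nonneg (Real.rpow_pos_of_pos (hQpos k) _).le,
        norm_sideProj_sub (hxpos k) (hxm k).1]
      exact hR k
    have h1 : Tendsto (fun k => blowup α v x t Q (φ k) (y (φ k)) 0) atTop (𝓝 (u 0)) := by
      refine key tendsto_id le_rfl (R := R) (Eventually.of_forall fun k => hyR _) (by simp)
        tendsto_const_nhds (Eventually.of_forall fun k => ?_)
      simp only [id, hyun]
      refine ⟨(rad_sideProj (hxpos _)).le, ?_⟩
      simpa [sideProj] using (hxm (φ k)).2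
    have h2 : Tendsto (fun k => blowup α v x t Q (φ k) 0 0 - blowup α v x t Q (φ k) (y (φ k)) 0)
        atTop (𝓝 0) := by simpa using hw.sub h1
    have h3 := ((happ 0 (hxlim.comp hφ.tendsto_atTop)).mul (happ 0 h2)).add
      ((happ 1 (hxlim.comp hφ.tendsto_atTop)).mul (happ 1 h2))
    simp only [PiLp.zero_apply, mul_zero, add_zero] at h3
    refine h3.congr fun k => ?_
    have h4 : x (φ k) 0 * blowup α v x t Q (φ k) (y (φ k)) 0 0
        + x (φ k) 1 * blowup α v x t Q (φ k) (y (φ k)) 0 1 = 0 := by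
      have h5 := hsol.no_penetration _ (rad_sideProj (hxpos (φ k))) _ (htm (φ k))
      have h6 := (hxpos (φ k)).ne'
      rw [blowup, hyun, htime]
      simp only [PiLp.smul_apply, smul_eq_mul]
      have h7 : sideProj (x (φ k)) 0 = x (φ k) 0 / rad (x (φ k)) := by simp [sideProj]
      have h8 : sideProj (x (φ k)) 1 = x (φ k) 1 / rad (x (φ k)) := by simp [sideProj]
      rw [h7, h8] at h5
      field_simp at h5
      linear_combination (Q (φ k))⁻¹ * h5
    simp only [Function.comp_apply, PiLp.sub_apply]
    linear_combination -h4
  have hzero : Tendsto (fun k => blowup α v x t Q (φ k) 0 0) atTop (𝓝 0) :=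
    tendsto_zero_of_cylindrical hδ (fun k => hxδ (φ k)) hradial hangular
      (by simpa [hu2] using happ 2 hw)
  have hlow : ∀ k, c₀⁻¹ ≤ ‖blowup α v x t Q (φ k) 0 0‖ := fun k => by
    have h1 := (hQc (φ k)).2
    have h2 := hQpos (φ k)
    rw [hwdef, norm_smul, norm_inv, Real.norm_of_nonneg h2.le, inv_mul_eq_div,
      le_div_iff₀ h2, inv_mul_le_iff₀ hc₀']
    exact h1
  have := ge_of_tendsto hzero.norm (Eventually.of_forall hlow)
  rw [norm_zero] at this
  exact absurd this (not_le.2 (inv_pos.2 hc₀'))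

section WeakFormulation

open MeasureTheory

/-! ### Weak formulation of the planar equations in self-similar variables -/

/-- Planar space-time: the two coordinates of the plane, then the time. -/
abbrev Plane : Type := ℝ × ℝ × ℝ

/-- The partial derivative in the first planar coordinate. -/
noncomputable def d₁ (f : Plane → ℝ) (z : Plane) : ℝ := fderiv ℝ f z (1, 0, 0)

/-- The partial derivative in the second planar coordinate. -/
noncomputable def d₂ (f : Plane → ℝ) (z : Plane) : ℝ := fderiv ℝ f z (0, 1, 0)

/-- The partial derivative in time. -/
noncomputable def dₜ (f : Plane → ℝ) (z : Plane) : ℝ := fderiv ℝ f z (0, 0, 1)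

section Parts

variable {O : Set Plane}

theorem integrable_of_continuousOn {K : Set Plane} (hK : IsCompact K) {f : Plane → ℝ}
    (hf : ContinuousOn f K) (h0 : ∀ z ∉ K, f z = 0) : Integrable f := by
  rw [← integrableOn_iff_integrable_of_support_subset (s := K)]
  · exact hf.integrableOn_compact hK
  · intro z hz; by_contra h; exact hz (h0 z h)

theorem continuousOn_fderiv_apply (hO : IsOpen O) {f : Plane → ℝ} (hf : ContDiffOn ℝ 1 f O)
    (e : Plane) : ContinuousOn (fun z => fderiv ℝ f z e) O :=
  (hf.continuousOn_fderiv_of_isOpen hO le_rfl).clm_apply continuousOn_const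

theorem contDiff_fderiv_apply {f : Plane → ℝ} (hf : ContDiff ℝ ∞ f) (e : Plane) :
    ContDiff ℝ ∞ (fun z => fderiv ℝ f z e) :=
  (hf.fderiv_right (m := ∞) (by simp)).clm_apply contDiff_const

theorem tsupport_fderiv_apply_subset {f : Plane → ℝ} (e : Plane) :
    tsupport (fun z => fderiv ℝ f z e) ⊆ tsupport f := by
  refine closure_minimal (fun z hz => ?_) isClosed_closure
  refine support_fderiv_subset ℝ (f := f) fun h => hz ?_
  simp [h]

/-- Instance search does not find this for the volume of an iterated product. -/
theorem isAddHaarMeasure_plane : (volume : Measure Plane).IsAddHaarMeasure := by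
  have : (volume : Measure (ℝ × ℝ)).IsAddHaarMeasure := inferInstance
  exact Measure.prod.instIsAddHaarMeasure _ _

theorem integral_add_add {f g h : Plane → ℝ} (hf : Integrable f) (hg : Integrable g)
    (hh : Integrable h) : ∫ z, (f z + g z + h z) = (∫ z, f z) + (∫ z, g z) + ∫ z, h z := by
  rw [← integral_add hf hg]
  exact integral_add (hf.add hg) hh

/-- Integration by parts against a test function supported in the domain of regularity. -/
theorem integral_mul_fderiv_test (hO : IsOpen O) {f χ : Plane → ℝ} (hf : ContDiffOn ℝ 1 f O)
    (hχ : ContDiff ℝ 1 χ) (hc : HasCompactSupport χ) (hs : tsupport χ ⊆ O) (e : Plane) :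
    ∫ z, f z * fderiv ℝ χ z e = -∫ z, fderiv ℝ f z e * χ z := by
  have hχd : Continuous fun z => fderiv ℝ χ z e :=
    (hχ.continuous_fderiv one_ne_zero).clm_apply continuous_const
  have h0 : ∀ z ∉ tsupport χ, χ z = 0 := fun z hz => image_eq_zero_of_notMem_tsupport hz
  have h0' : ∀ z ∉ tsupport χ, fderiv ℝ χ z e = 0 := fun z hz => by
    rw [fderiv_of_notMem_tsupport ℝ hz]; simp
  have := isAddHaarMeasure_plane
  refine integral_bilinear_hasLineDerivAt_right_eq_neg_left_of_integrable
    (B := ContinuousLinearMap.mul ℝ ℝ) (v := e) (f' := fun z => fderiv ℝ f z e)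
    (g' := fun z => fderiv ℝ χ z e) ?_ ?_ ?_ ?_ ?_
  · exact integrable_of_continuousOn hc (((continuousOn_fderiv_apply hO hf e).mono hs).mul
      hχ.continuous.continuousOn) (fun z hz => by simp [h0 z hz])
  · exact integrable_of_continuousOn hc ((hf.continuousOn.mono hs).mul
      hχd.continuousOn) (fun z hz => by simp [h0' z hz])
  · exact integrable_of_continuousOn hc ((hf.continuousOn.mono hs).mul
      hχ.continuous.continuousOn) (fun z hz => by simp [h0 z hz])
  · intro z hz
    exact ((hf.contDiffAt (hO.mem_nhds (hs hz))).differentiableAt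
      one_ne_zero).hasFDerivAt.hasLineDerivAt e
  · intro z _
    exact (hχ.differentiable one_ne_zero z).hasFDerivAt.hasLineDerivAt e

/-- The derivative along the space-time field `(F₁, F₂, 1)`. -/
noncomputable def dMat (F₁ F₂ f : Plane → ℝ) (z : Plane) : ℝ :=
  dₜ f z + F₁ z * d₁ f z + F₂ z * d₂ f z

theorem fderiv_mul_test {F χ : Plane → ℝ} {z : Plane} (hF : DifferentiableAt ℝ F z)
    (hχ : DifferentiableAt ℝ χ z) (e : Plane) :
    fderiv ℝ (fun z => F z * χ z) z e = F z * fderiv ℝ χ z e + fderiv ℝ F z e * χ z := by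
  have : HasFDerivAt (fun z => F z * χ z) _ z := hF.hasFDerivAt.mul hχ.hasFDerivAt
  rw [this.fderiv]
  simp; ring

/-- Integration by parts with a coefficient which is differentiable near the support of the test
function only. -/
theorem integral_mul_mul_fderiv_test (hO : IsOpen O) {f F χ : Plane → ℝ}
    (hf : ContDiffOn ℝ 1 f O) (hF : ContDiffOn ℝ 1 F O)
    (hχ : ContDiff ℝ ∞ χ) (hc : HasCompactSupport χ) (hs : tsupport χ ⊆ O) (e : Plane) :
    ∫ z, F z * fderiv ℝ f z e * χ z
      = -∫ z, f z * (F z * fderiv ℝ χ z e + fderiv ℝ F z e * χ z) := by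
  -- the product of the coefficient and the test function, which vanishes outside the support
  have hF' : ContDiff ℝ 1 (fun z => F z * χ z) := by
    rw [contDiff_iff_contDiffAt]
    intro z
    by_cases hz : z ∈ tsupport χ
    · exact (hF.contDiffAt (hO.mem_nhds (hs hz))).mul (hχ.contDiffAt.of_le (by simp))
    · refine (contDiffAt_const (c := (0 : ℝ))).congr_of_eventuallyEq ?_
      filter_upwards [(isClosed_tsupport χ).isOpen_compl.mem_nhds hz] with w hw
      simp [image_eq_zero_of_notMem_tsupport hw]
  have hsub : tsupport (fun z => F z * χ z) ⊆ tsupport χ := tsupport_mul_subset_right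
  have h := integral_mul_fderiv_test hO hf hF' hc.mul_left (hsub.trans hs) e
  have h1 : ∀ z, fderiv ℝ f z e * (F z * χ z) = F z * fderiv ℝ f z e * χ z := fun z => by ring
  simp only [h1] at h
  rw [← neg_eq_iff_eq_neg, ← h]
  refine integral_congr_ae (Eventually.of_forall fun z => ?_)
  by_cases hz : z ∈ tsupport χ
  · simp only
    rw [fderiv_mul_test ((hF.contDiffAt (hO.mem_nhds (hs hz))).differentiableAt one_ne_zero)
      (hχ.differentiable (by simp) z)]
  · simp only
    rw [fderiv_of_notMem_tsupport ℝ (fun h => hz (hsub h)), fderiv_of_notMem_tsupport ℝ hz,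
      image_eq_zero_of_notMem_tsupport hz]
    simp

theorem integrable_mul_test {g χ : Plane → ℝ} (hc : HasCompactSupport χ) (hs : tsupport χ ⊆ O)
    (hg : ContinuousOn g O) (hχ : Continuous χ) : Integrable fun z => g z * χ z :=
  integrable_of_continuousOn hc ((hg.mono hs).mul hχ.continuousOn)
    (fun z hz => by simp [image_eq_zero_of_notMem_tsupport hz])

/-- The adjoint of the derivative along a field. -/
theorem integral_dMat_mul_test (hO : IsOpen O) {f F₁ F₂ χ : Plane → ℝ}
    (hf : ContDiffOn ℝ 1 f O) (hF₁ : ContDiffOn ℝ 1 F₁ O) (hF₂ : ContDiffOn ℝ 1 F₂ O)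
    (hχ : ContDiff ℝ ∞ χ) (hc : HasCompactSupport χ) (hs : tsupport χ ⊆ O) :
    ∫ z, dMat F₁ F₂ f z * χ z
      = -∫ z, f z * (dMat F₁ F₂ χ z + (d₁ F₁ z + d₂ F₂ z) * χ z) := by
  have hfc := hf.continuousOn
  have hd : ∀ (e : Plane), Continuous fun z => fderiv ℝ χ z e := fun e =>
    (contDiff_fderiv_apply hχ e).continuous
  have hI : ∀ {g : Plane → ℝ}, ContinuousOn g O → Integrable fun z => g z * χ z := fun hg =>
    integrable_mul_test hc hs hg hχ.continuous
  have hI' : ∀ {g : Plane → ℝ} (e : Plane), ContinuousOn g O →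
      Integrable fun z => g z * fderiv ℝ χ z e := fun e hg =>
    integrable_mul_test (hc.mono' (subset_closure.trans (tsupport_fderiv_apply_subset e)))
      ((tsupport_fderiv_apply_subset e).trans hs) hg (hd e)
  have ht := integral_mul_fderiv_test hO hf (hχ.of_le (by simp)) hc hs (0, 0, 1)
  have h1 := integral_mul_mul_fderiv_test hO hf hF₁ hχ hc hs (1, 0, 0)
  have h2 := integral_mul_mul_fderiv_test hO hf hF₂ hχ hc hs (0, 1, 0)
  have ct := continuousOn_fderiv_apply hO hf (0, 0, 1)
  have c1 := hF₁.continuousOn.mul (continuousOn_fderiv_apply hO hf (1, 0, 0))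
  have c2 := hF₂.continuousOn.mul (continuousOn_fderiv_apply hO hf (0, 1, 0))
  have b1 := hfc.mul hF₁.continuousOn
  have b2 := hfc.mul hF₂.continuousOn
  have b1' := hfc.mul (continuousOn_fderiv_apply hO hF₁ (1, 0, 0))
  have b2' := hfc.mul (continuousOn_fderiv_apply hO hF₂ (0, 1, 0))
  have e1 : ∫ z, dMat F₁ F₂ f z * χ z = (∫ z, fderiv ℝ f z (0, 0, 1) * χ z)
      + (∫ z, F₁ z * fderiv ℝ f z (1, 0, 0) * χ z) + ∫ z, F₂ z * fderiv ℝ f z (0, 1, 0) * χ z := by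
    refine Eq.trans (integral_congr_ae (Eventually.of_forall fun z => ?_))
      (integral_add_add (hI ct) (hI c1) (hI c2))
    simp only [dMat, d₁, d₂, dₜ]
    ring
  have e2 : ∫ z, f z * (dMat F₁ F₂ χ z + (d₁ F₁ z + d₂ F₂ z) * χ z)
      = (∫ z, f z * fderiv ℝ χ z (0, 0, 1))
      + (∫ z, f z * (F₁ z * fderiv ℝ χ z (1, 0, 0) + fderiv ℝ F₁ z (1, 0, 0) * χ z))
      + ∫ z, f z * (F₂ z * fderiv ℝ χ z (0, 1, 0) + fderiv ℝ F₂ z (0, 1, 0) * χ z) := by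
    have i1 : Integrable fun z =>
        f z * (F₁ z * fderiv ℝ χ z (1, 0, 0) + fderiv ℝ F₁ z (1, 0, 0) * χ z) := by
      refine ((hI' (1, 0, 0) b1).add (hI b1')).congr (Eventually.of_forall fun z => ?_)
      simp only [Pi.add_apply, Pi.mul_apply]; ring
    have i2 : Integrable fun z =>
        f z * (F₂ z * fderiv ℝ χ z (0, 1, 0) + fderiv ℝ F₂ z (0, 1, 0) * χ z) := by
      refine ((hI' (0, 1, 0) b2).add (hI b2')).congr (Eventually.of_forall fun z => ?_)
      simp only [Pi.add_apply, Pi.mul_apply]; ring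
    refine Eq.trans (integral_congr_ae (Eventually.of_forall fun z => ?_))
      (integral_add_add (hI' (0, 0, 1) hfc) i1 i2)
    simp only [dMat, d₁, d₂, dₜ]
    ring
  rw [e1, e2]
  linarith

theorem fderiv_fderiv_apply {f : Plane → ℝ} {z : Plane} (hf : ContDiffAt ℝ 2 f z)
    (e e' : Plane) :
    fderiv ℝ (fun z => fderiv ℝ f z e) z e' = fderiv ℝ (fderiv ℝ f) z e' e := by
  have h : DifferentiableAt ℝ (fderiv ℝ f) z :=
    (hf.fderiv_right (m := 1) (by norm_num)).differentiableAt one_ne_zero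
  have : HasFDerivAt (fun z => fderiv ℝ f z e) _ z :=
    h.hasFDerivAt.clm_apply (hasFDerivAt_const e z)
  rw [this.fderiv]; simp

theorem fderiv_apply_comm {f : Plane → ℝ} {z : Plane} (hf : ContDiffAt ℝ 2 f z)
    (e e' : Plane) :
    fderiv ℝ (fun z => fderiv ℝ f z e) z e' = fderiv ℝ (fun z => fderiv ℝ f z e') z e := by
  rw [fderiv_fderiv_apply hf, fderiv_fderiv_apply hf]
  exact hf.isSymmSndFDerivAt (by simp) e' e

/-- A gradient is orthogonal to every rotated gradient of a test function. This removes the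
pressure, on which no convergence is known. -/
theorem integral_gradient_test (hO : IsOpen O) {P ψ : Plane → ℝ} (hP : ContDiffOn ℝ 1 P O)
    (hψ : ContDiff ℝ ∞ ψ) (hc : HasCompactSupport ψ) (hs : tsupport ψ ⊆ O) :
    ∫ z, d₁ P z * d₂ ψ z = ∫ z, d₂ P z * d₁ ψ z := by
  have hc' : ∀ e : Plane, HasCompactSupport fun z => fderiv ℝ ψ z e := fun e =>
    hc.mono' (subset_closure.trans (tsupport_fderiv_apply_subset e))
  have h1 := integral_mul_fderiv_test hO hP ((contDiff_fderiv_apply hψ (0, 1, 0)).of_le (by simp))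
    (hc' _) ((tsupport_fderiv_apply_subset _).trans hs) (1, 0, 0)
  have h2 := integral_mul_fderiv_test hO hP ((contDiff_fderiv_apply hψ (1, 0, 0)).of_le (by simp))
    (hc' _) ((tsupport_fderiv_apply_subset _).trans hs) (0, 1, 0)
  have h3 : ∀ z, fderiv ℝ (fun z => fderiv ℝ ψ z (0, 1, 0)) z (1, 0, 0)
      = fderiv ℝ (fun z => fderiv ℝ ψ z (1, 0, 0)) z (0, 1, 0) := fun z =>
    fderiv_apply_comm (hψ.contDiffAt.of_le (by norm_cast)) _ _
  simp only [h3] at h1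
  exact neg_injective (h1.symm.trans h2)

end Parts

section Weak

variable {O : Set Plane}

/-- The first component of the transport field of the self-similar equations. -/
noncomputable def selfField₁ (α : ℝ) (u : Plane → ℝ) (z : Plane) : ℝ := (1 - α) * z.1 + u z

/-- The second component of the transport field of the self-similar equations. -/
noncomputable def selfField₂ (α : ℝ) (w : Plane → ℝ) (z : Plane) : ℝ := (1 - α) * z.2.1 + w z

/-- The integrand of the weak form of the vorticity equation in self-similar variables. It does not
contain derivatives of the velocity `(u, w)`. The coefficient `κ` is the curvature term in the
divergence, and `f` is the centrifugal force. -/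
noncomputable def weakVort (α : ℝ) (u w κ f ψ : Plane → ℝ) (z : Plane) : ℝ :=
  u z * dMat (selfField₁ α u) (selfField₂ α w) (d₂ ψ) z
    - w z * dMat (selfField₁ α u) (selfField₂ α w) (d₁ ψ) z
    + (2 - 3 * α - κ z * u z) * (u z * d₂ ψ z - w z * d₁ ψ z) + f z * d₂ ψ z

theorem contDiffOn_selfField₁ {α : ℝ} {u : Plane → ℝ} {n : WithTop ℕ∞} (hu : ContDiffOn ℝ n u O) :
    ContDiffOn ℝ n (selfField₁ α u) O :=
  (contDiff_const.mul contDiff_fst).contDiffOn.add hu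

theorem contDiffOn_selfField₂ {α : ℝ} {w : Plane → ℝ} {n : WithTop ℕ∞} (hw : ContDiffOn ℝ n w O) :
    ContDiffOn ℝ n (selfField₂ α w) O :=
  (contDiff_const.mul (contDiff_fst.comp contDiff_snd)).contDiffOn.add hw

theorem d₁_selfField₁ {α : ℝ} {u : Plane → ℝ} {z : Plane} (hu : DifferentiableAt ℝ u z) :
    d₁ (selfField₁ α u) z = 1 - α + d₁ u z := by
  have : HasFDerivAt (selfField₁ α u) _ z :=
    (hasFDerivAt_fst.const_mul (1 - α)).add hu.hasFDerivAt
  rw [d₁, this.fderiv]; simp [d₁]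

theorem d₂_selfField₁ {α : ℝ} {u : Plane → ℝ} {z : Plane} (hu : DifferentiableAt ℝ u z) :
    d₂ (selfField₁ α u) z = d₂ u z := by
  have : HasFDerivAt (selfField₁ α u) _ z :=
    (hasFDerivAt_fst.const_mul (1 - α)).add hu.hasFDerivAt
  rw [d₂, this.fderiv]; simp [d₂]

theorem d₁_selfField₂ {α : ℝ} {w : Plane → ℝ} {z : Plane} (hw : DifferentiableAt ℝ w z) :
    d₁ (selfField₂ α w) z = d₁ w z := by
  have : HasFDerivAt (selfField₂ α w) _ z :=
    ((hasFDerivAt_fst.comp z hasFDerivAt_snd).const_mul (1 - α)).add hw.hasFDerivAt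
  rw [d₁, this.fderiv]; simp [d₁]

theorem d₂_selfField₂ {α : ℝ} {w : Plane → ℝ} {z : Plane} (hw : DifferentiableAt ℝ w z) :
    d₂ (selfField₂ α w) z = 1 - α + d₂ w z := by
  have : HasFDerivAt (selfField₂ α w) _ z :=
    ((hasFDerivAt_fst.comp z hasFDerivAt_snd).const_mul (1 - α)).add hw.hasFDerivAt
  rw [d₂, this.fderiv]; simp [d₂]

theorem continuousOn_dMat {F₁ F₂ f : Plane → ℝ} (hO : IsOpen O) (hF₁ : ContinuousOn F₁ O)
    (hF₂ : ContinuousOn F₂ O) (hf : ContDiffOn ℝ 1 f O) : ContinuousOn (dMat F₁ F₂ f) O :=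
  ((continuousOn_fderiv_apply hO hf _).add (hF₁.mul (continuousOn_fderiv_apply hO hf _))).add
    (hF₂.mul (continuousOn_fderiv_apply hO hf _))

theorem fderiv_eq_zero_off_tsupport {ψ : Plane → ℝ} {z : Plane} (hz : z ∉ tsupport ψ)
    (e : Plane) : fderiv ℝ ψ z e = 0 := by
  rw [fderiv_of_notMem_tsupport ℝ hz]; simp

theorem dMat_fderiv_eq_zero_off_tsupport {F₁ F₂ ψ : Plane → ℝ} {z : Plane} (hz : z ∉ tsupport ψ)
    (e : Plane) : dMat F₁ F₂ (fun z => fderiv ℝ ψ z e) z = 0 := by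
  have h : z ∉ tsupport (fun z => fderiv ℝ ψ z e) :=
    fun h => hz (tsupport_fderiv_apply_subset e h)
  simp only [dMat, d₁, d₂, dₜ, fderiv_eq_zero_off_tsupport h]
  simp

theorem weakVort_eq_zero_off_tsupport {α : ℝ} {u w κ f ψ : Plane → ℝ} {z : Plane}
    (hz : z ∉ tsupport ψ) : weakVort α u w κ f ψ z = 0 := by
  have h1 : d₁ ψ z = 0 := fderiv_eq_zero_off_tsupport hz _
  have h2 : d₂ ψ z = 0 := fderiv_eq_zero_off_tsupport hz _
  have h3 : dMat (selfField₁ α u) (selfField₂ α w) (d₁ ψ) z = 0 :=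
    dMat_fderiv_eq_zero_off_tsupport hz _
  have h4 : dMat (selfField₁ α u) (selfField₂ α w) (d₂ ψ) z = 0 :=
    dMat_fderiv_eq_zero_off_tsupport hz _
  simp [weakVort, h1, h2, h3, h4]

/-- The weak form of the vorticity equation comes from the equations for the two components of the
velocity, by testing with the rotated gradient of a function. -/
theorem integral_weakVort (hO : IsOpen O) {α : ℝ} {u w κ f ψ : Plane → ℝ}
    (hu : ContDiffOn ℝ 1 u O) (hw : ContDiffOn ℝ 1 w O)
    (hf : ContinuousOn f O) (hdiv : ∀ z ∈ O, d₁ u z + d₂ w z = -(κ z * u z))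
    (hψ : ContDiff ℝ ∞ ψ) (hc : HasCompactSupport ψ) (hs : tsupport ψ ⊆ O) :
    ∫ z, weakVort α u w κ f ψ z
      = (∫ z, (f z - (dMat (selfField₁ α u) (selfField₂ α w) u z + α * u z)) * d₂ ψ z)
        + ∫ z, (dMat (selfField₁ α u) (selfField₂ α w) w z + α * w z) * d₁ ψ z := by
  set F₁ := selfField₁ α u with hF₁
  set F₂ := selfField₂ α w with hF₂
  have hF₁c : ContDiffOn ℝ 1 F₁ O := contDiffOn_selfField₁ hu
  have hF₂c : ContDiffOn ℝ 1 F₂ O := contDiffOn_selfField₂ hw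
  have hψ₁ : ContDiff ℝ ∞ (d₁ ψ) := contDiff_fderiv_apply hψ _
  have hψ₂ : ContDiff ℝ ∞ (d₂ ψ) := contDiff_fderiv_apply hψ _
  have hc₁ : HasCompactSupport (d₁ ψ) :=
    hc.mono' (subset_closure.trans (tsupport_fderiv_apply_subset _))
  have hc₂ : HasCompactSupport (d₂ ψ) :=
    hc.mono' (subset_closure.trans (tsupport_fderiv_apply_subset _))
  have hs₁ : tsupport (d₁ ψ) ⊆ O := (tsupport_fderiv_apply_subset _).trans hs
  have hs₂ : tsupport (d₂ ψ) ⊆ O := (tsupport_fderiv_apply_subset _).trans hs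
  have e1 := integral_dMat_mul_test hO hu hF₁c hF₂c hψ₂ hc₂ hs₂
  have e2 := integral_dMat_mul_test hO hw hF₁c hF₂c hψ₁ hc₁ hs₁
  have cD : ContinuousOn (fun z => d₁ F₁ z + d₂ F₂ z) O :=
    (continuousOn_fderiv_apply hO hF₁c _).add (continuousOn_fderiv_apply hO hF₂c _)
  have cM : ∀ {g : Plane → ℝ}, ContDiffOn ℝ 1 g O → ContinuousOn (dMat F₁ F₂ g) O := fun hg =>
    continuousOn_dMat hO hF₁c.continuousOn hF₂c.continuousOn hg
  have cM₁ := cM (hψ₁.of_le (by simp)).contDiffOn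
  have cM₂ := cM (hψ₂.of_le (by simp)).contDiffOn
  have z₁ : ∀ z ∉ tsupport ψ, d₁ ψ z = 0 := fun z hz => fderiv_eq_zero_off_tsupport hz _
  have z₂ : ∀ z ∉ tsupport ψ, d₂ ψ z = 0 := fun z hz => fderiv_eq_zero_off_tsupport hz _
  have y₁ : ∀ z ∉ tsupport ψ, dMat F₁ F₂ (d₁ ψ) z = 0 := fun z hz =>
    dMat_fderiv_eq_zero_off_tsupport hz _
  have y₂ : ∀ z ∉ tsupport ψ, dMat F₁ F₂ (d₂ ψ) z = 0 := fun z hz =>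
    dMat_fderiv_eq_zero_off_tsupport hz _
  have i1 : Integrable fun z => u z * (dMat F₁ F₂ (d₂ ψ) z + (d₁ F₁ z + d₂ F₂ z) * d₂ ψ z) :=
    integrable_of_continuousOn hc ((hu.continuousOn.mul (cM₂.add
      (cD.mul hψ₂.continuous.continuousOn))).mono hs) fun z hz => by simp [z₂ z hz, y₂ z hz]
  have i2 : Integrable fun z => w z * (dMat F₁ F₂ (d₁ ψ) z + (d₁ F₁ z + d₂ F₂ z) * d₁ ψ z) :=
    integrable_of_continuousOn hc ((hw.continuousOn.mul (cM₁.add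
      (cD.mul hψ₁.continuous.continuousOn))).mono hs) fun z hz => by simp [z₁ z hz, y₁ z hz]
  have i3 : Integrable fun z => dMat F₁ F₂ u z * d₂ ψ z :=
    integrable_mul_test hc₂ hs₂ (cM hu) hψ₂.continuous
  have i4 : Integrable fun z => dMat F₁ F₂ w z * d₁ ψ z :=
    integrable_mul_test hc₁ hs₁ (cM hw) hψ₁.continuous
  have i5 : Integrable fun z => (f z - α * u z) * d₂ ψ z :=
    integrable_mul_test hc₂ hs₂ (hf.sub (continuousOn_const.mul hu.continuousOn)) hψ₂.continuous
  have i6 : Integrable fun z => α * w z * d₁ ψ z :=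
    integrable_mul_test hc₁ hs₁ (continuousOn_const.mul hw.continuousOn) hψ₁.continuous
  have k1 : ∫ z, (f z - (dMat F₁ F₂ u z + α * u z)) * d₂ ψ z
      = (∫ z, (f z - α * u z) * d₂ ψ z) - ∫ z, dMat F₁ F₂ u z * d₂ ψ z := by
    rw [← integral_sub i5 i3]
    exact integral_congr_ae (Eventually.of_forall fun z => by simp only; ring)
  have k2 : ∫ z, (dMat F₁ F₂ w z + α * w z) * d₁ ψ z
      = (∫ z, α * w z * d₁ ψ z) + ∫ z, dMat F₁ F₂ w z * d₁ ψ z := by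
    rw [← integral_add i6 i4]
    exact integral_congr_ae (Eventually.of_forall fun z => by simp only; ring)
  have k3 : ∫ z, weakVort α u w κ f ψ z
      = (∫ z, u z * (dMat F₁ F₂ (d₂ ψ) z + (d₁ F₁ z + d₂ F₂ z) * d₂ ψ z))
        - (∫ z, w z * (dMat F₁ F₂ (d₁ ψ) z + (d₁ F₁ z + d₂ F₂ z) * d₁ ψ z))
        + ((∫ z, (f z - α * u z) * d₂ ψ z) + ∫ z, α * w z * d₁ ψ z) := by
    rw [← integral_sub i1 i2, ← integral_add i5 i6]
    refine Eq.trans (integral_congr_ae (Eventually.of_forall fun z => ?_))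
      (integral_add (i1.sub i2) (i5.add i6))
    by_cases hz : z ∈ tsupport ψ
    · have hz' := hs hz
      have hud := (hu.contDiffAt (hO.mem_nhds hz')).differentiableAt one_ne_zero
      have hwd := (hw.contDiffAt (hO.mem_nhds hz')).differentiableAt one_ne_zero
      have h1 : d₁ F₁ z + d₂ F₂ z = 2 * (1 - α) - κ z * u z := by
        rw [hF₁, hF₂, d₁_selfField₁ hud, d₂_selfField₂ hwd]
        linear_combination hdiv z hz'
      simp only [weakVort, h1, ← hF₁, ← hF₂]
      ring
    · simp only [weakVort_eq_zero_off_tsupport hz, z₁ z hz, z₂ z hz, y₁ z hz, y₂ z hz]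
      simp
  rw [k3, k1, k2, e1, e2]
  ring

/-- Solutions of the self-similar equations satisfy the weak form of the vorticity equation. -/
theorem integral_weakVort_eq_zero (hO : IsOpen O) {α : ℝ} {u w P κ f ψ : Plane → ℝ}
    (hu : ContDiffOn ℝ 1 u O) (hw : ContDiffOn ℝ 1 w O) (hP : ContDiffOn ℝ 1 P O)
    (hf : ContinuousOn f O)
    (hdiv : ∀ z ∈ O, d₁ u z + d₂ w z = -(κ z * u z))
    (h₁ : ∀ z ∈ O, dMat (selfField₁ α u) (selfField₂ α w) u z + α * u z + d₁ P z = f z)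
    (h₂ : ∀ z ∈ O, dMat (selfField₁ α u) (selfField₂ α w) w z + α * w z + d₂ P z = 0)
    (hψ : ContDiff ℝ ∞ ψ) (hc : HasCompactSupport ψ) (hs : tsupport ψ ⊆ O) :
    ∫ z, weakVort α u w κ f ψ z = 0 := by
  have h3 := integral_gradient_test hO hP hψ hc hs
  have e1 : ∫ z, (f z - (dMat (selfField₁ α u) (selfField₂ α w) u z + α * u z)) * d₂ ψ z
      = ∫ z, d₁ P z * d₂ ψ z := by
    refine integral_congr_ae (Eventually.of_forall fun z => ?_)
    by_cases hz : z ∈ tsupport ψ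
    · simp only [← h₁ z (hs hz)]; ring
    · simp [d₂, fderiv_eq_zero_off_tsupport hz]
  have e2 : ∫ z, (dMat (selfField₁ α u) (selfField₂ α w) w z + α * w z) * d₁ ψ z
      = -∫ z, d₂ P z * d₁ ψ z := by
    rw [← integral_neg]
    refine integral_congr_ae (Eventually.of_forall fun z => ?_)
    by_cases hz : z ∈ tsupport ψ
    · simp only [eq_neg_of_add_eq_zero_left (h₂ z (hs hz))]; ring
    · simp [d₁, fderiv_eq_zero_off_tsupport hz]
  rw [integral_weakVort hO hu hw hf hdiv hψ hc hs, e1, e2, h3, add_neg_cancel]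

/-- The weak form of the divergence equation. -/
theorem integral_weakDiv_eq_zero (hO : IsOpen O) {u w κ ψ : Plane → ℝ}
    (hu : ContDiffOn ℝ 1 u O) (hw : ContDiffOn ℝ 1 w O)
    (hκ : ContinuousOn κ O) (hdiv : ∀ z ∈ O, d₁ u z + d₂ w z = -(κ z * u z))
    (hψ : ContDiff ℝ ∞ ψ) (hc : HasCompactSupport ψ) (hs : tsupport ψ ⊆ O) :
    ∫ z, (u z * d₁ ψ z + w z * d₂ ψ z - κ z * u z * ψ z) = 0 := by
  have e1 := integral_mul_fderiv_test hO hu (hψ.of_le (by simp)) hc hs (1, 0, 0)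
  have e2 := integral_mul_fderiv_test hO hw (hψ.of_le (by simp)) hc hs (0, 1, 0)
  have hI : ∀ {g : Plane → ℝ}, ContinuousOn g O → Integrable fun z => g z * ψ z := fun hg =>
    integrable_mul_test hc hs hg hψ.continuous
  have hI' : ∀ {g : Plane → ℝ} (e : Plane), ContinuousOn g O →
      Integrable fun z => g z * fderiv ℝ ψ z e := fun e hg =>
    integrable_mul_test (hc.mono' (subset_closure.trans (tsupport_fderiv_apply_subset e)))
      ((tsupport_fderiv_apply_subset e).trans hs) hg (contDiff_fderiv_apply hψ e).continuous
  have i3 : Integrable fun z => -(κ z * u z) * ψ z := hI (hκ.mul hu.continuousOn).neg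
  have e3 : ∫ z, -(κ z * u z) * ψ z
      = (∫ z, fderiv ℝ u z (1, 0, 0) * ψ z) + ∫ z, fderiv ℝ w z (0, 1, 0) * ψ z := by
    rw [← integral_add (hI (continuousOn_fderiv_apply hO hu _))
      (hI (continuousOn_fderiv_apply hO hw _))]
    refine integral_congr_ae (Eventually.of_forall fun z => ?_)
    by_cases hz : z ∈ tsupport ψ
    · simp only [← hdiv z (hs hz), d₁, d₂]; ring
    · simp [image_eq_zero_of_notMem_tsupport hz]
  have e4 : ∫ z, (u z * d₁ ψ z + w z * d₂ ψ z - κ z * u z * ψ z)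
      = (∫ z, u z * fderiv ℝ ψ z (1, 0, 0)) + (∫ z, w z * fderiv ℝ ψ z (0, 1, 0))
        + ∫ z, -(κ z * u z) * ψ z := by
    rw [← integral_add_add (hI' (1, 0, 0) hu.continuousOn) (hI' (0, 1, 0) hw.continuousOn) i3]
    refine integral_congr_ae (Eventually.of_forall fun z => ?_)
    simp only [d₁, d₂]; ring
  rw [e4, e1, e2, e3]; ring

/-- A continuous function which is orthogonal to all test functions vanishes. -/
theorem eq_zero_of_integral_test (hO : IsOpen O) {h : Plane → ℝ} (hh : ContinuousOn h O)
    (hint : ∀ ψ : Plane → ℝ, ContDiff ℝ ∞ ψ → HasCompactSupport ψ → tsupport ψ ⊆ O →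
      ∫ z, ψ z * h z = 0) {z : Plane} (hz : z ∈ O) : h z = 0 := by
  have := isAddHaarMeasure_plane
  have h1 := hO.ae_eq_zero_of_integral_contDiff_smul_eq_zero
    (hh.locallyIntegrableOn hO.measurableSet (μ := (volume : Measure Plane)))
    (fun ψ h1 h2 h3 => hint ψ h1 h2 h3)
  have h2 : h =ᵐ[volume.restrict O] fun _ => 0 := by
    rw [Filter.EventuallyEq, ae_restrict_iff' hO.measurableSet]
    exact h1
  exact Measure.eqOn_open_of_ae_eq h2 hO hh continuousOn_const hz

/-- Continuous convergence on a compact set implies convergence of the integrals. -/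
theorem tendsto_integral_of_continuous_convergence {K : Set Plane} (hK : IsCompact K)
    {J : ℕ → Plane → ℝ} {J' : Plane → ℝ} (hJ0 : ∀ n, ∀ z ∉ K, J n z = 0)
    (hJ0' : ∀ z ∉ K, J' z = 0) (hJc : ∀ᶠ n in atTop, ContinuousOn (J n) K)
    (hJc' : ContinuousOn J' K)
    (hlim : ∀ z ∈ K, Tendsto (fun q : ℕ × Plane => J q.1 q.2) (atTop ×ˢ 𝓝[K] z) (𝓝 (J' z))) :
    Tendsto (fun n => ∫ z, J n z) atTop (𝓝 (∫ z, J' z)) := by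
  have hunif : TendstoUniformlyOn J J' atTop K := by
    rw [← tendstoLocallyUniformlyOn_iff_tendstoUniformlyOn_of_compact hK,
      tendstoLocallyUniformlyOn_iff_forall_tendsto]
    intro z hz
    have h1 : Tendsto (fun q : ℕ × Plane => J' q.2) (atTop ×ˢ 𝓝[K] z) (𝓝 (J' z)) :=
      (hJc' z hz).tendsto.comp tendsto_snd
    exact (h1.prodMk_nhds (hlim z hz)).mono_right (nhds_le_uniformity _)
  have hb : ∀ᶠ n in atTop, ∀ z ∈ K, dist (J' z) (J n z) < 1 :=
    Metric.tendstoUniformlyOn_iff.1 hunif 1 one_pos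
  refine tendsto_integral_filter_of_dominated_convergence
    (fun z => K.indicator (fun z => ‖J' z‖ + 1) z) ?_ ?_ ?_ ?_
  · exact hJc.mono fun n hn => (integrable_of_continuousOn hK hn (hJ0 n)).aestronglyMeasurable
  · filter_upwards [hb] with n hn
    refine Eventually.of_forall fun z => ?_
    by_cases hz : z ∈ K
    · rw [indicator_of_mem hz]
      have h1 := hn z hz
      rw [dist_comm, dist_eq_norm] at h1
      have h2 := norm_sub_norm_le (J n z) (J' z)
      linarith
    · rw [indicator_of_notMem hz, hJ0 n z hz, norm_zero]
  · refine integrable_of_continuousOn hK ?_ fun z hz => indicator_of_notMem hz _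
    exact (hJc'.norm.add continuousOn_const).congr fun z hz => indicator_of_mem hz _
  · refine Eventually.of_forall fun z => ?_
    by_cases hz : z ∈ K
    · exact hunif.tendsto_at hz
    · simp only [hJ0 _ z hz, hJ0' z hz]; exact tendsto_const_nhds

theorem continuousOn_weakVort {α : ℝ} {u w κ f ψ : Plane → ℝ} (hO : IsOpen O)
    (hu : ContinuousOn u O) (hw : ContinuousOn w O) (hκ : ContinuousOn κ O)
    (hf : ContinuousOn f O) (hψ : ContDiff ℝ ∞ ψ) : ContinuousOn (weakVort α u w κ f ψ) O := by
  have hψ₁ : ContDiff ℝ ∞ (d₁ ψ) := contDiff_fderiv_apply hψ _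
  have hψ₂ : ContDiff ℝ ∞ (d₂ ψ) := contDiff_fderiv_apply hψ _
  have hF₁ : ContinuousOn (selfField₁ α u) O :=
    (show Continuous fun z : Plane => (1 - α) * z.1 by fun_prop).continuousOn.add hu
  have hF₂ : ContinuousOn (selfField₂ α w) O :=
    (show Continuous fun z : Plane => (1 - α) * z.2.1 by fun_prop).continuousOn.add hw
  have m₁ := continuousOn_dMat hO hF₁ hF₂ (hψ₁.of_le (m := 1) (by simp)).contDiffOn
  have m₂ := continuousOn_dMat hO hF₁ hF₂ (hψ₂.of_le (m := 1) (by simp)).contDiffOn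
  have c₁ := hψ₁.continuous.continuousOn (s := O)
  have c₂ := hψ₂.continuous.continuousOn (s := O)
  exact (((hu.mul m₂).sub (hw.mul m₁)).add ((continuousOn_const.sub (hκ.mul hu)).mul
    ((hu.mul c₂).sub (hw.mul c₁)))).add (hf.mul c₂)

/-- The limit of solutions of the self-similar equations, for continuous convergence of the
velocities only. The forces `f n` and the curvatures `κ n` tend to zero. -/
theorem limit_equations {Ω : Set Plane} (hΩ : IsOpen Ω) {α : ℝ} {u w P κ f : ℕ → Plane → ℝ}
    {O : ℕ → Set Plane} (hO : ∀ n, IsOpen (O n))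
    (hΩO : ∀ K ⊆ Ω, IsCompact K → ∀ᶠ n in atTop, K ⊆ O n)
    (hu : ∀ n, ContDiffOn ℝ 1 (u n) (O n)) (hw : ∀ n, ContDiffOn ℝ 1 (w n) (O n))
    (hP : ∀ n, ContDiffOn ℝ 1 (P n) (O n)) (hκ : ∀ n, ContinuousOn (κ n) (O n))
    (hf : ∀ n, ContinuousOn (f n) (O n))
    (hdiv : ∀ n, ∀ z ∈ O n, d₁ (u n) z + d₂ (w n) z = -(κ n z * u n z))
    (h₁ : ∀ n, ∀ z ∈ O n, dMat (selfField₁ α (u n)) (selfField₂ α (w n)) (u n) z + α * u n z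
      + d₁ (P n) z = f n z)
    (h₂ : ∀ n, ∀ z ∈ O n, dMat (selfField₁ α (u n)) (selfField₂ α (w n)) (w n) z + α * w n z
      + d₂ (P n) z = 0)
    {U W : Plane → ℝ} (hU : ContDiffOn ℝ 2 U Ω) (hW : ContDiffOn ℝ 2 W Ω)
    (hulim : ∀ z ∈ Ω, Tendsto (fun q : ℕ × Plane => u q.1 q.2) (atTop ×ˢ 𝓝 z) (𝓝 (U z)))
    (hwlim : ∀ z ∈ Ω, Tendsto (fun q : ℕ × Plane => w q.1 q.2) (atTop ×ˢ 𝓝 z) (𝓝 (W z)))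
    (hκlim : ∀ z ∈ Ω, Tendsto (fun q : ℕ × Plane => κ q.1 q.2) (atTop ×ˢ 𝓝 z) (𝓝 0))
    (hflim : ∀ z ∈ Ω, Tendsto (fun q : ℕ × Plane => f q.1 q.2) (atTop ×ˢ 𝓝 z) (𝓝 0)) :
    (∀ z ∈ Ω, d₁ U z + d₂ W z = 0) ∧
    ∀ z ∈ Ω, d₂ (fun z => dMat (selfField₁ α U) (selfField₂ α W) U z + α * U z) z
      = d₁ (fun z => dMat (selfField₁ α U) (selfField₂ α W) W z + α * W z) z := by
  have hU1 : ContDiffOn ℝ 1 U Ω := hU.of_le (by norm_num)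
  have hW1 : ContDiffOn ℝ 1 W Ω := hW.of_le (by norm_num)
  have hmono : ∀ z : Plane, ∀ K : Set Plane,
      (atTop : Filter ℕ) ×ˢ 𝓝[K] z ≤ atTop ×ˢ 𝓝 z := fun z K =>
    Filter.prod_mono le_rfl nhdsWithin_le_nhds
  have hcl : ∀ {g : Plane → ℝ}, Continuous g → ∀ z : Plane,
      Tendsto (fun q : ℕ × Plane => g q.2) (atTop ×ˢ 𝓝 z) (𝓝 (g z)) := fun hg z =>
    (hg.tendsto z).comp tendsto_snd
  have hdivlim : ∀ z ∈ Ω, d₁ U z + d₂ W z = 0 := by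
    intro z hz
    refine eq_zero_of_integral_test hΩ (h := fun z => d₁ U z + d₂ W z)
      ((continuousOn_fderiv_apply hΩ hU1 _).add (continuousOn_fderiv_apply hΩ hW1 _)) ?_ hz
    intro ψ hψ hc hs
    have c₁ : Continuous (d₁ ψ) := (contDiff_fderiv_apply hψ _).continuous
    have c₂ : Continuous (d₂ ψ) := (contDiff_fderiv_apply hψ _).continuous
    have z₁ : ∀ z ∉ tsupport ψ, d₁ ψ z = 0 := fun z hz => fderiv_eq_zero_off_tsupport hz _
    have z₂ : ∀ z ∉ tsupport ψ, d₂ ψ z = 0 := fun z hz => fderiv_eq_zero_off_tsupport hz _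
    have hev := hΩO _ hs hc
    have hlim := tendsto_integral_of_continuous_convergence hc
      (J := fun n z => u n z * d₁ ψ z + w n z * d₂ ψ z - κ n z * u n z * ψ z)
      (J' := fun z => U z * d₁ ψ z + W z * d₂ ψ z)
      (fun n z hz => by simp [z₁ z hz, z₂ z hz, image_eq_zero_of_notMem_tsupport hz])
      (fun z hz => by simp [z₁ z hz, z₂ z hz])
      (hev.mono fun n hn => ((((hu n).continuousOn.mul c₁.continuousOn).add
        ((hw n).continuousOn.mul c₂.continuousOn)).sub (((hκ n).mul (hu n).continuousOn).mul
          hψ.continuous.continuousOn)).mono hn)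
      (((hU.continuousOn.mul c₁.continuousOn).add (hW.continuousOn.mul c₂.continuousOn)).mono hs)
      (fun z hz => by
        have hz' := hs hz
        have := (((hulim z hz').mul (hcl c₁ z)).add ((hwlim z hz').mul (hcl c₂ z))).sub
          (((hκlim z hz').mul (hulim z hz')).mul (hcl hψ.continuous z))
        simp only [zero_mul, sub_zero] at this
        exact this.mono_left (hmono _ _))
    have h0 : ∫ z, (U z * d₁ ψ z + W z * d₂ ψ z) = 0 := by
      refine tendsto_nhds_unique hlim (tendsto_const_nhds.congr' ?_)
      filter_upwards [hev] with n hn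
      exact (integral_weakDiv_eq_zero (hO n) (hu n) (hw n) (hκ n) (hdiv n) hψ hc hn).symm
    have hI : ∀ {g : Plane → ℝ}, ContinuousOn g Ω → Integrable fun z => g z * ψ z := fun hg =>
      integrable_mul_test hc hs hg hψ.continuous
    have hI' : ∀ {g : Plane → ℝ} (e : Plane), ContinuousOn g Ω →
        Integrable fun z => g z * fderiv ℝ ψ z e := fun e hg =>
      integrable_mul_test (hc.mono' (subset_closure.trans (tsupport_fderiv_apply_subset e)))
        ((tsupport_fderiv_apply_subset e).trans hs) hg (contDiff_fderiv_apply hψ e).continuous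
    have e1 := integral_mul_fderiv_test hΩ hU1 (hψ.of_le (by simp)) hc hs (1, 0, 0)
    have e2 := integral_mul_fderiv_test hΩ hW1 (hψ.of_le (by simp)) hc hs (0, 1, 0)
    have e3 : ∫ z, ψ z * (d₁ U z + d₂ W z)
        = (∫ z, fderiv ℝ U z (1, 0, 0) * ψ z) + ∫ z, fderiv ℝ W z (0, 1, 0) * ψ z := by
      rw [← integral_add (hI (continuousOn_fderiv_apply hΩ hU1 _))
        (hI (continuousOn_fderiv_apply hΩ hW1 _))]
      refine integral_congr_ae (Eventually.of_forall fun z => ?_)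
      simp only [d₁, d₂]; ring
    have e4 : ∫ z, (U z * d₁ ψ z + W z * d₂ ψ z)
        = (∫ z, U z * fderiv ℝ ψ z (1, 0, 0)) + ∫ z, W z * fderiv ℝ ψ z (0, 1, 0) :=
      integral_add (hI' (1, 0, 0) hU.continuousOn) (hI' (0, 1, 0) hW.continuousOn)
    rw [e4, e1, e2] at h0
    rw [e3]; linarith
  refine ⟨hdivlim, fun z hz => ?_⟩
  set F₁ := selfField₁ α U with hF₁
  set F₂ := selfField₂ α W with hF₂
  have hF₁c : ContDiffOn ℝ 1 F₁ Ω := contDiffOn_selfField₁ hU1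
  have hF₂c : ContDiffOn ℝ 1 F₂ Ω := contDiffOn_selfField₂ hW1
  have hE : ∀ {g : Plane → ℝ}, ContDiffOn ℝ 2 g Ω →
      ContDiffOn ℝ 1 (fun z => dMat F₁ F₂ g z + α * g z) Ω := by
    intro g hg
    have h1 : ∀ e : Plane, ContDiffOn ℝ 1 (fun z => fderiv ℝ g z e) Ω := fun e =>
      (hg.fderiv_of_isOpen hΩ (by norm_num)).clm_apply contDiffOn_const
    exact (((h1 _).add (hF₁c.mul (h1 _))).add (hF₂c.mul (h1 _))).add
      (contDiffOn_const.mul (hg.of_le (by norm_num)))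
  have hE₁ := hE hU
  have hE₂ := hE hW
  suffices h : d₂ (fun z => dMat F₁ F₂ U z + α * U z) z
      - d₁ (fun z => dMat F₁ F₂ W z + α * W z) z = 0 from sub_eq_zero.1 h
  refine eq_zero_of_integral_test hΩ (h := fun z => d₂ (fun z => dMat F₁ F₂ U z + α * U z) z
      - d₁ (fun z => dMat F₁ F₂ W z + α * W z) z)
    ((continuousOn_fderiv_apply hΩ hE₁ _).sub (continuousOn_fderiv_apply hΩ hE₂ _)) ?_ hz
  intro ψ hψ hc hs
  have hψ₁ : ContDiff ℝ ∞ (d₁ ψ) := contDiff_fderiv_apply hψ _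
  have hψ₂ : ContDiff ℝ ∞ (d₂ ψ) := contDiff_fderiv_apply hψ _
  have hev := hΩO _ hs hc
  have hlim := tendsto_integral_of_continuous_convergence hc
    (J := fun n z => weakVort α (u n) (w n) (κ n) (f n) ψ z)
    (J' := fun z => weakVort α U W (fun _ => 0) (fun _ => 0) ψ z)
    (fun n z hz => weakVort_eq_zero_off_tsupport hz)
    (fun z hz => weakVort_eq_zero_off_tsupport hz)
    (hev.mono fun n hn => (continuousOn_weakVort (hO n) (hu n).continuousOn (hw n).continuousOn
      (hκ n) (hf n) hψ).mono hn)
    ((continuousOn_weakVort hΩ hU.continuousOn hW.continuousOn continuousOn_const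
      continuousOn_const hψ).mono hs)
    (fun z hz => by
      have hz' := hs hz
      have lu := hulim z hz'
      have lw := hwlim z hz'
      have lF₁ := (hcl (show Continuous fun z : Plane => (1 - α) * z.1 by fun_prop) z).add lu
      have lF₂ := (hcl (show Continuous fun z : Plane => (1 - α) * z.2.1 by fun_prop) z).add lw
      have lM : ∀ {g : Plane → ℝ}, ContDiff ℝ ∞ g →
          Tendsto (fun q : ℕ × Plane => dMat (selfField₁ α (u q.1)) (selfField₂ α (w q.1)) g q.2)
            (atTop ×ˢ 𝓝 z) (𝓝 (dMat F₁ F₂ g z)) := fun hg =>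
        ((hcl (contDiff_fderiv_apply hg _).continuous z).add
          (lF₁.mul (hcl (contDiff_fderiv_apply hg _).continuous z))).add
          (lF₂.mul (hcl (contDiff_fderiv_apply hg _).continuous z))
      have l₁ := hcl hψ₁.continuous z
      have l₂ := hcl hψ₂.continuous z
      exact ((((lu.mul (lM hψ₂)).sub (lw.mul (lM hψ₁))).add
        ((tendsto_const_nhds.sub ((hκlim z hz').mul lu)).mul ((lu.mul l₂).sub (lw.mul l₁)))).add
        ((hflim z hz').mul l₂)).mono_left (hmono _ _))
  have h0 : ∫ z, weakVort α U W (fun _ => 0) (fun _ => 0) ψ z = 0 := by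
    refine tendsto_nhds_unique hlim (tendsto_const_nhds.congr' ?_)
    filter_upwards [hev] with n hn
    exact (integral_weakVort_eq_zero (hO n) (hu n) (hw n) (hP n) (hf n) (hdiv n) (h₁ n)
      (h₂ n) hψ hc hn).symm
  rw [integral_weakVort hΩ hU1 hW1 (κ := fun _ => 0) continuousOn_const
    (fun z hz => by simpa using hdivlim z hz) hψ hc hs] at h0
  have e1 := integral_mul_fderiv_test hΩ hE₁ (hψ.of_le (by simp)) hc hs (0, 1, 0)
  have e2 := integral_mul_fderiv_test hΩ hE₂ (hψ.of_le (by simp)) hc hs (1, 0, 0)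
  have hI : ∀ {g : Plane → ℝ}, ContinuousOn g Ω → Integrable fun z => g z * ψ z := fun hg =>
    integrable_mul_test hc hs hg hψ.continuous
  have e3 : ∫ z, ψ z * (d₂ (fun z => dMat F₁ F₂ U z + α * U z) z
      - d₁ (fun z => dMat F₁ F₂ W z + α * W z) z)
      = (∫ z, fderiv ℝ (fun z => dMat F₁ F₂ U z + α * U z) z (0, 1, 0) * ψ z)
        - ∫ z, fderiv ℝ (fun z => dMat F₁ F₂ W z + α * W z) z (1, 0, 0) * ψ z := by
    rw [← integral_sub (hI (continuousOn_fderiv_apply hΩ hE₁ _))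
      (hI (continuousOn_fderiv_apply hΩ hE₂ _))]
    refine integral_congr_ae (Eventually.of_forall fun z => ?_)
    simp only [d₁, d₂]; ring
  have e4 : ∫ z, (0 - (dMat F₁ F₂ U z + α * U z)) * d₂ ψ z
      = -∫ z, (dMat F₁ F₂ U z + α * U z) * fderiv ℝ ψ z (0, 1, 0) := by
    rw [← integral_neg]
    refine integral_congr_ae (Eventually.of_forall fun z => ?_)
    simp only [d₂]; ring
  have e5 : ∫ z, (dMat F₁ F₂ W z + α * W z) * d₁ ψ z
      = ∫ z, (dMat F₁ F₂ W z + α * W z) * fderiv ℝ ψ z (1, 0, 0) := rfl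
  rw [e4, e5, e1, e2] at h0
  rw [e3]; linarith

/-- The curl of the limit equations: the vorticity equation in self-similar variables. -/
theorem vorticity_of_limit_equations {Ω : Set Plane} (hΩ : IsOpen Ω) {α : ℝ} {U W : Plane → ℝ}
    (hU : ContDiffOn ℝ 2 U Ω) (hW : ContDiffOn ℝ 2 W Ω) {z : Plane} (hz : z ∈ Ω)
    (hdiv : d₁ U z + d₂ W z = 0)
    (hcurl : d₂ (fun z => dMat (selfField₁ α U) (selfField₂ α W) U z + α * U z) z
      = d₁ (fun z => dMat (selfField₁ α U) (selfField₂ α W) W z + α * W z) z) :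
    dMat (selfField₁ α U) (selfField₂ α W) (fun z => d₁ W z - d₂ U z) z
      + (d₁ W z - d₂ U z) = 0 := by
  have hUa : ContDiffAt ℝ 2 U z := hU.contDiffAt (hΩ.mem_nhds hz)
  have hWa : ContDiffAt ℝ 2 W z := hW.contDiffAt (hΩ.mem_nhds hz)
  have hdU : DifferentiableAt ℝ U z := hUa.differentiableAt (by norm_num)
  have hdW : DifferentiableAt ℝ W z := hWa.differentiableAt (by norm_num)
  have hF₁ : DifferentiableAt ℝ (selfField₁ α U) z :=
    ((contDiffOn_selfField₁ hU).contDiffAt (hΩ.mem_nhds hz)).differentiableAt (by norm_num)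
  have hF₂ : DifferentiableAt ℝ (selfField₂ α W) z :=
    ((contDiffOn_selfField₂ hW).contDiffAt (hΩ.mem_nhds hz)).differentiableAt (by norm_num)
  have hd : ∀ {g : Plane → ℝ}, ContDiffAt ℝ 2 g z → ∀ e : Plane,
      DifferentiableAt ℝ (fun z => fderiv ℝ g z e) z := fun hg e =>
    ((hg.fderiv_right (m := 1) (by norm_num)).differentiableAt one_ne_zero).clm_apply
      (differentiableAt_const e)
  have hexp : ∀ {g : Plane → ℝ}, ContDiffAt ℝ 2 g z → ∀ e : Plane,
      fderiv ℝ (fun z => dMat (selfField₁ α U) (selfField₂ α W) g z + α * g z) z e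
      = fderiv ℝ (fun z => fderiv ℝ g z e) z (0, 0, 1)
        + (fderiv ℝ (selfField₁ α U) z e * fderiv ℝ g z (1, 0, 0)
          + selfField₁ α U z * fderiv ℝ (fun z => fderiv ℝ g z e) z (1, 0, 0))
        + (fderiv ℝ (selfField₂ α W) z e * fderiv ℝ g z (0, 1, 0)
          + selfField₂ α W z * fderiv ℝ (fun z => fderiv ℝ g z e) z (0, 1, 0))
        + α * fderiv ℝ g z e := by
    intro g hg e
    have h : HasFDerivAt (fun z => dMat (selfField₁ α U) (selfField₂ α W) g z + α * g z) _ z :=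
      (((hd hg (0, 0, 1)).hasFDerivAt.add (hF₁.hasFDerivAt.mul (hd hg (1, 0, 0)).hasFDerivAt)).add
        (hF₂.hasFDerivAt.mul (hd hg (0, 1, 0)).hasFDerivAt)).add
        ((hg.differentiableAt (by norm_num)).hasFDerivAt.const_mul α)
    rw [h.fderiv]
    simp only [add_apply, smul_apply, smul_eq_mul]
    rw [fderiv_apply_comm hg (0, 0, 1) e, fderiv_apply_comm hg (1, 0, 0) e,
      fderiv_apply_comm hg (0, 1, 0) e]
    ring
  have hω : ∀ e : Plane, fderiv ℝ (fun z => d₁ W z - d₂ U z) z e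
      = fderiv ℝ (fun z => fderiv ℝ W z (1, 0, 0)) z e
        - fderiv ℝ (fun z => fderiv ℝ U z (0, 1, 0)) z e := fun e => by
    have h : HasFDerivAt (fun z => d₁ W z - d₂ U z) _ z :=
      (hd hWa (1, 0, 0)).hasFDerivAt.sub (hd hUa (0, 1, 0)).hasFDerivAt
    rw [h.fderiv]; simp
  have a1 : fderiv ℝ (selfField₁ α U) z (1, 0, 0) = _ := d₁_selfField₁ hdU
  have a2 : fderiv ℝ (selfField₁ α U) z (0, 1, 0) = _ := d₂_selfField₁ hdU
  have b1 : fderiv ℝ (selfField₂ α W) z (1, 0, 0) = _ := d₁_selfField₂ hdW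
  have b2 : fderiv ℝ (selfField₂ α W) z (0, 1, 0) = _ := d₂_selfField₂ hdW
  rw [d₂, d₁, hexp hUa, hexp hWa, a2, b2, b1, a1] at hcurl
  simp only [dMat, dₜ, d₁, d₂] at hdiv hcurl hω ⊢
  simp only [hω]
  linear_combination -hcurl + (-(fderiv ℝ W z (1, 0, 0) - fderiv ℝ U z (0, 1, 0))) * hdiv

end Weak

end WeakFormulation

/-! ### The Euler equations in a meridian half plane -/

/-- The unit vectors of the coordinate axes. -/
noncomputable abbrev ax (i : Fin 3) : E3 := EuclideanSpace.single i 1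

theorem fderiv_slice {E F : Type*} [NormedAddCommGroup E] [NormedSpace ℝ E]
    [NormedAddCommGroup F] [NormedSpace ℝ F] {G : E → ℝ → F} {x : E} {t : ℝ}
    (hG : DifferentiableAt ℝ (fun z : E × ℝ => G z.1 z.2) (x, t)) (w : E) :
    fderiv ℝ (fun y => G y t) x w = fderiv ℝ (fun z : E × ℝ => G z.1 z.2) (x, t) (w, 0) := by
  have : HasFDerivAt (fun y => G y t) ((fderiv ℝ (fun z : E × ℝ => G z.1 z.2) (x, t)).comp
      ((ContinuousLinearMap.id ℝ E).prod (0 : E →L[ℝ] ℝ))) x :=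
    HasFDerivAt.comp (f := fun y : E => (y, t)) x hG.hasFDerivAt
      ((hasFDerivAt_id x).prodMk (hasFDerivAt_const t x))
  rw [this.fderiv]; simp

section Meridian

variable {a b T₀ : ℝ} {v : E3 → ℝ → E3} {p : E3 → ℝ → ℝ}

theorem differentiableAt_velocity (h : IsAxisymEulerSolution a b T₀ v p) {x : E3} {t : ℝ}
    (hx : x ∈ pipe) (ht : t ∈ Ioo 0 T₀) :
    DifferentiableAt ℝ (fun z : E3 × ℝ => v z.1 z.2) (x, t) :=
  (h.smooth_velocity.contDiffAt (spaceTime_mem_nhds hx ht)).differentiableAt (by simp)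

theorem differentiableAt_pressure (h : IsAxisymEulerSolution a b T₀ v p) {x : E3} {t : ℝ}
    (hx : x ∈ pipe) (ht : t ∈ Ioo 0 T₀) :
    DifferentiableAt ℝ (fun z : E3 × ℝ => p z.1 z.2) (x, t) :=
  (h.smooth_pressure.contDiffAt (spaceTime_mem_nhds hx ht)).differentiableAt (by simp)

/-- The angular derivative of an axially symmetric velocity. -/
theorem fderiv_velocity_perp (h : IsAxisymEulerSolution a b T₀ v p) {x : E3} {t : ℝ}
    (hx : x ∈ pipe) (ht : t ∈ Ioo 0 T₀) :
    fderiv ℝ (fun z : E3 × ℝ => v z.1 z.2) (x, t) (perp x, 0) = perp (v x t) := by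
  have hr : HasDerivAt (fun s => (rot s x, t)) (perp x, (0 : ℝ)) 0 := by
    simpa [rot_zero] using (hasDerivAt_rot 0 x).prodMk (hasDerivAt_const (0 : ℝ) t)
  have hd : HasFDerivAt (fun z : E3 × ℝ => v z.1 z.2)
      (fderiv ℝ (fun z : E3 × ℝ => v z.1 z.2) (x, t)) ((fun s => (rot s x, t)) 0) := by
    simpa [rot_zero] using (differentiableAt_velocity h hx ht).hasFDerivAt
  have h1 := hd.comp_hasDerivAt (0 : ℝ) hr
  have h2 : HasDerivAt (fun s => rot s (v x t)) (perp (v x t)) 0 := by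
    simpa [rot_zero] using hasDerivAt_rot 0 (v x t)
  refine h1.unique (h2.congr_of_eventuallyEq (Eventually.of_forall fun s => ?_))
  exact h.axisymmetric s x (pipe_subset_closedPipe hx) t ⟨ht.1.le, ht.2⟩

/-- The point of the meridian half plane at distance `ρ` from the axis and at height `ζ`. -/
noncomputable def merid (ρ ζ : ℝ) : E3 := ρ • ax 0 + ζ • ax 2

@[simp] theorem merid_zero (ρ ζ : ℝ) : merid ρ ζ 0 = ρ := by simp [merid]
@[simp] theorem merid_one (ρ ζ : ℝ) : merid ρ ζ 1 = 0 := by simp [merid]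
@[simp] theorem merid_two (ρ ζ : ℝ) : merid ρ ζ 2 = ζ := by simp [merid]

theorem rad_merid {ρ ζ : ℝ} (hρ : 0 ≤ ρ) : rad (merid ρ ζ) = ρ := by
  simp [rad, Real.sqrt_sq hρ]

variable {ρ ζ t : ℝ}

/-- On the meridian half plane the derivative across it is the angular derivative, divided by the
radius, so the axial symmetry removes it from the equations. -/
theorem fderiv_velocity_merid (h : IsAxisymEulerSolution a b T₀ v p) (hρ : 0 < ρ) (hρ' : ρ < 1)
    (ht : t ∈ Ioo 0 T₀) :
    fderiv ℝ (fun z : E3 × ℝ => v z.1 z.2) (merid ρ ζ, t) (ax 1, 0)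
      = ρ⁻¹ • perp (v (merid ρ ζ) t) := by
  have hx : merid ρ ζ ∈ pipe := by rw [mem_pipe, rad_merid hρ.le]; exact hρ'
  rw [← fderiv_velocity_perp h hx ht, ← map_smul]
  congr 1
  ext i
  · fin_cases i <;> simp [perp, hρ.ne']
  · simp

/-- The momentum equation on the meridian half plane. The last term on the left contains the
centrifugal force. -/
theorem momentum_merid (h : IsAxisymEulerSolution a b T₀ v p) (hρ : 0 < ρ) (hρ' : ρ < 1)
    (ht : t ∈ Ioo 0 T₀) (i : Fin 3) :
    fderiv ℝ (fun z : E3 × ℝ => v z.1 z.2) (merid ρ ζ, t) (0, 1) i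
      + v (merid ρ ζ) t 0 * fderiv ℝ (fun z : E3 × ℝ => v z.1 z.2) (merid ρ ζ, t) (ax 0, 0) i
      + v (merid ρ ζ) t 2 * fderiv ℝ (fun z : E3 × ℝ => v z.1 z.2) (merid ρ ζ, t) (ax 2, 0) i
      + v (merid ρ ζ) t 1 * ρ⁻¹ * perp (v (merid ρ ζ) t) i
      = -fderiv ℝ (fun z : E3 × ℝ => p z.1 z.2) (merid ρ ζ, t) (ax i, 0) := by
  have hx : merid ρ ζ ∈ pipe := by rw [mem_pipe, rad_merid hρ.le]; exact hρ'
  have h1 := momentum_apply h hx ht (ax i)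
  rw [fderiv_slice (differentiableAt_pressure h hx ht)] at h1
  rw [← h1]
  have h2 : ((v (merid ρ ζ) t, 1) : E3 × ℝ) = ((0 : E3), (1 : ℝ))
      + v (merid ρ ζ) t 0 • (ax 0, (0 : ℝ)) + v (merid ρ ζ) t 1 • (ax 1, (0 : ℝ))
      + v (merid ρ ζ) t 2 • (ax 2, (0 : ℝ)) := by
    ext j
    · fin_cases j <;> simp
    · simp
  rw [h2, map_add, map_add, map_add, map_smul, map_smul, map_smul,
    fderiv_velocity_merid h hρ hρ' ht]
  have h3 : ∀ y : E3, inner ℝ y (ax i) = y i := fun y => by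
    simp [EuclideanSpace.inner_single_right]
  rw [h3]
  simp only [PiLp.add_apply, PiLp.smul_apply, smul_eq_mul]
  ring

/-- Incompressibility on the meridian half plane, with the curvature term on the right. -/
theorem divergence_merid (h : IsAxisymEulerSolution a b T₀ v p) (hρ : 0 < ρ) (hρ' : ρ < 1)
    (ht : t ∈ Ioo 0 T₀) :
    fderiv ℝ (fun z : E3 × ℝ => v z.1 z.2) (merid ρ ζ, t) (ax 0, 0) 0
      + fderiv ℝ (fun z : E3 × ℝ => v z.1 z.2) (merid ρ ζ, t) (ax 2, 0) 2
      = -(ρ⁻¹ * v (merid ρ ζ) t 0) := by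
  have hx : merid ρ ζ ∈ pipe := by rw [mem_pipe, rad_merid hρ.le]; exact hρ'
  have h1 := h.divergence_free _ hx t ht
  rw [Fin.sum_univ_three] at h1
  simp only [fderiv_slice (differentiableAt_velocity h hx ht)] at h1
  rw [fderiv_velocity_merid h hρ hρ' ht] at h1
  simp [perp] at h1
  linarith

end Meridian

/-! ### Self-similar variables around the boundary point -/

/-- The spatial scale of the self-similar variables at the logarithmic time `z.2.2 + m`. -/
noncomputable def scale (α m : ℝ) (z : Plane) : ℝ := Real.exp (-(1 - α) * (z.2.2 + m))

/-- The space-time point with the self-similar variables `z`, whose time is shifted by `m`. -/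
noncomputable def chart (α T₀ m : ℝ) (z : Plane) : E3 × ℝ :=
  (merid (1 + scale α m z * z.1) (scale α m z * z.2.1), T₀ - Real.exp (-(z.2.2 + m)))

/-- A function in self-similar variables, with the exponential weight `c`. -/
noncomputable def selfSim (α T₀ c m : ℝ) (G : E3 × ℝ → ℝ) (z : Plane) : ℝ :=
  Real.exp (c * (z.2.2 + m)) * G (chart α T₀ m z)

theorem hasFDerivAt_time (z : Plane) : HasFDerivAt (fun z : Plane => z.2.2)
    ((ContinuousLinearMap.snd ℝ ℝ ℝ).comp (ContinuousLinearMap.snd ℝ ℝ (ℝ × ℝ))) z :=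
  ((ContinuousLinearMap.snd ℝ ℝ ℝ).comp (ContinuousLinearMap.snd ℝ ℝ (ℝ × ℝ))).hasFDerivAt

theorem hasFDerivAt_exp_time (c m : ℝ) (z : Plane) :
    HasFDerivAt (fun z : Plane => Real.exp (c * (z.2.2 + m)))
      (Real.exp (c * (z.2.2 + m)) • (c • ((ContinuousLinearMap.snd ℝ ℝ ℝ).comp
        (ContinuousLinearMap.snd ℝ ℝ (ℝ × ℝ))))) z :=
  (((hasFDerivAt_time z).add_const m).const_mul c).exp

/-- The chain rule for self-similar variables, for a general direction `e` in planar space-time. -/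
theorem fderiv_selfSim {α T₀ c m : ℝ} {G : E3 × ℝ → ℝ} {z : Plane}
    (hG : DifferentiableAt ℝ G (chart α T₀ m z)) (e : Plane) :
    fderiv ℝ (selfSim α T₀ c m G) z e = Real.exp (c * (z.2.2 + m)) *
      (c * e.2.2 * G (chart α T₀ m z)
        + (scale α m z * (e.1 - (1 - α) * z.1 * e.2.2)) * fderiv ℝ G (chart α T₀ m z) (ax 0, 0)
        + (scale α m z * (e.2.1 - (1 - α) * z.2.1 * e.2.2))
          * fderiv ℝ G (chart α T₀ m z) (ax 2, 0)
        + Real.exp (-(z.2.2 + m)) * e.2.2 * fderiv ℝ G (chart α T₀ m z) (0, 1)) := by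
  have hs : HasFDerivAt (scale α m) _ z := hasFDerivAt_exp_time (-(1 - α)) m z
  have ht : HasFDerivAt (fun z : Plane => Real.exp (-(z.2.2 + m)))
      (Real.exp (-(z.2.2 + m)) • -((ContinuousLinearMap.snd ℝ ℝ ℝ).comp
        (ContinuousLinearMap.snd ℝ ℝ (ℝ × ℝ)))) z :=
    ((hasFDerivAt_time z).add_const m).neg.exp
  have h1 : HasFDerivAt (fun z : Plane => z.1) _ z := (ContinuousLinearMap.fst ℝ ℝ (ℝ × ℝ)).hasFDerivAt
  have h2 : HasFDerivAt (fun z : Plane => z.2.1) _ z :=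
    ((ContinuousLinearMap.fst ℝ ℝ ℝ).comp (ContinuousLinearMap.snd ℝ ℝ (ℝ × ℝ))).hasFDerivAt
  have hc : HasFDerivAt (chart α T₀ m) _ z :=
    ((((hs.mul h1).const_add (1 : ℝ)).smul_const (ax 0)).add ((hs.mul h2).smul_const (ax 2))).prodMk
      (ht.const_sub T₀)
  have hg : HasFDerivAt (selfSim α T₀ c m G) _ z :=
    (hasFDerivAt_exp_time c m z).mul (hG.hasFDerivAt.comp z hc)
  rw [hg.fderiv]
  have hsplit : ∀ r s q : ℝ, fderiv ℝ G (chart α T₀ m z) (r • ax 0 + s • ax 2, q)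
      = r * fderiv ℝ G (chart α T₀ m z) (ax 0, 0) + s * fderiv ℝ G (chart α T₀ m z) (ax 2, 0)
        + q * fderiv ℝ G (chart α T₀ m z) (0, 1) := by
    intro r s q
    have : ((r • ax 0 + s • ax 2, q) : E3 × ℝ)
        = r • (ax 0, (0 : ℝ)) + s • (ax 2, (0 : ℝ)) + q • ((0 : E3), (1 : ℝ)) := by simp
    rw [this, map_add, map_add, map_smul, map_smul, map_smul]
    simp
  have he : scale α m z = Real.exp (-(1 - α) * (z.2.2 + m)) := rfl
  simp only [add_apply, smul_apply, ContinuousLinearMap.comp_apply, ContinuousLinearMap.prod_apply,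
    ContinuousLinearMap.smulRight_apply, ContinuousLinearMap.coe_fst', ContinuousLinearMap.coe_snd',
    neg_apply, smul_eq_mul, hsplit]
  rw [← he]
  ring

/-- The part of self-similar space-time which the chart maps into the meridian half plane of the
open cylinder, at times between `0` and the blow-up time. -/
def chartDomain (α T₀ m : ℝ) : Set Plane :=
  {z | z.1 < 0 ∧ 0 < 1 + scale α m z * z.1 ∧ 0 < T₀ - Real.exp (-(z.2.2 + m))}

theorem continuous_scale (α m : ℝ) : Continuous (scale α m) := by unfold scale; fun_prop

theorem isOpen_chartDomain (α T₀ m : ℝ) : IsOpen (chartDomain α T₀ m) := by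
  have h1 : Continuous fun z : Plane => 1 + scale α m z * z.1 :=
    continuous_const.add ((continuous_scale α m).mul continuous_fst)
  have h2 : Continuous fun z : Plane => T₀ - Real.exp (-(z.2.2 + m)) := by fun_prop
  exact (isOpen_lt continuous_fst continuous_const).inter
    ((isOpen_lt continuous_const h1).inter (isOpen_lt continuous_const h2))

theorem scale_pos (α m : ℝ) (z : Plane) : 0 < scale α m z := Real.exp_pos _

section SelfSimilar

variable {a b T₀ α m : ℝ} {v : E3 → ℝ → E3} {p : E3 → ℝ → ℝ} {z : Plane}

theorem radius_chart_lt (hz : z ∈ chartDomain α T₀ m) : 1 + scale α m z * z.1 < 1 := by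
  have := mul_neg_of_pos_of_neg (scale_pos α m z) hz.1
  linarith

theorem time_chart_mem (hz : z ∈ chartDomain α T₀ m) :
    T₀ - Real.exp (-(z.2.2 + m)) ∈ Ioo 0 T₀ :=
  ⟨hz.2.2, by linarith [Real.exp_pos (-(z.2.2 + m))]⟩

theorem chart_mem (hz : z ∈ chartDomain α T₀ m) : chart α T₀ m z ∈ pipe ×ˢ Ioo 0 T₀ := by
  refine ⟨?_, time_chart_mem hz⟩
  rw [mem_pipe, chart, rad_merid hz.2.1.le]
  exact radius_chart_lt hz

/-- The components of the velocity in self-similar variables. -/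
noncomputable def selfVel (α T₀ m : ℝ) (v : E3 → ℝ → E3) (i : Fin 3) : Plane → ℝ :=
  selfSim α T₀ (-α) m (fun z => v z.1 z.2 i)

theorem contDiff_chart (α T₀ m : ℝ) : ContDiff ℝ ∞ (chart α T₀ m) := by
  have h : ContDiff ℝ ∞ (scale α m) := by unfold scale; fun_prop
  unfold chart merid
  fun_prop

theorem contDiffOn_selfSim {c : ℝ} {G : E3 × ℝ → ℝ} (hG : ContDiffOn ℝ ∞ G (spaceTime T₀)) :
    ContDiffOn ℝ 1 (selfSim α T₀ c m G) (chartDomain α T₀ m) := by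
  have h1 : ContDiffOn ℝ ∞ (G ∘ chart α T₀ m) (chartDomain α T₀ m) :=
    hG.comp (contDiff_chart α T₀ m).contDiffOn fun z hz =>
      prod_mono pipe_subset_closedPipe Ioo_subset_Ico_self (chart_mem hz)
  have h2 : ContDiff ℝ ∞ (fun z : Plane => Real.exp (c * (z.2.2 + m))) := by fun_prop
  exact (h2.contDiffOn.mul h1).of_le (by simp)

theorem contDiffOn_selfVel (h : IsAxisymEulerSolution a b T₀ v p) (i : Fin 3) :
    ContDiffOn ℝ 1 (selfVel α T₀ m v i) (chartDomain α T₀ m) :=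
  contDiffOn_selfSim (contDiffOn_euclidean.1 h.smooth_velocity i)

/-- The curvature of the cylinder in self-similar variables. -/
noncomputable def selfCurv (α m : ℝ) (z : Plane) : ℝ := scale α m z / (1 + scale α m z * z.1)

theorem continuousOn_selfCurv : ContinuousOn (selfCurv α m) (chartDomain α T₀ m) := by
  have h := continuous_scale α m
  exact h.continuousOn.div (by fun_prop) fun z hz => hz.2.1.ne'

theorem fderiv_velocity_component (h : IsAxisymEulerSolution a b T₀ v p)
    (hz : z ∈ chartDomain α T₀ m) (i : Fin 3) :
    DifferentiableAt ℝ (fun z : E3 × ℝ => v z.1 z.2 i) (chart α T₀ m z) ∧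
    ∀ w, fderiv ℝ (fun z : E3 × ℝ => v z.1 z.2 i) (chart α T₀ m z) w
      = fderiv ℝ (fun z : E3 × ℝ => v z.1 z.2) (chart α T₀ m z) w i := by
  have hd := differentiableAt_velocity h (chart_mem hz).1 (chart_mem hz).2
  have hi := hasFDerivAt_apply hd.hasFDerivAt i
  exact ⟨hi.differentiableAt, fun w => by rw [hi.fderiv]; simp⟩

theorem exp_mul_scale (α m : ℝ) (z : Plane) :
    Real.exp (-α * (z.2.2 + m)) * scale α m z = Real.exp (-(z.2.2 + m)) := by
  rw [scale, ← Real.exp_add]; congr 1; ring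

/-- Incompressibility in self-similar variables. -/
theorem selfVel_divergence (h : IsAxisymEulerSolution a b T₀ v p)
    (hz : z ∈ chartDomain α T₀ m) :
    d₁ (selfVel α T₀ m v 0) z + d₂ (selfVel α T₀ m v 2) z
      = -(selfCurv α m z * selfVel α T₀ m v 0 z) := by
  obtain ⟨hd0, hf0⟩ := fderiv_velocity_component h hz 0
  obtain ⟨hd2, hf2⟩ := fderiv_velocity_component h hz 2
  rw [d₁, d₂, selfVel, selfVel, fderiv_selfSim hd0, fderiv_selfSim hd2]
  simp only [hf0, hf2]
  have h1 := divergence_merid h (ζ := scale α m z * z.2.1) hz.2.1 (radius_chart_lt hz)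
    (time_chart_mem hz)
  simp only [selfSim, selfCurv, chart] at h1 ⊢
  rw [div_eq_mul_inv]
  linear_combination (Real.exp (-α * (z.2.2 + m)) * scale α m z) * h1

/-- The momentum equation in self-similar variables, where the rescaled pressure gradient is still
written in the original variables and the swirl part is on the right. -/
theorem selfVel_material (h : IsAxisymEulerSolution a b T₀ v p)
    (hz : z ∈ chartDomain α T₀ m) (i : Fin 3) :
    dMat (selfField₁ α (selfVel α T₀ m v 0)) (selfField₂ α (selfVel α T₀ m v 2))
        (selfVel α T₀ m v i) z + α * selfVel α T₀ m v i z
      + Real.exp (-2 * α * (z.2.2 + m)) * scale α m z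
        * fderiv ℝ (fun z : E3 × ℝ => p z.1 z.2) (chart α T₀ m z) (ax i, 0)
      = -(Real.exp (-2 * α * (z.2.2 + m)) * selfCurv α m z * v (chart α T₀ m z).1
        (chart α T₀ m z).2 1 * perp (v (chart α T₀ m z).1 (chart α T₀ m z).2) i) := by
  obtain ⟨hd, hf⟩ := fderiv_velocity_component h hz i
  have h1 := momentum_merid h (ζ := scale α m z * z.2.1) hz.2.1 (radius_chart_lt hz)
    (time_chart_mem hz) i
  have h2 := exp_mul_scale α m z
  have h3 : Real.exp (-2 * α * (z.2.2 + m)) = Real.exp (-α * (z.2.2 + m)) ^ 2 := by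
    rw [sq, ← Real.exp_add]; congr 1; ring
  rw [dMat, dₜ, d₁, d₂, selfVel, fderiv_selfSim hd, fderiv_selfSim hd, fderiv_selfSim hd]
  simp only [hf]
  simp only [selfField₁, selfField₂, selfVel, selfSim, selfCurv, chart] at h1 ⊢
  rw [div_eq_mul_inv, h3]
  linear_combination (Real.exp (-α * (z.2.2 + m)) ^ 2 * scale α m z) * h1
    - Real.exp (-α * (z.2.2 + m)) * (fderiv ℝ (fun z : E3 × ℝ => v z.1 z.2)
      (merid (1 + scale α m z * z.1) (scale α m z * z.2.1), T₀ - Real.exp (-(z.2.2 + m))) (0, 1)) i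
      * h2

/-- The pressure in self-similar variables. -/
noncomputable def selfPres (α T₀ m : ℝ) (p : E3 → ℝ → ℝ) : Plane → ℝ :=
  selfSim α T₀ (-2 * α) m (fun z => p z.1 z.2)

/-- The centrifugal force in self-similar variables. -/
noncomputable def selfForce (α T₀ m : ℝ) (v : E3 → ℝ → E3) (z : Plane) : ℝ :=
  selfCurv α m z * selfVel α T₀ m v 1 z ^ 2

/-- The radial momentum equation in self-similar variables. -/
theorem selfVel_radial (h : IsAxisymEulerSolution a b T₀ v p) (hz : z ∈ chartDomain α T₀ m) :
    dMat (selfField₁ α (selfVel α T₀ m v 0)) (selfField₂ α (selfVel α T₀ m v 2))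
        (selfVel α T₀ m v 0) z + α * selfVel α T₀ m v 0 z + d₁ (selfPres α T₀ m p) z
      = selfForce α T₀ m v z := by
  have hd := differentiableAt_pressure h (chart_mem hz).1 (chart_mem hz).2
  have h1 := selfVel_material h hz 0
  have h3 : Real.exp (-2 * α * (z.2.2 + m)) = Real.exp (-α * (z.2.2 + m)) ^ 2 := by
    rw [sq, ← Real.exp_add]; congr 1; ring
  have h4 : d₁ (selfPres α T₀ m p) z = Real.exp (-2 * α * (z.2.2 + m)) * scale α m z
      * fderiv ℝ (fun z : E3 × ℝ => p z.1 z.2) (chart α T₀ m z) (ax 0, 0) := by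
    rw [d₁, selfPres, fderiv_selfSim hd]; simp; ring
  have h5 : selfForce α T₀ m v z = -(Real.exp (-2 * α * (z.2.2 + m)) * selfCurv α m z *
      v (chart α T₀ m z).1 (chart α T₀ m z).2 1 *
        perp (v (chart α T₀ m z).1 (chart α T₀ m z).2) 0) := by
    rw [selfForce, selfVel, selfSim, h3]; simp [perp]; ring
  rw [h4, h5]; exact h1

/-- The vertical momentum equation in self-similar variables. -/
theorem selfVel_vertical (h : IsAxisymEulerSolution a b T₀ v p) (hz : z ∈ chartDomain α T₀ m) :
    dMat (selfField₁ α (selfVel α T₀ m v 0)) (selfField₂ α (selfVel α T₀ m v 2))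
        (selfVel α T₀ m v 2) z + α * selfVel α T₀ m v 2 z + d₂ (selfPres α T₀ m p) z = 0 := by
  have hd := differentiableAt_pressure h (chart_mem hz).1 (chart_mem hz).2
  have h1 := selfVel_material h hz 2
  have h4 : d₂ (selfPres α T₀ m p) z = Real.exp (-2 * α * (z.2.2 + m)) * scale α m z
      * fderiv ℝ (fun z : E3 × ℝ => p z.1 z.2) (chart α T₀ m z) (ax 2, 0) := by
    rw [d₂, selfPres, fderiv_selfSim hd]; simp; ring
  rw [h4, h1]; simp [perp]

end SelfSimilar

/-! ### Convergence to the profile at the boundary point -/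

section Convergence

variable {a b d T₀ α : ℝ} {v : E3 → ℝ → E3} {p : E3 → ℝ → ℝ} {V : E2 → E3} {W : E3 → ℝ → E3}

theorem tendsto_add_natCast (z₀ : Plane) :
    Tendsto (fun q : ℕ × Plane => q.2.2.2 + (q.1 : ℝ)) (atTop ×ˢ 𝓝 z₀) atTop := by
  have h1 : Tendsto (fun q : ℕ × Plane => q.2.2.2) (atTop ×ˢ 𝓝 z₀) (𝓝 z₀.2.2) :=
    ((by fun_prop : Continuous fun z : Plane => z.2.2).tendsto z₀).comp tendsto_snd
  exact h1.add_atTop (tendsto_natCast_atTop_atTop.comp tendsto_fst)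

theorem tendsto_scale (hα : α < 1) (z₀ : Plane) :
    Tendsto (fun q : ℕ × Plane => scale α q.1 q.2) (atTop ×ˢ 𝓝 z₀) (𝓝 0) := by
  refine Real.tendsto_exp_atBot.comp ?_
  exact (tendsto_add_natCast z₀).const_mul_atTop_of_neg (by linarith)

theorem tendsto_time (T₀ : ℝ) (z₀ : Plane) :
    Tendsto (fun q : ℕ × Plane => T₀ - Real.exp (-(q.2.2.2 + q.1))) (atTop ×ˢ 𝓝 z₀)
      (𝓝[<] T₀) := by
  refine tendsto_nhdsWithin_iff.2 ⟨?_, Eventually.of_forall fun q => ?_⟩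
  · have := (Real.tendsto_exp_neg_atTop_nhds_zero.comp (tendsto_add_natCast z₀)).const_sub T₀
    simpa using this
  · exact mem_Iio.2 (by linarith [Real.exp_pos (-(q.2.2.2 + q.1))])

theorem tendsto_snd_comp {g : Plane → ℝ} (hg : Continuous g) (z₀ : Plane) :
    Tendsto (fun q : ℕ × Plane => g q.2) (atTop ×ˢ 𝓝 z₀) (𝓝 (g z₀)) :=
  (hg.tendsto z₀).comp tendsto_snd

/-- Around a point of the open half plane, the charts with large time shifts take values in the part
of the cylinder where the solution is close to the profile. -/
theorem eventually_chart_mem (hα : α < 1) (ha : a < 0) (hb : 0 < b) (hd : d < 1) (hT : 0 < T₀)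
    {z₀ : Plane} (hz₀ : z₀.1 < 0) :
    ∀ᶠ q : ℕ × Plane in atTop ×ˢ 𝓝 z₀, q.2 ∈ chartDomain α T₀ q.1 ∧
      (chart α T₀ q.1 q.2).1 ∈ cylOff a b d := by
  have hE := tendsto_scale hα z₀
  have h1 := (hE.mul (tendsto_snd_comp (g := fun z => z.1) (by fun_prop) z₀)).const_add 1
  have h2 := hE.mul (tendsto_snd_comp (g := fun z => z.2.1) (by fun_prop) z₀)
  have h3 := tendsto_snd_comp (g := fun z => z.1) (by fun_prop) z₀
  rw [zero_mul, add_zero] at h1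
  rw [zero_mul] at h2
  have h4 := (tendsto_time T₀ z₀).mono_right nhdsWithin_le_nhds
  filter_upwards [h1.eventually_const_lt one_pos, h1.eventually_const_lt hd,
    h2.eventually_const_lt ha, h2.eventually_lt_const hb, h3.eventually_lt_const hz₀,
    h4.eventually_const_lt hT] with q g1 g2 g3 g4 g5 g6
  have hq : q.2 ∈ chartDomain α T₀ q.1 := ⟨g5, g1, g6⟩
  refine ⟨hq, ⟨⟨?_, by simpa [chart] using g3, by simpa [chart] using g4⟩, ?_⟩⟩
  · rw [chart, rad_merid g1.le]; exact radius_chart_lt hq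
  · rw [chart, rad_merid g1.le]; exact g2

/-- In self-similar variables the velocity is close to the profile. -/
theorem IsBoundaryASSS.exists_estimate (hS : IsBoundaryASSS α a b d T₀ v V W) :
    ∃ G : ℝ → ℝ, Tendsto G (𝓝[<] T₀) (𝓝 0) ∧ ∀ (m : ℝ) (z : Plane) (i : Fin 3),
      z ∈ chartDomain α T₀ m → (chart α T₀ m z).1 ∈ cylOff a b d →
      |selfVel α T₀ m v i z - V !₂[z.1, z.2.1] i| ≤ G (T₀ - Real.exp (-(z.2.2 + m))) := by
  obtain ⟨-, ⟨C, hC⟩, g, hg, hform⟩ := hS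
  refine ⟨fun t => |g t| * C, by simpa using hg.abs.mul_const C, fun m z i hz hx => ?_⟩
  have ht := time_chart_mem hz
  set s := z.2.2 + m with hs
  have hρ := hz.2.1
  have hE : 0 < scale α m z := scale_pos α m z
  have e1 : T₀ - (T₀ - Real.exp (-s)) = Real.exp (-s) := by ring
  have e2 : Real.exp (-s) ^ (1 - α) = scale α m z := by
    rw [← Real.exp_mul, scale, ← hs]; congr 1; ring
  have e3 : Real.exp (-s) ^ α = Real.exp (-α * s) := by
    rw [← Real.exp_mul]; congr 1; ring
  have hrad : rad (chart α T₀ m z).1 = 1 + scale α m z * z.1 := rad_merid hρ.le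
  have h := hform _ hx _ (Ioo_subset_Ico_self ht) !₂[z.1, z.2.1] (by
    rw [e1, e2, hrad]
    ext j
    fin_cases j
    · simp; field_simp
    · simp [chart]; field_simp)
  rw [e1, e3] at h
  have hexp : Real.exp (-α * s) ≠ 0 := (Real.exp_pos _).ne'
  have hi : v (chart α T₀ m z).1 (T₀ - Real.exp (-s)) i
      = 1 / Real.exp (-α * s) * V !₂[z.1, z.2.1] i
        + g (T₀ - Real.exp (-s)) / Real.exp (-α * s)
          * W (chart α T₀ m z).1 (T₀ - Real.exp (-s)) i := by
    rw [h]
    have hr : eR (chart α T₀ m z).1 = ax 0 := by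
      ext j; fin_cases j <;> simp [eR, chart, rad_merid hρ.le, hρ.ne']
    have hθ : eTheta (chart α T₀ m z).1 = ax 1 := by
      ext j; fin_cases j <;> simp [eTheta, chart, rad_merid hρ.le, hρ.ne']
    have hz : eZ = ax 2 := by ext j; fin_cases j <;> simp [eZ]
    rw [hr, hθ, hz]
    fin_cases i <;> simp
  have he : selfVel α T₀ m v i z - V !₂[z.1, z.2.1] i
      = g (T₀ - Real.exp (-s)) * W (chart α T₀ m z).1 (T₀ - Real.exp (-s)) i := by
    have : selfVel α T₀ m v i z
        = Real.exp (-α * s) * v (chart α T₀ m z).1 (T₀ - Real.exp (-s)) i := rfl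
    rw [this, hi]; field_simp; ring
  rw [he, abs_mul]
  exact mul_le_mul_of_nonneg_left ((abs_apply_le_norm _ i).trans
    (hC _ hx _ (Ioo_subset_Ico_self ht))) (abs_nonneg _)

theorem isOpen_negHalf : IsOpen {z : Plane | z.1 < 0} := isOpen_lt continuous_fst continuous_const

theorem continuous_planeVec : Continuous fun z : Plane => (!₂[z.1, z.2.1] : E2) := by
  refine (PiLp.continuous_toLp 2 _).comp (continuous_pi fun i => ?_)
  fin_cases i <;> simp <;> fun_prop

theorem halfPlane_mem_nhds {y : E2} (hy : y 0 < 0) : halfPlane ∈ 𝓝 y := by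
  have h : IsOpen {y : E2 | y 0 < 0} :=
    isOpen_lt (by fun_prop : Continuous fun y : E2 => y 0) continuous_const
  exact mem_of_superset (h.mem_nhds hy) fun y hy => (show y 0 < 0 from hy).le

/-- The velocity in self-similar variables converges continuously to the profile. -/
theorem tendsto_selfVel (hα : α < 1) (ha : a < 0) (hb : 0 < b) (hd : d < 1) (hT : 0 < T₀)
    (hS : IsBoundaryASSS α a b d T₀ v V W) (hV : ContinuousOn V halfPlane) (i : Fin 3)
    {z₀ : Plane} (hz₀ : z₀.1 < 0) :
    Tendsto (fun q : ℕ × Plane => selfVel α T₀ q.1 v i q.2) (atTop ×ˢ 𝓝 z₀)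
      (𝓝 (V !₂[z₀.1, z₀.2.1] i)) := by
  obtain ⟨G, hG, hest⟩ := hS.exists_estimate
  have hGlim := hG.comp (tendsto_time T₀ z₀)
  have h1 : Tendsto (fun q : ℕ × Plane => selfVel α T₀ q.1 v i q.2 - V !₂[q.2.1, q.2.2.1] i)
      (atTop ×ˢ 𝓝 z₀) (𝓝 0) := by
    refine squeeze_zero_norm' ?_ hGlim
    filter_upwards [eventually_chart_mem hα ha hb hd hT hz₀] with q hq
    exact hest q.1 q.2 i hq.1 hq.2
  have h2 : Tendsto (fun q : ℕ × Plane => V !₂[q.2.1, q.2.2.1] i) (atTop ×ˢ 𝓝 z₀)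
      (𝓝 (V !₂[z₀.1, z₀.2.1] i)) := by
    have hc : ContinuousAt V !₂[z₀.1, z₀.2.1] :=
      hV.continuousAt (halfPlane_mem_nhds (by simpa using hz₀))
    have h3 : Tendsto (fun z : Plane => V !₂[z.1, z.2.1]) (𝓝 z₀) (𝓝 (V !₂[z₀.1, z₀.2.1])) :=
      hc.tendsto.comp (continuous_planeVec.tendsto z₀)
    exact (((by fun_prop : Continuous fun x : E3 => x i).tendsto _).comp h3).comp tendsto_snd
  simpa using h1.add h2

/-- The angular component of the profile vanishes, because the swirl does not blow up. -/
theorem profile_angular_eq_zero (hα : α ∈ Ioo (0 : ℝ) 1) (ha : a < 0) (hb : 0 < b) (hd : d < 1)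
    (hT : 0 < T₀) (hsol : IsAxisymEulerSolution a b T₀ v p)
    (hS : IsBoundaryASSS α a b d T₀ v V W) (hV : ContinuousOn V halfPlane) {y : E2}
    (hy : y 0 < 0) : V y 1 = 0 := by
  obtain ⟨C, hC⟩ := exists_swirl_bound hsol (by linarith) hT
  set z₀ : Plane := (y 0, y 1, 0) with hz₀
  have hyz : (!₂[z₀.1, z₀.2.1] : E2) = y := by ext i; fin_cases i <;> simp [hz₀]
  have h1 := tendsto_selfVel hα.2 ha hb hd hT hS hV 1 (z₀ := z₀) hy
  rw [hyz] at h1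
  have h2 := (tendsto_snd_comp (g := fun z => z.1) (by fun_prop) z₀)
  have h3 : Tendsto (fun q : ℕ × Plane => 1 + scale α q.1 q.2 * q.2.1) (atTop ×ˢ 𝓝 z₀) (𝓝 1) := by
    simpa using ((tendsto_scale hα.2 z₀).mul h2).const_add 1
  have h4 : Tendsto (fun q : ℕ × Plane => Real.exp (-α * (q.2.2.2 + q.1)) * C) (atTop ×ˢ 𝓝 z₀)
      (𝓝 0) := by
    have := Real.tendsto_exp_atBot.comp
      ((tendsto_add_natCast z₀).const_mul_atTop_of_neg (show -α < 0 by linarith [hα.1]))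
    simpa using this.mul_const C
  have h5 : Tendsto (fun q : ℕ × Plane => (1 + scale α q.1 q.2 * q.2.1)
      * selfVel α T₀ q.1 v 1 q.2) (atTop ×ˢ 𝓝 z₀) (𝓝 0) := by
    refine squeeze_zero_norm' ?_ h4
    filter_upwards [eventually_chart_mem hα.2 ha hb hd hT (z₀ := z₀) hy] with q hq
    have hx := chart_mem hq.1
    have h6 := hC _ (pipe_subset_closedPipe hx.1) _ (Ioo_subset_Ico_self hx.2)
    have h7 : (1 + scale α q.1 q.2 * q.2.1) * selfVel α T₀ q.1 v 1 q.2
        = Real.exp (-α * (q.2.2.2 + q.1)) *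
          swirl v ((chart α T₀ q.1 q.2).1, (chart α T₀ q.1 q.2).2) := by
      simp only [selfVel, selfSim, swirl]
      simp only [chart, merid_zero, merid_one]
      ring
    rw [h7, norm_mul, Real.norm_of_nonneg (Real.exp_pos _).le]
    gcongr
    exact h6
  have := tendsto_nhds_unique (h3.mul h1) h5
  simpa using this

/-- The estimate by the profile at a boundary point, where the radial velocity vanishes. -/
theorem abs_profile_radial_le (hd : d < 1)
    (hsol : IsAxisymEulerSolution a b T₀ v p) (hV : ContinuousOn V halfPlane) {y : E2}
    (hy : y 0 = 0) {m M : ℝ}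
    (hest : ∀ z : Plane, z ∈ chartDomain α T₀ m → (chart α T₀ m z).1 ∈ cylOff a b d → z.2.2 = 0 →
      |selfVel α T₀ m v 0 z - V !₂[z.1, z.2.1] 0| ≤ M)
    (h1 : a < Real.exp (-(1 - α) * (0 + m)) * y 1) (h2 : Real.exp (-(1 - α) * (0 + m)) * y 1 < b)
    (h3 : 0 < T₀ - Real.exp (-(0 + m))) : |V y 0| ≤ M := by
  obtain ⟨t, ht_def⟩ : ∃ t, t = T₀ - Real.exp (-(0 + m)) := ⟨_, rfl⟩
  have ht : t ∈ Ico 0 T₀ := by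
    rw [ht_def]; exact ⟨h3.le, by linarith [Real.exp_pos (-(0 + m))]⟩
  obtain ⟨ε, hε⟩ : ∃ ε, ε = Real.exp (-(1 - α) * (0 + m)) := ⟨_, rfl⟩
  have hε0 : 0 < ε := hε ▸ Real.exp_pos _
  rw [← hε] at h1 h2
  have hscale : ∀ r : ℝ, scale α m (r, y 1, 0) = ε := fun r => hε.symm
  have hcontx : Continuous fun r : ℝ => merid (1 + ε * r) (ε * y 1) := by
    unfold merid; fun_prop
  have hxlim : Tendsto (fun r : ℝ => 1 + ε * r) (𝓝[<] 0) (𝓝 1) := by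
    have : Continuous fun r : ℝ => 1 + ε * r := by fun_prop
    simpa using (this.tendsto 0).mono_left nhdsWithin_le_nhds
  have hneg : ∀ᶠ r in 𝓝[<] (0 : ℝ), r < 0 := self_mem_nhdsWithin
  have hm0 : merid (1 + ε * 0) (ε * y 1) ∈ closedPipe := by
    rw [mem_closedPipe, rad_merid (by simp)]; simp
  have hvlim : Tendsto (fun r : ℝ => v (merid (1 + ε * r) (ε * y 1)) t 0) (𝓝[<] 0) (𝓝 0) := by
    have hc : ContinuousOn (fun x => v x t 0) closedPipe :=
      (contDiffOn_euclidean.1 hsol.smooth_velocity 0).continuousOn.comp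
        (f := fun x : E3 => (x, t)) (by fun_prop) fun x hx => ⟨hx, ht⟩
    have hz : v (merid (1 + ε * 0) (ε * y 1)) t 0 = 0 := by
      have := hsol.no_penetration (merid (1 + ε * 0) (ε * y 1)) (by rw [rad_merid] <;> simp) _ ht
      simpa using this
    have h4 : Tendsto (fun r : ℝ => merid (1 + ε * r) (ε * y 1)) (𝓝[<] 0)
        (𝓝[closedPipe] (merid (1 + ε * 0) (ε * y 1))) := by
      refine tendsto_nhdsWithin_iff.2 ⟨(hcontx.tendsto 0).mono_left nhdsWithin_le_nhds, ?_⟩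
      filter_upwards [hneg, hxlim.eventually_const_lt one_pos] with r hr hr'
      rw [mem_closedPipe, rad_merid hr'.le]
      nlinarith
    have h5 := (hc _ hm0).tendsto.comp h4
    rw [hz] at h5
    exact h5
  have hVlim : Tendsto (fun r : ℝ => V !₂[r, y 1] 0) (𝓝[<] 0) (𝓝 (V y 0)) := by
    have h4 : Tendsto (fun r : ℝ => (!₂[r, y 1] : E2)) (𝓝[<] 0) (𝓝[halfPlane] y) := by
      refine tendsto_nhdsWithin_iff.2 ⟨?_, ?_⟩
      · have h6 : Continuous fun r : ℝ => (!₂[r, y 1] : E2) :=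
          continuous_planeVec.comp (f := fun r : ℝ => (r, y 1, (0 : ℝ))) (by fun_prop)
        have h7 : (!₂[(0 : ℝ), y 1] : E2) = y := by
          ext i; fin_cases i <;> simp [hy]
        simpa [h7] using (h6.tendsto 0).mono_left nhdsWithin_le_nhds
      · filter_upwards [hneg] with r hr
        simpa [halfPlane] using hr.le
    have h8 := (hV y (by simp [halfPlane, hy])).tendsto.comp h4
    exact ((by fun_prop : Continuous fun x : E3 => x 0).tendsto _).comp h8
  have hlim := ((hvlim.const_mul (Real.exp (-α * (0 + m)))).sub hVlim).abs
  simp only [mul_zero, zero_sub, abs_neg] at hlim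
  refine le_of_tendsto hlim ?_
  filter_upwards [hneg, hxlim.eventually_const_lt one_pos, hxlim.eventually_const_lt hd]
    with r hr hr' hr''
  have hdom : (r, y 1, (0 : ℝ)) ∈ chartDomain α T₀ m := by
    refine ⟨hr, ?_, h3⟩
    rw [hscale]; exact hr'
  have hchart : chart α T₀ m (r, y 1, 0) = (merid (1 + ε * r) (ε * y 1), t) := by
    simp only [chart, hscale, ht_def]
  have hsv : selfVel α T₀ m v 0 (r, y 1, 0)
      = Real.exp (-α * (0 + m)) * v (merid (1 + ε * r) (ε * y 1)) t 0 := by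
    simp only [selfVel, selfSim, hchart]
  rw [← hsv]
  refine hest (r, y 1, 0) hdom ?_ rfl
  rw [hchart]
  refine ⟨⟨?_, by simpa using h1, by simpa using h2⟩, ?_⟩
  · rw [rad_merid hr'.le]; nlinarith
  · rw [rad_merid hr'.le]; exact hr''

/-- The radial component of the profile vanishes on the boundary. -/
theorem profile_radial_boundary (hα : α < 1) (ha : a < 0) (hb : 0 < b) (hd : d < 1)
    (hT : 0 < T₀) (hsol : IsAxisymEulerSolution a b T₀ v p)
    (hS : IsBoundaryASSS α a b d T₀ v V W) (hV : ContinuousOn V halfPlane) {y : E2}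
    (hy : y 0 = 0) : V y 0 = 0 := by
  obtain ⟨G, hG, hest⟩ := hS.exists_estimate
  have hm : Tendsto (fun m : ℝ => 0 + m) atTop atTop := by
    simp only [zero_add]; exact tendsto_id
  have hE : Tendsto (fun m : ℝ => Real.exp (-(1 - α) * (0 + m)) * y 1) atTop (𝓝 0) := by
    have := Real.tendsto_exp_atBot.comp
      (hm.const_mul_atTop_of_neg (show -(1 - α) < 0 by linarith))
    simpa using this.mul_const (y 1)
  have hTlim : Tendsto (fun m : ℝ => T₀ - Real.exp (-(0 + m))) atTop (𝓝[<] T₀) := by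
    refine tendsto_nhdsWithin_iff.2 ⟨?_, Eventually.of_forall fun m => ?_⟩
    · simpa using (Real.tendsto_exp_neg_atTop_nhds_zero.comp hm).const_sub T₀
    · exact mem_Iio.2 (by linarith [Real.exp_pos (-(0 + m))])
  have hbound : ∀ᶠ m : ℝ in atTop, |V y 0| ≤ G (T₀ - Real.exp (-(0 + m))) := by
    filter_upwards [hE.eventually_const_lt ha, hE.eventually_lt_const hb,
      (hTlim.mono_right nhdsWithin_le_nhds).eventually_const_lt hT] with m h1 h2 h3
    refine abs_profile_radial_le hd hsol hV hy (fun z hz hz' hz0 => ?_) h1 h2 h3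
    have := hest m z 0 hz hz'
    rwa [hz0] at this
  exact abs_nonpos_iff.1 (ge_of_tendsto (hG.comp hTlim) hbound)

theorem contDiffOn_planeProfile (hV : ContDiffOn ℝ 2 V halfPlane) (i : Fin 3) :
    ContDiffOn ℝ 2 (fun z : Plane => V !₂[z.1, z.2.1] i) {z : Plane | z.1 < 0} := by
  have h1 : ContDiff ℝ 2 fun z : Plane => (!₂[z.1, z.2.1] : E2) := by
    rw [contDiff_euclidean]
    intro j
    fin_cases j <;> simp <;> fun_prop
  have h2 : ContDiffOn ℝ 2 (fun z : Plane => V !₂[z.1, z.2.1]) {z : Plane | z.1 < 0} :=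
    hV.comp h1.contDiffOn fun z hz => by simpa [halfPlane] using (show z.1 < 0 from hz).le
  exact contDiffOn_euclidean.1 h2 i

/-- The profile solves the planar Euler equations in self-similar variables. -/
theorem profile_equations (hα : α ∈ Ioo (0 : ℝ) 1) (ha : a < 0) (hb : 0 < b) (hd : d < 1)
    (hT : 0 < T₀) (hsol : IsAxisymEulerSolution a b T₀ v p)
    (hS : IsBoundaryASSS α a b d T₀ v V W) (hV : ContDiffOn ℝ 2 V halfPlane)
    {U₀ U₂ : Plane → ℝ} (hU₀ : U₀ = fun z => V !₂[z.1, z.2.1] 0)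
    (hU₂ : U₂ = fun z => V !₂[z.1, z.2.1] 2) :
    ∀ z : Plane, z.1 < 0 → d₁ U₀ z + d₂ U₂ z = 0 ∧
      dMat (selfField₁ α U₀) (selfField₂ α U₂) (fun z => d₁ U₂ z - d₂ U₀ z) z
        + (d₁ U₂ z - d₂ U₀ z) = 0 := by
  have hC₀ : ContDiffOn ℝ 2 U₀ {z : Plane | z.1 < 0} := hU₀ ▸ contDiffOn_planeProfile hV 0
  have hC₂ : ContDiffOn ℝ 2 U₂ {z : Plane | z.1 < 0} := hU₂ ▸ contDiffOn_planeProfile hV 2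
  have hlim : ∀ i, ∀ z ∈ {z : Plane | z.1 < 0},
      Tendsto (fun q : ℕ × Plane => selfVel α T₀ q.1 v i q.2) (atTop ×ˢ 𝓝 z)
        (𝓝 (V !₂[z.1, z.2.1] i)) := fun i z hz =>
    tendsto_selfVel hα.2 ha hb hd hT hS hV.continuousOn i hz
  have hκlim : ∀ z ∈ {z : Plane | z.1 < 0},
      Tendsto (fun q : ℕ × Plane => selfCurv α q.1 q.2) (atTop ×ˢ 𝓝 z) (𝓝 0) := fun z _ => by
    have hE := tendsto_scale hα.2 z
    have h1 := (hE.mul (tendsto_snd_comp (g := fun z => z.1) (by fun_prop) z)).const_add 1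
    rw [zero_mul, add_zero] at h1
    have := hE.div h1 one_ne_zero
    rw [zero_div] at this
    exact this
  have h := limit_equations isOpen_negHalf (α := α)
    (u := fun n => selfVel α T₀ n v 0) (w := fun n => selfVel α T₀ n v 2)
    (P := fun n => selfPres α T₀ n p) (κ := fun n => selfCurv α n)
    (f := fun n => selfForce α T₀ n v) (O := fun n => chartDomain α T₀ n)
    (fun n => isOpen_chartDomain α T₀ n) (fun K hK hKc => ?_)
    (fun n => contDiffOn_selfVel hsol 0) (fun n => contDiffOn_selfVel hsol 2)
    (fun n => contDiffOn_selfSim hsol.smooth_pressure) (fun n => continuousOn_selfCurv)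
    (fun n => continuousOn_selfCurv.mul ((contDiffOn_selfVel hsol 1).continuousOn.pow 2))
    (fun n z hz => selfVel_divergence hsol hz) (fun n z hz => selfVel_radial hsol hz)
    (fun n z hz => selfVel_vertical hsol hz) hC₀ hC₂
    (fun z hz => by rw [hU₀]; exact hlim 0 z hz) (fun z hz => by rw [hU₂]; exact hlim 2 z hz)
    hκlim (fun z hz => by
      have := (hκlim z hz).mul ((hlim 1 z hz).pow 2)
      rw [zero_mul] at this
      exact this)
  · exact fun z hz => ⟨h.1 z hz,
      vorticity_of_limit_equations isOpen_negHalf hC₀ hC₂ hz (h.1 z hz) (h.2 z hz)⟩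
  · refine hKc.induction_on (p := fun S => ∀ᶠ n : ℕ in atTop, S ⊆ chartDomain α T₀ n)
      (by simp) (fun s t hst ht => ht.mono fun n hn => hst.trans hn)
      (fun s t hs ht => (hs.and ht).mono fun n hn => union_subset hn.1 hn.2) fun z hz => ?_
    obtain ⟨A, hA, B, hB, hAB⟩ := eventually_prod_iff.1
      (eventually_chart_mem hα.2 ha hb hd hT (hK hz))
    exact ⟨{z | B z}, mem_nhdsWithin_of_mem_nhds hB, hA.mono fun n hn w hw => (hAB hn hw).1⟩

end Convergence

/-! ### A Liouville theorem on the half plane -/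

theorem convex_halfPlane : Convex ℝ halfPlane := by
  intro x hx y hy s t hs ht _
  have hx' : x 0 ≤ 0 := hx
  have hy' : y 0 ≤ 0 := hy
  change (s • x + t • y) 0 ≤ 0
  simp only [PiLp.add_apply, PiLp.smul_apply, smul_eq_mul]
  nlinarith

theorem isClosed_halfPlane : IsClosed halfPlane :=
  isClosed_le (by fun_prop : Continuous fun y : E2 => y 0) continuous_const

theorem isOpen_openHalf : IsOpen {y : E2 | y 0 < 0} :=
  isOpen_lt (by fun_prop : Continuous fun y : E2 => y 0) continuous_const

theorem uniqueDiffOn_halfPlane : UniqueDiffOn ℝ halfPlane :=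
  uniqueDiffOn_convex convex_halfPlane
    ⟨!₂[-1, 0], mem_interior_iff_mem_nhds.2 (halfPlane_mem_nhds (by simp))⟩

theorem openHalf_subset : {y : E2 | y 0 < 0} ⊆ halfPlane := fun y hy =>
  (show y 0 < 0 from hy).le

theorem halfPlane_subset_closure : halfPlane ⊆ closure {y : E2 | y 0 < 0} := by
  intro y hy
  have h : Tendsto (fun s : ℝ => y + s • (!₂[1, 0] : E2)) (𝓝[<] 0) (𝓝 y) := by
    have : Continuous fun s : ℝ => y + s • (!₂[1, 0] : E2) := by fun_prop
    simpa using (this.tendsto 0).mono_left nhdsWithin_le_nhds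
  refine mem_closure_of_tendsto h ?_
  filter_upwards [self_mem_nhdsWithin] with s hs
  have hy' : y 0 ≤ 0 := hy
  have hs' : s < 0 := hs
  change (y + s • (!₂[1, 0] : E2)) 0 < 0
  simp; linarith

/-- The first unit vector of the plane. -/
noncomputable abbrev bx : E2 := EuclideanSpace.single 0 1

/-- The second unit vector of the plane. -/
noncomputable abbrev bz : E2 := EuclideanSpace.single 1 1

/-- The projection of planar space-time to the plane. -/
noncomputable def planeL : Plane →L[ℝ] E2 :=
  (ContinuousLinearMap.fst ℝ ℝ (ℝ × ℝ)).smulRight bx +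
    ((ContinuousLinearMap.fst ℝ ℝ ℝ).comp (ContinuousLinearMap.snd ℝ ℝ (ℝ × ℝ))).smulRight bz

theorem planeL_apply (z : Plane) : planeL z = !₂[z.1, z.2.1] := by
  ext i; fin_cases i <;> simp [planeL]

theorem hasFDerivAt_comp_planeL {F : Type*} [NormedAddCommGroup F] [NormedSpace ℝ F]
    {f : E2 → F} (hf : DifferentiableOn ℝ f halfPlane) {z : Plane} (hz : z.1 < 0) :
    HasFDerivAt (fun z : Plane => f !₂[z.1, z.2.1])
      ((fderivWithin ℝ f halfPlane !₂[z.1, z.2.1]).comp planeL) z := by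
  have hn : halfPlane ∈ 𝓝 (planeL z) := by
    rw [planeL_apply]; exact halfPlane_mem_nhds (by simpa using hz)
  have h := (hf (planeL z) (mem_of_mem_nhds hn)).hasFDerivWithinAt.hasFDerivAt hn
  have h2 := h.comp z planeL.hasFDerivAt
  rw [← planeL_apply]
  refine h2.congr_of_eventuallyEq (Eventually.of_forall fun w => ?_)
  simp [planeL_apply]

section Liouville

variable {α : ℝ} {V : E2 → E3}

/-- The derivative of the profile, up to the boundary. -/
noncomputable abbrev gradV (V : E2 → E3) (y : E2) : E2 →L[ℝ] E3 := fderivWithin ℝ V halfPlane y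

/-- The vorticity of the planar part of the profile. -/
noncomputable def vort (V : E2 → E3) (y : E2) : ℝ := gradV V y bx 2 - gradV V y bz 0

/-- The transport field of the self-similar vorticity equation. -/
noncomputable def transportField (α : ℝ) (V : E2 → E3) (y : E2) : E2 :=
  ((1 - α) * y 0 + V y 0) • bx + ((1 - α) * y 1 + V y 2) • bz

theorem contDiffOn_vort (hV : ContDiffOn ℝ 2 V halfPlane) :
    ContDiffOn ℝ 1 (vort V) halfPlane := by
  have h := hV.fderivWithin uniqueDiffOn_halfPlane (m := 1) (by norm_num)
  have h1 : ∀ (e : E2) (i : Fin 3), ContDiffOn ℝ 1 (fun y => gradV V y e i) halfPlane := fun e i =>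
    contDiffOn_euclidean.1 (h.clm_apply contDiffOn_const) i
  exact (h1 bx 2).sub (h1 bz 0)

theorem fderiv_planeProfile (hV : DifferentiableOn ℝ V halfPlane) (i : Fin 3) {z : Plane}
    (hz : z.1 < 0) (e : Plane) :
    fderiv ℝ (fun z : Plane => V !₂[z.1, z.2.1] i) z e
      = gradV V !₂[z.1, z.2.1] (planeL e) i := by
  rw [(hasFDerivAt_apply (hasFDerivAt_comp_planeL hV hz) i).fderiv]
  simp

theorem planeL_e₁ : planeL (1, 0, 0) = bx := by ext i; fin_cases i <;> simp [planeL]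
theorem planeL_e₂ : planeL (0, 1, 0) = bz := by ext i; fin_cases i <;> simp [planeL]
theorem planeL_e₃ : planeL (0, 0, 1) = 0 := by ext i; fin_cases i <;> simp [planeL]

/-- The equations for the profile, written with derivatives in the plane: it is free of divergence,
and its vorticity is transported and damped, up to the boundary. -/
theorem profile_transport (hV : ContDiffOn ℝ 2 V halfPlane)
    (heq : ∀ U₀ U₂ : Plane → ℝ, (U₀ = fun z => V !₂[z.1, z.2.1] 0) →
      (U₂ = fun z => V !₂[z.1, z.2.1] 2) → ∀ z : Plane, z.1 < 0 → d₁ U₀ z + d₂ U₂ z = 0 ∧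
      dMat (selfField₁ α U₀) (selfField₂ α U₂) (fun z => d₁ U₂ z - d₂ U₀ z) z
        + (d₁ U₂ z - d₂ U₀ z) = 0) :
    (∀ y : E2, y 0 < 0 → gradV V y bx 0 + gradV V y bz 2 = 0) ∧
    ∀ y ∈ halfPlane, fderivWithin ℝ (vort V) halfPlane y (transportField α V y) + vort V y = 0 := by
  have hVd : DifferentiableOn ℝ V halfPlane := hV.differentiableOn (by norm_num)
  have hω := contDiffOn_vort hV
  have hωd : DifferentiableOn ℝ (vort V) halfPlane := hω.differentiableOn one_ne_zero
  have hd1 : ∀ (i : Fin 3) (z : Plane), z.1 < 0 →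
      d₁ (fun z => V !₂[z.1, z.2.1] i) z = gradV V !₂[z.1, z.2.1] bx i := fun i z hz => by
    rw [d₁, fderiv_planeProfile hVd i hz, planeL_e₁]
  have hd2 : ∀ (i : Fin 3) (z : Plane), z.1 < 0 →
      d₂ (fun z => V !₂[z.1, z.2.1] i) z = gradV V !₂[z.1, z.2.1] bz i := fun i z hz => by
    rw [d₂, fderiv_planeProfile hVd i hz, planeL_e₂]
  have hvec : ∀ y : E2, (!₂[y 0, y 1] : E2) = y := fun y => by ext i; fin_cases i <;> simp
  refine ⟨fun y hy => ?_, ?_⟩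
  · have h := (heq _ _ rfl rfl (y 0, y 1, 0) hy).1
    rw [hd1 0 _ hy, hd2 2 _ hy] at h
    simpa [hvec] using h
  · have hVc := hV.continuousOn
    have hVi : ∀ i, ContinuousOn (fun y => V y i) halfPlane := fun i =>
      (contDiffOn_euclidean.1 hV i).continuousOn
    have hFc : ContinuousOn (transportField α V) halfPlane := by
      unfold transportField
      have h0 := hVi 0
      have h2 := hVi 2
      fun_prop
    have hcont : ContinuousOn (fun y => fderivWithin ℝ (vort V) halfPlane y (transportField α V y)
        + vort V y) halfPlane :=
      ((hω.continuousOn_fderivWithin uniqueDiffOn_halfPlane le_rfl).clm_apply hFc).add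
        hω.continuousOn
    have hint : EqOn (fun y => fderivWithin ℝ (vort V) halfPlane y (transportField α V y)
        + vort V y) (fun _ => 0) {y : E2 | y 0 < 0} := by
      intro y hy
      set z : Plane := (y 0, y 1, 0) with hz
      have hz0 : z.1 < 0 := hy
      have h := (heq _ _ rfl rfl z hz0).2
      have he : (fun z : Plane => d₁ (fun z => V !₂[z.1, z.2.1] 2) z
          - d₂ (fun z => V !₂[z.1, z.2.1] 0) z) =ᶠ[𝓝 z] fun z => vort V !₂[z.1, z.2.1] := by
        filter_upwards [isOpen_negHalf.mem_nhds hz0] with w hw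
        rw [hd1 2 w hw, hd2 0 w hw, vort]
      have hfd := (hasFDerivAt_comp_planeL hωd hz0).congr_of_eventuallyEq he
      have hvz : (!₂[z.1, z.2.1] : E2) = y := hvec y
      rw [dMat, dₜ, d₁, d₂, hfd.fderiv] at h
      simp only [ContinuousLinearMap.comp_apply, planeL_e₁, planeL_e₂, planeL_e₃, map_zero,
        zero_add, hd1 2 z hz0, hd2 0 z hz0, hvz] at h
      simp only [transportField, map_add, map_smul, smul_eq_mul]
      simp only [selfField₁, selfField₂, hvz] at h
      rw [vort]
      exact h
    intro y hy
    exact hint.of_subset_closure hcont continuousOn_const openHalf_subset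
      halfPlane_subset_closure hy

/-- A bounded vorticity vanishes: at a maximum of its square with a slowly decaying weight, the
damping dominates the transport of the weight. -/
theorem vort_eq_zero (hV : ContDiffOn ℝ 2 V halfPlane)
    {C : ℝ} (hC : ∀ y ∈ halfPlane, ‖gradV V y‖ ≤ C)
    (hbd : ∀ y : E2, y 0 = 0 → V y 0 = 0)
    (htr : ∀ y ∈ halfPlane,
      fderivWithin ℝ (vort V) halfPlane y (transportField α V y) + vort V y = 0) :
    ∀ y ∈ halfPlane, vort V y = 0 := by
  have hC0 : 0 ≤ C := (norm_nonneg _).trans (hC 0 (by simp [halfPlane]))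
  have hω := contDiffOn_vort hV
  have hωd : DifferentiableOn ℝ (vort V) halfPlane := hω.differentiableOn one_ne_zero
  have hωb : ∀ y ∈ halfPlane, |vort V y| ≤ 2 * C := by
    intro y hy
    have h1 : ∀ (e : E2) (i : Fin 3), ‖e‖ = 1 → |gradV V y e i| ≤ C := fun e i he => by
      refine (abs_apply_le_norm _ i).trans (((gradV V y).le_opNorm e).trans ?_)
      rw [he, mul_one]; exact hC y hy
    have h2 := h1 bx 2 (by simp)
    have h3 := h1 bz 0 (by simp)
    have := abs_sub (gradV V y bx 2) (gradV V y bz 0)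
    rw [vort]; linarith
  have hVb : ∀ y ∈ halfPlane, ‖V y‖ ≤ ‖V 0‖ + C * ‖y‖ := by
    intro y hy
    have h1 := convex_halfPlane.norm_image_sub_le_of_norm_fderivWithin_le
      (hV.differentiableOn (by norm_num)) hC (show (0 : E2) ∈ halfPlane by simp [halfPlane]) hy
    have h2 := norm_sub_norm_le (V y) (V 0)
    rw [sub_zero] at h1
    linarith
  -- the growth of the transport field, which determines the decay of the weight
  set C₁ : ℝ := |1 - α| + 2 * ‖V 0‖ + 2 * C + 1 with hC₁
  have hC₁0 : 0 < C₁ := by positivity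
  set ε : ℝ := 1 / (2 * C₁) with hε
  have hε0 : 0 < ε := by positivity
  have hn2 : ∀ y : E2, ‖y‖ ^ 2 = y 0 ^ 2 + y 1 ^ 2 := fun y => by
    rw [EuclideanSpace.norm_sq_eq, Fin.sum_univ_two]; simp
  have hgrow : ∀ y ∈ halfPlane, |y 0 * ((1 - α) * y 0 + V y 0) + y 1 * ((1 - α) * y 1 + V y 2)|
      ≤ C₁ * (1 + (y 0 ^ 2 + y 1 ^ 2)) := by
    intro y hy
    have h0 : |y 0| ≤ ‖y‖ := PiLp.norm_apply_le y 0
    have h1 : |y 1| ≤ ‖y‖ := PiLp.norm_apply_le y 1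
    have h2 := abs_apply_le_norm (V y) 0
    have h3 := abs_apply_le_norm (V y) 2
    have h4 := hVb y hy
    have e1 : y 0 * ((1 - α) * y 0 + V y 0) + y 1 * ((1 - α) * y 1 + V y 2)
        = (1 - α) * ‖y‖ ^ 2 + (y 0 * V y 0 + y 1 * V y 2) := by rw [hn2]; ring
    rw [e1, ← hn2]
    have h5 : |y 0 * V y 0| ≤ ‖y‖ * ‖V y‖ := by rw [abs_mul]; gcongr
    have h6 : |y 1 * V y 2| ≤ ‖y‖ * ‖V y‖ := by rw [abs_mul]; gcongr
    have h7 : |(1 - α) * ‖y‖ ^ 2| = |1 - α| * ‖y‖ ^ 2 := by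
      rw [abs_mul, abs_of_nonneg (sq_nonneg ‖y‖)]
    have h8 : ‖y‖ * ‖V y‖ ≤ ‖y‖ * (‖V 0‖ + C * ‖y‖) := by gcongr
    have h9 : ‖y‖ ≤ 1 + ‖y‖ ^ 2 := by nlinarith [sq_nonneg (‖y‖ - 1)]
    have h10 := abs_add_le ((1 - α) * ‖y‖ ^ 2) (y 0 * V y 0 + y 1 * V y 2)
    have h11 := abs_add_le (y 0 * V y 0) (y 1 * V y 2)
    have h12 : ‖V 0‖ * ‖y‖ ≤ ‖V 0‖ * (1 + ‖y‖ ^ 2) := by gcongr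
    have h13 := abs_nonneg (1 - α)
    rw [hC₁]
    nlinarith [sq_nonneg ‖y‖]
  set g : E2 → ℝ := fun y => vort V y ^ 2 * Real.exp (-ε * Real.log (1 + (y 0 ^ 2 + y 1 ^ 2)))
    with hg
  have hnpos : ∀ y : E2, 0 < 1 + (y 0 ^ 2 + y 1 ^ 2) := fun y => by positivity
  have hgc : ContinuousOn g halfPlane := by
    have h1 : Continuous fun y : E2 => Real.exp (-ε * Real.log (1 + (y 0 ^ 2 + y 1 ^ 2))) := by
      refine Real.continuous_exp.comp (continuous_const.mul (Continuous.log (by fun_prop) ?_))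
      exact fun y => (hnpos y).ne'
    exact (hω.continuousOn.pow 2).mul h1.continuousOn
  have hglim : Tendsto g (Bornology.cobounded E2 ⊓ 𝓟 halfPlane) (𝓝 0) := by
    have h1 : Tendsto (fun y : E2 => (2 * C) ^ 2 *
        Real.exp (-ε * Real.log (1 + (y 0 ^ 2 + y 1 ^ 2)))) (Bornology.cobounded E2) (𝓝 0) := by
      have h2 : Tendsto (fun y : E2 => 1 + (y 0 ^ 2 + y 1 ^ 2)) (Bornology.cobounded E2) atTop := by
        have h3 : Tendsto (fun y : E2 => 1 + ‖y‖ ^ 2) (Bornology.cobounded E2) atTop :=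
          tendsto_atTop_add_const_left _ _
            ((tendsto_pow_atTop two_ne_zero).comp tendsto_norm_cobounded_atTop)
        simpa only [hn2] using h3
      have h4 := Real.tendsto_exp_atBot.comp ((Real.tendsto_log_atTop.comp h2).const_mul_atTop_of_neg
        (show -ε < 0 by linarith))
      simpa using h4.const_mul ((2 * C) ^ 2)
    refine squeeze_zero_norm' ?_ (h1.mono_left inf_le_left)
    filter_upwards [mem_inf_of_right (mem_principal_self _)] with y hy
    have h5 := hωb y hy
    rw [hg, norm_mul, Real.norm_of_nonneg (Real.exp_pos _).le, norm_pow, Real.norm_eq_abs]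
    gcongr
  by_contra hne
  push Not at hne
  obtain ⟨y₀, hy₀, hne⟩ := hne
  have hg0 : 0 < g y₀ := by
    have h1 := Real.exp_pos (-ε * Real.log (1 + (y₀ 0 ^ 2 + y₀ 1 ^ 2)))
    have h2 : 0 < vort V y₀ ^ 2 := by positivity
    exact mul_pos h2 h1
  obtain ⟨y, hy, hmax⟩ := hgc.exists_isMaxOn' isClosed_halfPlane hy₀ (by
    rw [← Metric.cobounded_eq_cocompact]
    exact hglim.eventually_le_const hg0)
  have hgy : 0 < g y := hg0.trans_le (hmax hy₀)
  -- the line in the direction of the transport field stays in the half plane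
  set F : E2 := transportField α V y with hF
  have hF0 : F 0 = (1 - α) * y 0 + V y 0 := by simp [hF, transportField]
  have hF1 : F 1 = (1 - α) * y 1 + V y 2 := by simp [hF, transportField]
  have hcl : Continuous fun s : ℝ => y + s • F := by fun_prop
  have hline : ∀ᶠ s in 𝓝 (0 : ℝ), y + s • F ∈ halfPlane := by
    rcases lt_or_eq_of_le (show y 0 ≤ 0 from hy) with h | h
    · have := hcl.continuousAt.eventually_mem (x := 0)
        (by simpa using halfPlane_mem_nhds h)
      exact this
    · refine Eventually.of_forall fun s => ?_
      have : F 0 = 0 := by rw [hF0, h, hbd y h]; ring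
      change (y + s • F) 0 ≤ 0
      simp [h, this]
  have hlined : HasDerivAt (fun s : ℝ => y + s • F) F 0 := by
    simpa using ((hasDerivAt_id (0 : ℝ)).smul_const F).const_add y
  have hωline : HasDerivAt (fun s : ℝ => vort V (y + s • F)) (-vort V y) 0 := by
    have h1 : HasFDerivWithinAt (vort V) (fderivWithin ℝ (vort V) halfPlane y) halfPlane
        ((fun s : ℝ => y + s • F) 0) := by
      simpa using (hωd y hy).hasFDerivWithinAt
    have h2 := h1.comp_hasDerivAt (0 : ℝ) hlined hline
    have h3 := htr y hy
    rw [← hF] at h3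
    rw [show -vort V y = fderivWithin ℝ (vort V) halfPlane y F by linarith]
    exact h2
  have hwline : HasDerivAt (fun s : ℝ => Real.exp (-ε * Real.log
      (1 + ((y + s • F) 0 ^ 2 + (y + s • F) 1 ^ 2))))
      (Real.exp (-ε * Real.log (1 + (y 0 ^ 2 + y 1 ^ 2))) *
        (-ε * ((2 * (y 0 * F 0 + y 1 * F 1)) / (1 + (y 0 ^ 2 + y 1 ^ 2))))) 0 := by
    have h1 : ∀ i : Fin 2, HasDerivAt (fun s : ℝ => (y + s • F) i) (F i) 0 := fun i => by
      have : HasDerivAt (fun s : ℝ => y i + s * F i) (F i) 0 := by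
        simpa using ((hasDerivAt_id (0 : ℝ)).mul_const (F i)).const_add (y i)
      simpa using this
    have h2 : HasDerivAt (fun s : ℝ => 1 + ((y + s • F) 0 ^ 2 + (y + s • F) 1 ^ 2))
        (2 * (y 0 * F 0 + y 1 * F 1)) 0 :=
      ((((h1 0).pow 2).add ((h1 1).pow 2)).const_add 1).congr_deriv (by simp; ring)
    have h3 := ((h2.log (hnpos _).ne').const_mul (-ε)).exp
    simpa using h3
  have hgline := (hωline.pow 2).mul hwline
  have hloc : IsLocalMax (fun s : ℝ => vort V (y + s • F) ^ 2 * Real.exp (-ε * Real.log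
      (1 + ((y + s • F) 0 ^ 2 + (y + s • F) 1 ^ 2)))) 0 := by
    filter_upwards [hline] with s hs
    have := hmax hs
    simpa [hg] using this
  have hzero := hloc.hasDerivAt_eq_zero hgline
  simp only [zero_smul, add_zero] at hzero
  set E := Real.exp (-ε * Real.log (1 + (y 0 ^ 2 + y 1 ^ 2))) with hE
  set N := 1 + (y 0 ^ 2 + y 1 ^ 2) with hN
  have hNpos : 0 < N := hnpos y
  have hfac : vort V y ^ 2 * E * (2 + 2 * ε * ((y 0 * F 0 + y 1 * F 1) / N)) = 0 := by
    have : 2 * (y 0 * F 0 + y 1 * F 1) / N = 2 * ((y 0 * F 0 + y 1 * F 1) / N) := by ring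
    rw [this] at hzero
    norm_num at hzero
    linear_combination -hzero
  have hgy' : vort V y ^ 2 * E ≠ 0 := hgy.ne'
  have hq : |(y 0 * F 0 + y 1 * F 1) / N| ≤ C₁ := by
    rw [abs_div, abs_of_pos hNpos, div_le_iff₀ hNpos, hF0, hF1]
    exact hgrow y hy
  have hq' := (abs_le.1 hq).1
  have hεC : ε * C₁ = 1 / 2 := by rw [hε]; field_simp
  have : 2 + 2 * ε * ((y 0 * F 0 + y 1 * F 1) / N) = 0 := (mul_eq_zero.1 hfac).resolve_left hgy'
  nlinarith

/-- The point of the half plane which corresponds to a point of the right complex half plane. -/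
noncomputable def reflPt : ℂ →L[ℝ] E2 :=
  -(Complex.reCLM.smulRight bx) + Complex.imCLM.smulRight bz

theorem reflPt_apply (z : ℂ) : reflPt z = !₂[-z.re, z.im] := by
  ext i; fin_cases i <;> simp [reflPt]

theorem norm_reflPt (z : ℂ) : ‖reflPt z‖ = ‖z‖ := by
  rw [← sq_eq_sq₀ (norm_nonneg _) (norm_nonneg _), reflPt_apply, EuclideanSpace.norm_sq_eq,
    Fin.sum_univ_two, Complex.sq_norm, Complex.normSq_apply]
  simp; ring

/-- The complex velocity of the profile on the right half plane. -/
noncomputable def cvel (V : E2 → E3) (z : ℂ) : ℂ :=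
  (V (reflPt z) 0 : ℂ) + (V (reflPt z) 2 : ℂ) * Complex.I

theorem reflPt_mem {z : ℂ} (hz : 0 ≤ z.re) : reflPt z ∈ halfPlane := by
  rw [reflPt_apply]; simpa [halfPlane] using hz

/-- The Cauchy–Riemann equations for the complex velocity are the two first order equations for the
profile: no divergence and no vorticity. The reflection of the first coordinate makes the complex
velocity, and not its conjugate, holomorphic. -/
theorem differentiableAt_cvel (hV : ContDiffOn ℝ 2 V halfPlane)
    (hdiv : ∀ y : E2, y 0 < 0 → gradV V y bx 0 + gradV V y bz 2 = 0)
    (hω : ∀ y ∈ halfPlane, vort V y = 0) {z : ℂ} (hz : 0 < z.re) :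
    DifferentiableAt ℂ (cvel V) z := by
  have hy : reflPt z 0 < 0 := by rw [reflPt_apply]; simpa using hz
  have hd : HasFDerivAt V (gradV V (reflPt z)) (reflPt z) :=
    (hV.differentiableOn (by norm_num) _ (reflPt_mem hz.le)).hasFDerivWithinAt.hasFDerivAt
      (halfPlane_mem_nhds hy)
  have hc := hd.comp z reflPt.hasFDerivAt
  have hi := fun i => Complex.ofRealCLM.hasFDerivAt.comp z (hasFDerivAt_apply hc i)
  have hf : HasFDerivAt (cvel V) _ z := (hi 0).add ((hi 2).mul_const Complex.I)
  rw [differentiableAt_complex_iff_differentiableAt_real]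
  refine ⟨hf.differentiableAt, ?_⟩
  have e1 : reflPt 1 = -bx := by ext i; fin_cases i <;> simp [reflPt]
  have e2 : reflPt Complex.I = bz := by ext i; fin_cases i <;> simp [reflPt]
  have h1 := hdiv _ hy
  have h2 := hω _ (reflPt_mem hz.le)
  rw [vort] at h2
  have h3 : gradV V (reflPt z) bz 2 = -gradV V (reflPt z) bx 0 := by linarith
  have h4 : gradV V (reflPt z) bx 2 = gradV V (reflPt z) bz 0 := by linarith
  rw [hf.fderiv]
  simp only [add_apply, smul_apply, ContinuousLinearMap.comp_apply, e1, e2, map_neg,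
    PiLp.proj_apply, Complex.ofRealCLM_apply, smul_eq_mul]
  simp only [h3, h4]
  push_cast
  linear_combination ((gradV V (reflPt z) bz 0 : ℝ) : ℂ) * Complex.I_sq

theorem cvel_re (z : ℂ) : (cvel V z).re = V (reflPt z) 0 := by simp [cvel]

/-- A harmonic function on the half plane which vanishes on the boundary and has sublinear growth
vanishes: here both signs `σ` of the radial component of the profile, the real
part of the complex velocity `c`, are bounded by zero. The Phragmén–Lindelöf principle is applied to
`exp (σ c(z) - δ z)`, which tends to zero on the positive real axis by the sublinear growth. -/
theorem profile_radial_nonpos {σ : ℝ} (hσ : |σ| = 1) (hV : ContDiffOn ℝ 2 V halfPlane)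
    (hlin : Tendsto (fun y => ‖V y‖ / ‖y‖) (Bornology.cobounded E2 ⊓ 𝓟 halfPlane) (𝓝 0))
    (hbd : ∀ y : E2, y 0 = 0 → V y 0 = 0)
    (hdiv : ∀ y : E2, y 0 < 0 → gradV V y bx 0 + gradV V y bz 2 = 0)
    (hω : ∀ y ∈ halfPlane, vort V y = 0) {z : ℂ} (hz : 0 ≤ z.re) :
    σ * V (reflPt z) 0 ≤ 0 := by
  have hVc : ContinuousOn (fun z => V (reflPt z)) {z : ℂ | 0 ≤ z.re} :=
    hV.continuousOn.comp reflPt.continuous.continuousOn fun z hz => reflPt_mem hz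
  have hcc : ContinuousOn (cvel V) {z : ℂ | 0 ≤ z.re} := by
    have h : ∀ i : Fin 3, ContinuousOn (fun z => ((V (reflPt z) i : ℝ) : ℂ)) {z : ℂ | 0 ≤ z.re} :=
      fun i => Complex.continuous_ofReal.comp_continuousOn
        ((by fun_prop : Continuous fun x : E3 => x i).comp_continuousOn hVc)
    exact (h 0).add ((h 2).mul continuousOn_const)
  have hsmall : ∀ δ > 0, ∀ᶠ z in Bornology.cobounded ℂ ⊓ 𝓟 {z : ℂ | 0 ≤ z.re},
      ‖V (reflPt z)‖ ≤ δ * ‖z‖ := by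
    intro δ hδ
    have h1 : Tendsto reflPt (Bornology.cobounded ℂ ⊓ 𝓟 {z : ℂ | 0 ≤ z.re})
        (Bornology.cobounded E2 ⊓ 𝓟 halfPlane) := by
      refine tendsto_inf.2 ⟨?_, ?_⟩
      · refine Tendsto.mono_left ?_ inf_le_left
        rw [← tendsto_norm_atTop_iff_cobounded]
        simpa only [norm_reflPt] using tendsto_norm_cobounded_atTop
      · refine tendsto_principal.2 ?_
        filter_upwards [mem_inf_of_right (mem_principal_self _)] with z hz
        exact reflPt_mem hz
    have hpos : ∀ᶠ z : ℂ in Bornology.cobounded ℂ ⊓ 𝓟 {z : ℂ | 0 ≤ z.re}, 0 < ‖z‖ :=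
      (tendsto_norm_cobounded_atTop.mono_left inf_le_left).eventually_gt_atTop 0
    filter_upwards [(hlin.comp h1).eventually_le_const hδ, hpos] with z h2 h3
    simp only [Function.comp_apply, norm_reflPt] at h2
    rwa [div_le_iff₀ h3] at h2
  suffices h : ∀ δ > 0, σ * V (reflPt z) 0 ≤ δ * z.re by
    have h1 : Tendsto (fun δ : ℝ => δ * z.re) (𝓝[>] 0) (𝓝 0) := by
      have : Continuous fun δ : ℝ => δ * z.re := by fun_prop
      simpa using (this.tendsto 0).mono_left nhdsWithin_le_nhds
    refine ge_of_tendsto h1 ?_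
    filter_upwards [self_mem_nhdsWithin] with δ hδ using h δ hδ
  intro δ hδ
  set f : ℂ → ℂ := fun z => Complex.exp (σ * cvel V z - δ * z) with hf
  have hnorm : ∀ z, ‖f z‖ = Real.exp (σ * V (reflPt z) 0 - δ * z.re) := fun z => by
    rw [hf, Complex.norm_exp]
    simp [cvel_re]
  have hle : ∀ z : ℂ, σ * V (reflPt z) 0 ≤ ‖V (reflPt z)‖ := fun z => by
    refine (le_abs_self _).trans ?_
    rw [abs_mul, hσ, one_mul]
    exact abs_apply_le_norm _ 0
  have key : ‖f z‖ ≤ 1 := by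
    refine PhragmenLindelof.right_half_plane_of_tendsto_zero_on_real ?_ ?_ ?_ ?_ hz
    · refine ⟨fun w hw => ?_, ?_⟩
      · have := differentiableAt_cvel hV hdiv hω hw
        exact (((this.const_mul _).sub (differentiableAt_id.const_mul _)).cexp).differentiableWithinAt
      · rw [Complex.closure_setOfPred_lt_re]
        exact Complex.continuous_exp.comp_continuousOn
          ((continuousOn_const.mul hcc).sub (continuousOn_const.mul continuousOn_id))
    · refine ⟨1, by norm_num, 1, ?_⟩
      refine Asymptotics.IsBigO.of_bound 1 ?_
      have hmono : Bornology.cobounded ℂ ⊓ 𝓟 {z : ℂ | 0 < z.re}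
          ≤ Bornology.cobounded ℂ ⊓ 𝓟 {z : ℂ | 0 ≤ z.re} :=
        inf_le_inf_left _ (principal_mono.2 fun z hz => (show 0 < z.re from hz).le)
      filter_upwards [hmono (hsmall 1 one_pos), mem_inf_of_right (mem_principal_self _)]
        with w h1 h2
      have h3 : 0 < w.re := h2
      rw [hnorm, one_mul, Real.norm_of_nonneg (Real.exp_pos _).le, Real.rpow_one, one_mul]
      refine Real.exp_le_exp.2 ?_
      have := hle w
      have := mul_pos hδ h3
      linarith
    · rw [tendsto_zero_iff_norm_tendsto_zero]
      simp only [hnorm]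
      have hreal : Tendsto (fun x : ℝ => (x : ℂ)) atTop
          (Bornology.cobounded ℂ ⊓ 𝓟 {z : ℂ | 0 ≤ z.re}) := by
        refine tendsto_inf.2 ⟨?_, ?_⟩
        · rw [← tendsto_norm_atTop_iff_cobounded]
          simpa using tendsto_abs_atTop_atTop
        · refine tendsto_principal.2 ?_
          filter_upwards [eventually_ge_atTop 0] with x hx
          simpa using hx
      refine Real.tendsto_exp_atBot.comp ?_
      have h1 : Tendsto (fun x : ℝ => -(δ / 2) * x) atTop atBot :=
        tendsto_id.const_mul_atTop_of_neg (by linarith)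
      refine tendsto_atBot_mono' _ ?_ h1
      filter_upwards [hreal.eventually (hsmall (δ / 2) (by linarith)), eventually_ge_atTop 0]
        with x hx hx0
      have h2 := hle x
      rw [Complex.norm_real, Real.norm_of_nonneg hx0] at hx
      simp only [Complex.ofReal_re]
      linarith
    · intro x
      have h1 : V (reflPt (x * Complex.I)) 0 = 0 := hbd _ (by rw [reflPt_apply]; simp)
      rw [hnorm, h1]
      simp
  rw [hnorm, Real.exp_le_one_iff] at key
  linarith

/-- A profile with sublinear growth and bounded gradient, which solves the self-similar planar
equations and is odd, vanishes. -/
theorem profile_eq_zero (hV : ContDiffOn ℝ 2 V halfPlane)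
    {C : ℝ} (hC : ∀ y ∈ halfPlane, ‖gradV V y‖ ≤ C)
    (hlin : Tendsto (fun y => ‖V y‖ / ‖y‖) (Bornology.cobounded E2 ⊓ 𝓟 halfPlane) (𝓝 0))
    (hodd : ∀ y ∈ halfPlane, V !₂[y 0, -(y 1)] 2 = -(V y 2))
    (hang : ∀ y : E2, y 0 < 0 → V y 1 = 0)
    (hbd : ∀ y : E2, y 0 = 0 → V y 0 = 0)
    (hdiv : ∀ y : E2, y 0 < 0 → gradV V y bx 0 + gradV V y bz 2 = 0)
    (htr : ∀ y ∈ halfPlane,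
      fderivWithin ℝ (vort V) halfPlane y (transportField α V y) + vort V y = 0) :
    ∀ y ∈ halfPlane, V y = 0 := by
  have hω := vort_eq_zero hV hC hbd htr
  have hrad : ∀ y ∈ halfPlane, V y 0 = 0 := by
    intro y hy
    have hy' : y 0 ≤ 0 := hy
    obtain ⟨z, hz, rfl⟩ : ∃ z : ℂ, 0 ≤ z.re ∧ reflPt z = y :=
      ⟨⟨-(y 0), y 1⟩, by simpa using hy', by
        rw [reflPt_apply]; ext i; fin_cases i <;> simp⟩
    have h1 := profile_radial_nonpos (σ := 1) (by simp) hV hlin hbd hdiv hω hz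
    have h2 := profile_radial_nonpos (σ := -1) (by simp) hV hlin hbd hdiv hω hz
    linarith
  have hd : ∀ y : E2, y 0 < 0 → HasFDerivAt V (gradV V y) y := fun y hy =>
    (hV.differentiableOn (by norm_num) y
      (openHalf_subset hy)).hasFDerivWithinAt.hasFDerivAt (halfPlane_mem_nhds hy)
  -- the gradient of the vertical component vanishes, by the two first order equations
  have hgrad : ∀ y : E2, y 0 < 0 → ∀ e : E2, gradV V y e 2 = 0 := by
    intro y hy e
    have h0 : ∀ e : E2, gradV V y e 0 = 0 := fun e => by
      have h1 := hasFDerivAt_apply (hd y hy) 0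
      have h2 : (fun y => V y 0) =ᶠ[𝓝 y] fun _ => 0 := by
        filter_upwards [halfPlane_mem_nhds hy] with w hw using hrad w hw
      have h3 := h1.unique ((hasFDerivAt_const (0 : ℝ) y).congr_of_eventuallyEq h2)
      simpa using congrArg (fun L => L e) h3
    have h1 := hdiv y hy
    have h2 := hω y (openHalf_subset hy)
    rw [vort, h0] at h2
    rw [h0] at h1
    have he : e = e 0 • bx + e 1 • bz := by ext i; fin_cases i <;> simp
    rw [he, map_add, map_smul, map_smul]
    simp only [PiLp.add_apply, PiLp.smul_apply, smul_eq_mul]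
    rw [show gradV V y bx 2 = 0 by linarith, show gradV V y bz 2 = 0 by linarith]
    simp
  have hconv : Convex ℝ {y : E2 | y 0 < 0} := by
    intro x hx y hy s t hs ht hst
    have hx' : x 0 < 0 := hx
    have hy' : y 0 < 0 := hy
    change (s • x + t • y) 0 < 0
    simp only [PiLp.add_apply, PiLp.smul_apply, smul_eq_mul]
    rcases hs.eq_or_lt with h | h
    · subst h; simp at hst; subst hst; simpa using hy'
    · nlinarith
  have hint : ∀ y ∈ {y : E2 | y 0 < 0}, V y = 0 := by
    intro y hy
    have hyr : !₂[y 0, -(y 1)] ∈ {y : E2 | y 0 < 0} := by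
      have : y 0 < 0 := hy
      change (!₂[y 0, -(y 1)] : E2) 0 < 0
      simpa using this
    have hconst : V !₂[y 0, -(y 1)] 2 = V y 2 := by
      refine hconv.is_const_of_fderivWithin_eq_zero (𝕜 := ℝ) (f := fun y => V y 2)
        (fun w hw => (hasFDerivAt_apply (hd w hw) 2).differentiableAt.differentiableWithinAt)
        (fun w hw => ?_) hyr hy
      rw [fderivWithin_of_isOpen isOpen_openHalf hw, (hasFDerivAt_apply (hd w hw) 2).fderiv]
      ext e
      simpa using hgrad w hw e
    have h1 := hodd y (openHalf_subset hy)
    have h2 : V y 2 = 0 := by linarith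
    ext i
    fin_cases i
    · simpa using hrad y (openHalf_subset hy)
    · simpa using hang y hy
    · simpa using h2
  intro y hy
  have : EqOn V (fun _ => 0) halfPlane :=
    EqOn.of_subset_closure (fun y hy => hint y hy) hV.continuousOn continuousOn_const
      openHalf_subset halfPlane_subset_closure
  exact this hy

end Liouville

/-- No solution is asymptotically self-similar around the boundary point, with a profile of
sublinear growth, bounded gradient and odd vertical component. -/
theorem not_isBoundaryASSS {α a b d T₀ : ℝ} (hα : α ∈ Ioo (0 : ℝ) 1) (ha : a < 0) (hb : 0 < b)
    (hd : d < 1) (hT : 0 < T₀) {v : E3 → ℝ → E3} {p : E3 → ℝ → ℝ} {V : E2 → E3} {W : E3 → ℝ → E3}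
    (hsol : IsAxisymEulerSolution a b T₀ v p) (hS : IsBoundaryASSS α a b d T₀ v V W)
    (hV : ContDiffOn ℝ 2 V halfPlane)
    (hlin : Tendsto (fun y => ‖V y‖ / ‖y‖) (Bornology.cobounded E2 ⊓ 𝓟 halfPlane) (𝓝 0))
    (hgrad : ∃ C : ℝ, ∀ y ∈ halfPlane, ‖fderivWithin ℝ V halfPlane y‖ ≤ C)
    (hodd : ∀ y ∈ halfPlane, V !₂[y 0, -(y 1)] 2 = -(V y 2)) : False := by
  obtain ⟨C, hC⟩ := hgrad
  obtain ⟨y, hy, hne⟩ := hS.1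
  have heq := profile_transport (α := α) hV fun U₀ U₂ h₀ h₂ =>
    profile_equations hα ha hb hd hT hsol hS hV h₀ h₂
  exact hne (profile_eq_zero hV hC hlin hodd
    (fun y hy => profile_angular_eq_zero hα ha hb hd hT hsol hS hV.continuousOn hy)
    (fun y hy => profile_radial_boundary hα.2 ha hb hd hT hsol hS hV.continuousOn hy)
    heq.1 heq.2 y hy)

end AxiEuler

theorem mainTheorem2 (α : ℝ) (hα : α ∈ Ioo (0 : ℝ) 1) :
    -- (1): profile around the origin, near maximal points near the side boundary
    (¬ ∃ (γ a b T₀ : ℝ) (v : E3 → ℝ → E3) (p : E3 → ℝ → ℝ) (V : E3 → E3) (W : E3 → ℝ → E3)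
        (x : ℕ → E3) (t Q : ℕ → ℝ),
        γ ∈ Ioo (0 : ℝ) 1 ∧ a < 0 ∧ 0 < b ∧ 0 < T₀ ∧
        IsAxisymEulerSolution a b T₀ v p ∧
        IsASSS α a b T₀ v V W ∧
        IsC2Holder γ V ∧ IsC21Holder γ (cyl a b) (Ico 0 T₀) W ∧
        IsHolderOn γ univ (fun y => ‖y‖ * gradNorm V y) ∧
        IsHolderOn γ univ (fun y => ‖y‖ ^ 2 * hessNorm V y) ∧
        IsBlowupPoints a b T₀ v x t ∧ IsScale v x t Q ∧
        IsNearMaximal a b v x t ∧ IsNearSide α x Q ∧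
        HasOddLimits α a b v x t Q) ∧
    -- (2): profile around the boundary point, with sublinear growth
    (¬ ∃ (γ a b d T₀ : ℝ) (v : E3 → ℝ → E3) (p : E3 → ℝ → ℝ) (V : E2 → E3) (W : E3 → ℝ → E3)
        (x : ℕ → E3) (t Q : ℕ → ℝ),
        γ ∈ Ioo (0 : ℝ) 1 ∧ a < 0 ∧ 0 < b ∧ 0 ≤ d ∧ d < 1 ∧ 0 < T₀ ∧
        IsAxisymEulerSolution a b T₀ v p ∧
        IsBoundaryASSS α a b d T₀ v V W ∧
        IsC2HolderLocOn γ halfPlane V ∧ IsC21HolderLoc γ (cylOff a b d) (Ico 0 T₀) W ∧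
        IsBlowupPoints a b T₀ v x t ∧ IsScale v x t Q ∧
        IsAnchor α a b T₀ v x t Q ∧ IsNearSide α x Q ∧
        Tendsto (fun y => ‖V y‖ / ‖y‖) (Bornology.cobounded E2 ⊓ 𝓟 halfPlane) (𝓝 0) ∧
        (∃ C : ℝ, ∀ y ∈ halfPlane, ‖fderivWithin ℝ V halfPlane y‖ ≤ C) ∧
        (∀ y ∈ halfPlane, V !₂[y 0, -(y 1)] 2 = -(V y 2))) := by
  refine ⟨?_, ?_⟩
  · rintro ⟨γ, a, b, T₀, v, p, V, W, x, t, Q, -, ha, hb, hT, hsol, hS, hV, -, hgrad, -, hx, hQ, hm,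
      hside, hodd⟩
    exact not_isASSS hα ha hb hT hsol hS hV hgrad hx hQ hm hside hodd
  · rintro ⟨γ, a, b, d, T₀, v, p, V, W, x, t, Q, -, ha, hb, -, hd, hT, hsol, hS, hV, -, -, -, -, -,
      hlin, hgrad, hodd⟩
    exact not_isBoundaryASSS hα ha hb hd hT hsol hS hV.1 hlin hgrad hodd
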